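/- **Setting.** All manifolds, bundles, sections and forms are smooth, vector bundles are real of finite rank; $M$ is a finite-dimensional Hausdorff second countable manifold without boundary. Let $A\hookrightarrow L$ be a *Lie pair* over $M$, i.e. $L$ and $A$ are Lie algebroids over $M$ and $A\to L$ is an injective vector bundle morphism over $\mathrm{id}_M$ compatible with anchors and brackets. Let $A^\circ\subset L^*$ be the annihilator of $A$, so that $A^\circ\cong (L/A)^*$, and put $\Omega^k(A,V)=\Gamma(\wedge^kA^*\otimes V)$. Let $E=\bigoplus_{i\in\mathbb Z}E_i$ be a graded vector bundle with finitely many nonzero $E_i$. Write $\mathrm{End}_j(E)$ for the endomorphisms of degree $j$. An *$A$-superconnection* on $E$ is an operator $D=\partial+d^\nabla+\sum_{k\ge2}\omega^{(k)}\wedge\cdot$ on $\Omega^\bullet(A,E)$, where $\nabla$ is a degree-preserving $A$-connection on $E$, $d^{\nabla}$ its exterior covariant derivative, $\partial=\omega^{(0)}\in\Gamma(\mathrm{End}_1(E))$ and $\omega^{(k)}\in\Omega^k(A,\mathrm{End}_{1-k}(E))$; the sign rule is $(\eta\otimes\phi)\wedge(\theta\otimes e)=(-1)^{iq}(\eta\wedge\theta)\otimes\phi(e)$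 for $\phi$ of degree $i$ and $\theta$ of form degree $q$. A *homotopy $A$-module* is a pair $(E,D_A)$ with $D_A$ an $A$-superconnection such that $D_A^2=0$; then $\partial^2=0$. It is *regular* if $\partial$ has constant rank. $L$-superconnections are defined likewise (with forms on $L$), and $D_L$ *extends* $D_A$ if restricting the components $\nabla,\omega^{(k)}$ of $D_L$ to sections of $A$ gives those of $D_A$. Let $\widehat\Omega(E)=\bigoplus_{k,j}\Omega^k(A,A^\circ\otimes\mathrm{End}_j(E))$, with total degree $k+j$, and let $s=\sum_k s^{(k)}$ be the operator on it whose component $s^{(1)}=d^{\widehat\nabla}$ is the exterior covariant derivative of $(\widehat\nabla_a\varphi)(l)=[\nabla_a,\varphi(l)]-\varphi([a,l])$ (for $a\in\Gamma(A)$, $l\in\Gamma(L)$, and $\varphi\in\Gamma(A^\circ\otimes\mathrm{End}(E))$ read as a map $L\to\mathrm{End}(E)$ vanishing on $A$), and for $k\ne1$, $\varpi\in\Omega^p(A,A^\circ\otimes\mathrm{End}(E))$, $$s^{(k)}(\varpi)(a_1,\dots,a_{k+p};l)=(-1)^{(1-k)(p+1)}\sum_{\sigma}\mathrm{sgn}(\sigma)\,\big[\omega_A^{(k)}(a_{\sigma(1)},\dots,a_{\sigma(k)}),\varpi(a_{\sigma(k+1)},\dots,a_{\sigma(k+p)};l)\big],$$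 the sum being over $(k,p)$-shuffles and $[\cdot,\cdot]$ being the graded commutator of $\mathrm{End}(E)$. **Theorem.** Let $A\hookrightarrow L$ be a Lie pair, and let $(E,D_A)$ be a regular homotopy $A$-module with $E_i=0$ for $i>0$, such that the complex $(E,\partial)$ is exact in all degrees $i<0$. Let $K=E_0/\partial(E_{-1})$ be its cohomology in degree $0$, with the $A$-connection $\nabla^K_a[e]=[\nabla_a e]$. Then: 1. $s$ is an $A$-superconnection on $A^\circ\otimes\mathrm{End}(E)$ with $s^2=0$, and $\nabla^K$ is flat. Write $\widehat H^p(E,s)$ for the cohomology of $(\widehat\Omega(E),s)$ in total degree $p$, and $H^p(A,A^\circ\otimes\mathrm{End}(K))$ for the cohomology of $\Omega^\bullet(A,A^\circ\otimes\mathrm{End}(K))$ under the exterior covariant derivative of $(\widehat\nabla^K_a\varphi)(l)=[\nabla^K_a,\varphi(l)]-\varphi([a,l])$. 2. $\widehat H^p(E,s)=0$ for all $p<0$, and there are isomorphisms of real vector spaces $\Phi^p:\widehat H^p(E,s)\to H^p(A,A^\circ\otimes\mathrm{End}(K))$ for all $p\in\mathbb Z$ such that: if $\varpi=\sum_k\varpi^{(k)}$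 is a cocycle of total degree $p$ whose components of form degree $k<p$ vanish, then $\Phi^p([\varpi])$ is the class of the form $\overline\varpi$ with $\overline\varpi(a_1,\dots,a_p;l)([e])=[\varpi^{(p)}(a_1,\dots,a_p;l)(e)]$ for $e\in\Gamma(E_0)$ (of the form $0$ if $p<0$). 3. There exist $L$-superconnections $D_L$ on $E$ extending $D_A$, and $L$-connections $\nabla^{K,L}$ on $K$ extending $\nabla^K$. For every choice of them, the following forms are well-defined cocycles of degree $1$: $$\alpha_E=\sum_k\alpha^{(k)},\quad\alpha^{(k)}(a_1,\dots,a_k;l)(e)=(D_L^2e)(a_1,\dots,a_k,l),\qquad \mathrm{at}_K(a;l)=[\nabla^{K,L}_a,\nabla^{K,L}_l]-\nabla^{K,L}_{[a,l]},$$ where $a,a_i\in\Gamma(A)$, $l\in\Gamma(L)$, $e\in\Gamma(E)$; and $\Phi^1([\alpha_E])=[\mathrm{at}_K]$. That is, the isomorphism $\Phi^1$ sends the Atiyah class of $E$ to the Atiyah class of the $A$-module $K$. -/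

import Mathlib

set_option linter.unusedSectionVars false
set_option linter.unusedVariables false

open scoped Manifold ContDiff

namespace HomotopyModules

open Function Bundle
open scoped TensorProduct

/-- The module of `R`-linear endomorphisms of `N`; for `N = Γ(E)` it is `Γ(End(E))`. -/
abbrev EndMod (R N : Type*) [CommRing R] [AddCommGroup N] [Module R N] : Type _ := N →ₗ[R] N

/-- The Lie-Rinehart structure carried by the module of sections `A = Γ(𝒜)` of a Lie algebroid, over
`R = C^∞(M)`: an `R`-linear anchor with values in derivations of `R` and a Lie bracket with
`[a, f b] = f [a, b] + ρ(a)(f) b` (the Leibniz rule makes the bracket `ℝ`-bilinear). -/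
structure LieRinehart (R A : Type*) [CommRing R] [Algebra ℝ R] [AddCommGroup A] [Module R A] where
  anchor : A →ₗ[R] Derivation ℝ R R
  bracket : A → A → A
  bracket_add_left : ∀ a b c, bracket (a + b) c = bracket a c + bracket b c
  bracket_add_right : ∀ a b c, bracket a (b + c) = bracket a b + bracket a c
  bracket_self : ∀ a, bracket a a = 0
  bracket_smul : ∀ (a : A) (f : R) (b : A),
    bracket a (f • b) = f • bracket a b + anchor a f • b
  jacobi : ∀ a b c, bracket a (bracket b c) = bracket (bracket a b) c + bracket b (bracket a c)
  anchor_bracket : ∀ a b f,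
    anchor (bracket a b) f = anchor a (anchor b f) - anchor b (anchor a f)

section
variable {R A N : Type*} [CommRing R] [Algebra ℝ R] [AddCommGroup A] [Module R A]
  [AddCommGroup N] [Module R N]

/-- A connection along `g` on the `R`-module `N`: an operator `∇_a e`, `R`-linear in `a`, additive in
`e`, with `∇_a (f e) = f ∇_a e + ρ(a)(f) e` (so it is `ℝ`-bilinear). For `A = Γ(𝒜)` and `N = Γ(E)`
these are exactly the `𝒜`-connections on the vector bundle `E`. -/
structure LieRinehart.Connection (g : LieRinehart R A) (N : Type*) [AddCommGroup N]
    [Module R N] where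
  nabla : A → N → N
  add_left : ∀ a b e, nabla (a + b) e = nabla a e + nabla b e
  smul_left : ∀ (f : R) a e, nabla (f • a) e = f • nabla a e
  add_right : ∀ a e e', nabla a (e + e') = nabla a e + nabla a e'
  leibniz : ∀ a (f : R) e, nabla a (f • e) = f • nabla a e + g.anchor a f • e

namespace LieRinehart
variable (g : LieRinehart R A)

theorem bracket_skew (a b : A) : g.bracket a b = - g.bracket b a := by
  have h := g.bracket_self (a + b)
  rw [g.bracket_add_left, g.bracket_add_right, g.bracket_add_right, g.bracket_self, g.bracket_self,
    zero_add, add_zero] at h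
  exact eq_neg_of_add_eq_zero_left h

theorem bracket_smul_left (a b : A) (f : R) :
    g.bracket (f • a) b = f • g.bracket a b - g.anchor b f • a := by
  rw [g.bracket_skew, g.bracket_smul, g.bracket_skew a b, smul_neg, neg_add, sub_eq_add_neg]

namespace Connection
variable {g} (D : g.Connection N)
theorem zero_right (a : A) : D.nabla a 0 = 0 := by simpa using D.add_right a 0 0
theorem neg_right (a : A) (e : N) : D.nabla a (-e) = - D.nabla a e := by
  rw [eq_neg_iff_add_eq_zero, ← D.add_right]; simp [D.zero_right]

/-- The Lie derivative `(L_a u)(v) = ∇_a (u(v)) - ∑ i, u(v_1, …, [a, v_i], …, v_p)` of a form.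
Only used to check that the exterior covariant derivative below is alternating and `R`-multilinear. -/
def lieDer {p : ℕ} (a : A) (u : A [⋀^Fin p]→ₗ[R] N) : A [⋀^Fin p]→ₗ[R] N where
  toFun v := D.nabla a (u v) - ∑ i, u (update v i (g.bracket a (v i)))
  map_update_add' {inst} v i x y := by
    obtain rfl : inst = instDecidableEqFin p := Subsingleton.elim _ _
    have h : ∀ z : A, (∑ j, u (update (update v i z) j (g.bracket a (update v i z j))))
        = u (update v i (g.bracket a z))
          + ∑ j ∈ Finset.univ.erase i, u (update (update v j (g.bracket a (v j))) i z) := by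
      intro z
      rw [← Finset.add_sum_erase _ _ (Finset.mem_univ i)]
      congr 1
      · simp
      · refine Finset.sum_congr rfl fun j hj => ?_
        have hj := Finset.ne_of_mem_erase hj
        rw [update_of_ne hj, update_comm hj.symm]
    rw [h, h, h]
    simp only [u.map_update_add, D.add_right, g.bracket_add_right, Finset.sum_add_distrib]
    abel
  map_update_smul' {inst} v i f x := by
    obtain rfl : inst = instDecidableEqFin p := Subsingleton.elim _ _
    have h : ∀ z : A, (∑ j, u (update (update v i z) j (g.bracket a (update v i z j))))
        = u (update v i (g.bracket a z))
          + ∑ j ∈ Finset.univ.erase i, u (update (update v j (g.bracket a (v j))) i z) := by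
      intro z
      rw [← Finset.add_sum_erase _ _ (Finset.mem_univ i)]
      congr 1
      · simp
      · refine Finset.sum_congr rfl fun j hj => ?_
        have hj := Finset.ne_of_mem_erase hj
        rw [update_of_ne hj, update_comm hj.symm]
    rw [h, h]
    simp only [u.map_update_add, u.map_update_smul, D.leibniz, g.bracket_smul,
      ← Finset.smul_sum, smul_sub, smul_add]
    abel
  map_eq_zero_of_eq' v i j hv hij := by
    have hs : (∑ k, u (update v k (g.bracket a (v k)))) =
        u (update v i (g.bracket a (v i))) + u (update v j (g.bracket a (v j))) := by
      refine Fintype.sum_eq_add _ _ hij fun k ⟨hki, hkj⟩ ↦ ?_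
      refine u.map_eq_zero_of_eq _ ?_ hij
      rw [update_of_ne hki.symm, update_of_ne hkj.symm, hv]
    have h2 : u (update v j (g.bracket a (v j))) = - u (update v i (g.bracket a (v i))) := by
      rw [← u.map_swap _ hij]
      congr 1
      funext k
      simp only [comp]
      by_cases hk : k = i
      · subst hk; simp [hv, update_of_ne hij, update_of_ne hij.symm]
      by_cases hk' : k = j
      · subst hk'; simp [hv]
      · simp [Equiv.swap_apply_of_ne_of_ne hk hk', hk, hk']
    rw [hs, h2, u.map_eq_zero_of_eq _ hv hij, D.zero_right]; simp

/-- The exterior covariant derivative `d^∇ u`, by the formula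
`∑ i, (-1)^i ∇_{v_i} (u(…, v̂_i, …)) + ∑ i < j, (-1)^(i+j) u([v_i, v_j], …, v̂_i, …, v̂_j, …)`,
where in the second sum `[v_i, v_j]` has been moved to the slot of `v_i`, which absorbs `(-1)^i`. -/
def extDerivFun {p : ℕ} (u : A [⋀^Fin p]→ₗ[R] N) (v : Fin (p + 1) → A) : N :=
  (∑ i : Fin (p + 1), (-1 : ℤ) ^ (i : ℕ) • D.nabla (v i) (u (i.removeNth v))) +
    ∑ j : Fin (p + 1), ∑ i : Fin p, if i.castSucc < j then
      (-1 : ℤ) ^ (j : ℕ) • u (update (j.removeNth v) i (g.bracket (v i.castSucc) (v j))) else 0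

theorem exists_uncurry {n : ℕ} (F : A →ₗ[R] A [⋀^Fin n]→ₗ[R] N)
    (hF : ∀ a b j, b j = a → F a b = 0) :
    ∃ w : A [⋀^Fin (n + 1)]→ₗ[R] N, ∀ v, w v = F (v 0) (Fin.tail v) := by
  refine ⟨{ LinearMap.uncurryLeft (AlternatingMap.toMultilinearMapLM ∘ₗ F) with
    map_eq_zero_of_eq' := ?_ }, ?_⟩
  · intro v i j hv hij
    change F (v 0) (Fin.tail v) = 0
    rcases Fin.eq_zero_or_eq_succ i with rfl | ⟨i, rfl⟩
    · rcases Fin.eq_zero_or_eq_succ j with rfl | ⟨j, rfl⟩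
      · exact absurd rfl hij
      · exact hF _ _ j hv.symm
    · rcases Fin.eq_zero_or_eq_succ j with rfl | ⟨j, rfl⟩
      · exact hF _ _ i hv
      · exact (F (v 0)).map_eq_zero_of_eq _ hv (fun h => hij (by rw [h]))
  · intro v; rfl

theorem map_cons_removeNth {p : ℕ} (u : A [⋀^Fin (p + 1)]→ₗ[R] N) (x : A) (b : Fin (p + 1) → A)
    (j : Fin (p + 1)) :
    u (Fin.cons x (j.removeNth b)) = (-1 : ℤ) ^ (j : ℕ) • u (update b j x) := by
  have h := u.map_insertNth j x (j.removeNth b)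
  rw [Fin.insertNth_removeNth] at h
  rw [h, smul_smul, ← pow_add, Even.neg_one_pow ⟨_, rfl⟩, one_smul]
  rfl

theorem extDerivFun_cons {p : ℕ} (u : A [⋀^Fin (p + 1)]→ₗ[R] N) (a : A) (b : Fin (p + 1) → A) :
    D.extDerivFun u (Fin.cons a b) = D.lieDer a u b - D.extDerivFun (u.curryLeft a) b := by
  have hr : ∀ i : Fin (p + 1), i.succ.removeNth (Fin.cons a b : Fin (p + 2) → A)
      = (Fin.cons a (i.removeNth b) : Fin (p + 1) → A) := by
    intro i
    funext k
    refine Fin.cases ?_ (fun k => ?_) k <;> simp [Fin.removeNth]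
  have h0 : (0 : Fin (p + 2)).removeNth (Fin.cons a b : Fin (p + 2) → A) = b := by
    funext k; simp [Fin.removeNth]
  have hup : ∀ (j : Fin (p + 1)) (i : Fin p) (z : A),
      update (Fin.cons a (j.removeNth b) : Fin (p + 1) → A) i.succ z
        = Fin.cons a (update (j.removeNth b) i z) := by
    intro j i z; rw [Fin.cons_update]
  have hup0 : ∀ (j : Fin (p + 1)) (z : A),
      update (Fin.cons a (j.removeNth b) : Fin (p + 1) → A) 0 z
        = Fin.cons z (j.removeNth b) := by
    intro j z; rw [Fin.update_cons_zero]
  have hc : ∀ w : Fin p → A, u.curryLeft a w = u (Fin.cons a w) := fun w => rfl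
  have hpow : ∀ (n : ℕ) (x : N), (-1 : ℤ) ^ n • (-1 : ℤ) ^ n • x = x := fun n x => by
    rw [smul_smul, ← pow_add, Even.neg_one_pow ⟨_, rfl⟩, one_smul]
  have inner : ∀ j : Fin (p + 1), (∑ i : Fin (p + 1), if i.castSucc < j.succ then
        (-1 : ℤ) ^ (j.succ : ℕ) • u (update (j.succ.removeNth (Fin.cons a b : Fin (p + 2) → A)) i
          (g.bracket ((Fin.cons a b : Fin (p + 2) → A) i.castSucc)
            ((Fin.cons a b : Fin (p + 2) → A) j.succ))) else 0)
      = - u (update b j (g.bracket a (b j))) - ∑ i : Fin p, if i.castSucc < j then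
        (-1 : ℤ) ^ (j : ℕ) • u.curryLeft a (update (j.removeNth b) i
          (g.bracket (b i.castSucc) (b j))) else 0 := by
    intro j
    have hneg : ∀ (P : Prop) [Decidable P] (x : N), (if P then -x else 0) = -(if P then x else 0) := by
      intro P _ x; split <;> simp
    rw [Fin.sum_univ_succ]
    simp only [hr, hup, hup0, hc, Fin.cons_succ, Fin.cons_zero, Fin.val_succ, pow_succ,
      Fin.castSucc_zero, Fin.succ_pos, if_true, ← Fin.succ_castSucc, Fin.succ_lt_succ_iff,
      map_cons_removeNth, mul_neg_one, neg_smul, hpow, hneg, Finset.sum_neg_distrib]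
    abel
  unfold extDerivFun
  rw [Fin.sum_univ_succ (n := p + 1), Fin.sum_univ_succ (n := p + 1)]
  simp only [inner]
  simp only [hr, h0, hc, Fin.cons_succ, Fin.cons_zero, Fin.val_succ, Fin.val_zero, pow_succ,
    pow_zero, one_smul, Fin.not_lt_zero, if_false, Finset.sum_const_zero, zero_add,
    mul_neg_one, neg_smul, Finset.sum_neg_distrib, Finset.sum_sub_distrib]
  change _ = D.nabla a (u b) - _ - _
  abel

theorem extDerivFun_smul {p : ℕ} (u : A [⋀^Fin p]→ₗ[R] N) (f : R) (v : Fin (p + 1) → A) :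
    D.extDerivFun (f • u) v = f • D.extDerivFun u v +
      ∑ i : Fin (p + 1), (-1 : ℤ) ^ (i : ℕ) • g.anchor (v i) f • u (i.removeNth v) := by
  unfold extDerivFun
  simp only [AlternatingMap.smul_apply, D.leibniz, smul_add, Finset.sum_add_distrib,
    Finset.smul_sum, smul_ite, smul_zero, smul_comm f ((-1 : ℤ) ^ _)]
  abel

theorem extDerivFun_add {p : ℕ} (u u' : A [⋀^Fin p]→ₗ[R] N) (v : Fin (p + 1) → A) :
    D.extDerivFun (u + u') v = D.extDerivFun u v + D.extDerivFun u' v := by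
  unfold extDerivFun
  have h : ∀ (P : Prop) [Decidable P] (x y : N),
    (if P then x + y else 0) = (if P then x else 0) + (if P then y else 0) := by
    intro P _ x y; split <;> simp
  simp only [AlternatingMap.add_apply, D.add_right, smul_add, Finset.sum_add_distrib, h]
  abel

theorem lieDer_cons_self {p : ℕ} (u : A [⋀^Fin (p + 1)]→ₗ[R] N) (a : A) (c : Fin p → A) :
    D.lieDer a u (Fin.cons a c) = D.lieDer a (u.curryLeft a) c := by
  change D.nabla _ _ - _ = D.nabla _ _ - _
  rw [Fin.sum_univ_succ]
  simp only [Fin.cons_zero, g.bracket_self, Fin.cons_succ, ← Fin.cons_update]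
  rw [u.map_coord_zero (m := update _ _ _) 0 (by simp), zero_add]
  rfl

theorem exists_extDeriv : ∀ {p : ℕ} (u : A [⋀^Fin p]→ₗ[R] N),
    ∃ w : A [⋀^Fin (p + 1)]→ₗ[R] N, ⇑w = D.extDerivFun u
  | 0, u => by
    obtain ⟨w, hw⟩ := exists_uncurry (R := R) (A := A) (N := N) (n := 0)
      { toFun := fun a => AlternatingMap.constOfIsEmpty R A (Fin 0) (D.nabla a (u ![]))
        map_add' := fun a b => by ext; simp [D.add_left]
        map_smul' := fun f a => by ext; simp [D.smul_left] } (fun _ _ j => j.elim0)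
    refine ⟨w, funext fun v => ?_⟩
    rw [hw]
    simp [extDerivFun, Subsingleton.elim (Fin.removeNth 0 v) ![]]
  | p + 1, u => by
    choose w hw using fun a => exists_extDeriv (u.curryLeft a)
    have key : ∀ a b, (D.lieDer a u - w a) b = D.extDerivFun u (Fin.cons a b) := by
      intro a b; rw [extDerivFun_cons, ← hw]; rfl
    obtain ⟨W, hW⟩ := exists_uncurry (R := R) (A := A) (N := N) (n := p + 1)
      { toFun := fun a => D.lieDer a u - w a
        map_add' := fun a b => by
          ext c
          rw [AlternatingMap.add_apply, AlternatingMap.sub_apply, AlternatingMap.sub_apply,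
            AlternatingMap.sub_apply, hw, hw, hw, map_add, extDerivFun_add]
          change (D.nabla _ _ - _) - _ = (D.nabla _ _ - _ - _) + (D.nabla _ _ - _ - _)
          simp only [D.add_left, g.bracket_add_left, u.map_update_add, Finset.sum_add_distrib]
          abel
        map_smul' := fun f a => by
          ext c
          rw [AlternatingMap.smul_apply, AlternatingMap.sub_apply, AlternatingMap.sub_apply,
            hw, hw, map_smul, extDerivFun_smul]
          change (D.nabla _ _ - _) - _ = f • (D.nabla _ _ - _ - _)
          have h1 : ∀ i : Fin (p + 1), (u.curryLeft a) (i.removeNth c)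
              = (-1 : ℤ) ^ (i : ℕ) • u (update c i a) := fun i => map_cons_removeNth u a c i
          have hpow : ∀ (n : ℕ) (r : R) (x : N),
              (-1 : ℤ) ^ n • r • (-1 : ℤ) ^ n • x = r • x := fun n r x => by
            rw [smul_comm r, smul_smul, ← pow_add, Even.neg_one_pow ⟨_, rfl⟩, one_smul]
          simp only [D.smul_left, g.bracket_smul_left, u.map_update_sub, u.map_update_smul,
            Finset.sum_sub_distrib, h1, hpow, smul_sub, Finset.smul_sum]
          abel } (fun a b j hj => by
          have h1 := (D.lieDer a u - w a).map_insertNth j a (j.removeNth b)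
          rw [← hj, Fin.insertNth_self_removeNth, hj] at h1
          change (D.lieDer a u - w a) b = 0
          rw [h1]
          change _ • (D.lieDer a u - w a) (Fin.cons a (j.removeNth b)) = 0
          rw [AlternatingMap.sub_apply, hw, lieDer_cons_self]
          generalize j.removeNth b = c
          have : D.extDerivFun (u.curryLeft a) (Fin.cons a c) = D.lieDer a (u.curryLeft a) c := by
            cases p with
            | zero =>
              simp [extDerivFun, lieDer, Subsingleton.elim c ![]]
            | succ p =>
              rw [extDerivFun_cons, AlternatingMap.curryLeft_same]
              simp [extDerivFun, D.zero_right]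
          rw [this, sub_self, smul_zero])
    refine ⟨W, funext fun v => ?_⟩
    rw [hW, ← Fin.cons_self_tail v]
    exact key _ _

/-- The exterior covariant derivative `d^∇ : Ω^p(A, N) → Ω^(p+1)(A, N)`, where `Ω^p(A, N)` is the
module of alternating `R`-multilinear maps `A^p → N`. -/
def extDeriv {p : ℕ} (u : A [⋀^Fin p]→ₗ[R] N) : A [⋀^Fin (p + 1)]→ₗ[R] N where
  toFun := D.extDerivFun u
  map_update_add' v i x y := by
    obtain ⟨w, hw⟩ := D.exists_extDeriv u
    simp only [← hw, w.map_update_add]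
  map_update_smul' v i f x := by
    obtain ⟨w, hw⟩ := D.exists_extDeriv u
    simp only [← hw, w.map_update_smul]
  map_eq_zero_of_eq' v i j hv hij := by
    obtain ⟨w, hw⟩ := D.exists_extDeriv u
    simp only [← hw, w.map_eq_zero_of_eq v hv hij]

theorem extDeriv_add {p : ℕ} (u u' : A [⋀^Fin p]→ₗ[R] N) :
    D.extDeriv (u + u') = D.extDeriv u + D.extDeriv u' :=
  AlternatingMap.ext fun v => D.extDerivFun_add u u' v

theorem extDeriv_real_smul [Module ℝ N] [IsScalarTower ℝ R N] {p : ℕ} (c : ℝ)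
    (u : A [⋀^Fin p]→ₗ[R] N) : D.extDeriv (c • u) = c • D.extDeriv u := by
  ext v
  have h := D.extDerivFun_smul u (algebraMap ℝ R c) v
  have hu : algebraMap ℝ R c • u = c • u := by ext w; simp
  simp only [hu, Derivation.map_algebraMap, zero_smul, smul_zero, Finset.sum_const_zero,
    add_zero, algebraMap_smul] at h
  exact h

/-- The exterior covariant derivative on `Ω^•(A, N)`. -/
def extDerivTotal [Module ℝ N] [IsScalarTower ℝ R N] :
    (∀ k : ℕ, A [⋀^Fin k]→ₗ[R] N) →ₗ[ℝ] (∀ k : ℕ, A [⋀^Fin k]→ₗ[R] N) where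
  toFun u
    | 0 => 0
    | k + 1 => D.extDeriv (u k)
  map_add' u u' := by
    funext k
    cases k with
    | zero => simp
    | succ k => exact D.extDeriv_add _ _
  map_smul' c u := by
    funext k
    cases k with
    | zero => simp
    | succ k => exact D.extDeriv_real_smul _ _

/-- The induced connection `[∇, ·]` on endomorphisms. -/
def onEnd : g.Connection (EndMod R N) where
  nabla a f :=
    { toFun := fun e => D.nabla a (f e) - f (D.nabla a e)
      map_add' := fun e e' => by simp only [map_add, D.add_right]; abel
      map_smul' := fun r e => by
        simp only [map_smul, map_add, D.leibniz, RingHom.id_apply, smul_sub]; abel }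
  add_left a b f := by ext e; simp [D.add_left]; abel
  smul_left r a f := by ext e; simp [D.smul_left, smul_sub]
  add_right a f f' := by ext e; simp [D.add_right]; abel
  leibniz a r f := by ext e; simp [D.leibniz, smul_sub]; abel

end Connection

variable {L : Type*} [AddCommGroup L] [Module R L]

/-- A morphism of Lie-Rinehart structures over the same ring `R`. -/
structure Hom (gA : LieRinehart R A) (gL : LieRinehart R L) extends A →ₗ[R] L where
  anchor_map : ∀ a, gL.anchor (toLinearMap a) = gA.anchor a
  bracket_map : ∀ a b, toLinearMap (gA.bracket a b) = gL.bracket (toLinearMap a) (toLinearMap b)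

variable {gA : LieRinehart R A} {gL : LieRinehart R L}

/-- `Γ(A° ⊗ P)`: the `R`-linear maps `φ : L → P` that vanish on `A`. -/
def Hom.annihilator (ι : Hom gA gL) (P : Type*) [AddCommGroup P] [Module R P] :
    Submodule R (L →ₗ[R] P) where
  carrier := {f | ∀ a, f (ι.toLinearMap a) = 0}
  add_mem' hf hf' a := by simp [hf a, hf' a]
  zero_mem' a := rfl
  smul_mem' r f hf a := by simp [hf a]

/-- The tensor product of the dual Bott connection on `A°` and of a connection on `N`:
`(∇_a φ)(l) = ∇_a (φ(l)) - φ([a, l])`. -/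
def Connection.onAnnihilator (D : gA.Connection N) (ι : Hom gA gL) :
    gA.Connection (ι.annihilator N) where
  nabla a f := ⟨
    { toFun := fun l => D.nabla a (f.1 l) - f.1 (gL.bracket (ι.toLinearMap a) l)
      map_add' := fun l l' => by
        simp only [map_add, D.add_right, gL.bracket_add_right]; abel
      map_smul' := fun r l => by
        simp only [map_smul, map_add, D.leibniz, gL.bracket_smul, RingHom.id_apply, smul_sub,
          ι.anchor_map]
        abel },
    fun b => by
      change D.nabla a (f.1 _) - f.1 _ = 0
      rw [f.2, ← ι.bracket_map, f.2, D.zero_right, sub_zero]⟩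
  add_left a b f := by
    ext l; simp [D.add_left, gL.bracket_add_left]; abel
  smul_left r a f := by
    have h := f.2 a
    ext l; simp [D.smul_left, gL.bracket_smul_left, smul_sub, h]
  add_right a f f' := by ext l; simp [D.add_right]; abel
  leibniz a r f := by ext l; simp [D.leibniz, smul_sub]; abel

/-- `Γ(A° ⊗ End(N))`: the `R`-linear maps `L → End(N)` that vanish on `A`. -/
def Hom.AnnEnd (ι : Hom gA gL) (N : Type*) [AddCommGroup N] [Module R N] : Type _ :=
  ι.annihilator (EndMod R N)

namespace Hom.AnnEnd
variable (ι : Hom gA gL) (N)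
instance : AddCommGroup (ι.AnnEnd N) := inferInstanceAs (AddCommGroup (ι.annihilator (EndMod R N)))
instance : Module R (ι.AnnEnd N) := inferInstanceAs (Module R (ι.annihilator (EndMod R N)))
instance [Module ℝ N] [IsScalarTower ℝ R N] : Module ℝ (ι.AnnEnd N) :=
  inferInstanceAs (Module ℝ (ι.annihilator (EndMod R N)))
instance [Module ℝ N] [IsScalarTower ℝ R N] : IsScalarTower ℝ R (ι.AnnEnd N) :=
  inferInstanceAs (IsScalarTower ℝ R (ι.annihilator (EndMod R N)))
variable {ι N}
/-- An element of `Γ(A° ⊗ End(N))` as a map `L → End(N)`. -/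
def toHom : ι.AnnEnd N →ₗ[R] L →ₗ[R] EndMod R N := (ι.annihilator (EndMod R N)).subtype
theorem toHom_incl (f : ι.AnnEnd N) (a : A) : toHom f (ι.toLinearMap a) = 0 := f.2 a
@[ext] theorem ext {f f' : ι.AnnEnd N} (h : ∀ l, toHom f l = toHom f' l) : f = f' :=
  Subtype.ext (LinearMap.ext h)
/-- An element of `Γ(A° ⊗ End(N))` from a map `L → End(N)` that vanishes on `A`. -/
def mk (φ : L →ₗ[R] EndMod R N) (h : ∀ a, φ (ι.toLinearMap a) = 0) : ι.AnnEnd N := ⟨φ, h⟩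
@[simp] theorem toHom_mk (φ : L →ₗ[R] EndMod R N) (h : ∀ a, φ (ι.toLinearMap a) = 0) :
    toHom (mk (ι := ι) φ h) = φ := rfl
end Hom.AnnEnd

/-- The connection `∇̂` on `A° ⊗ End(N)` induced by the Bott connection and by `∇`:
`(∇̂_a φ)(l) = [∇_a, φ(l)] - φ([a, l])`. -/
def Connection.onAnnEnd (D : gA.Connection N) (ι : Hom gA gL) : gA.Connection (ι.AnnEnd N) :=
  D.onEnd.onAnnihilator ι

section wedge
variable {P Q : Type*} [AddCommGroup P] [Module R P] [AddCommGroup Q] [Module R Q]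

/-- For `w ∈ Ω^k(A, End N)` and `u ∈ Ω^q(A, N)`, the form
`(v_1, …, v_n) ↦ ∑ σ, sgn(σ) w(v_σ(1), …, v_σ(k)) (u(v_σ(k+1), …, v_σ(n)))`, the sum being over
`(k, q)`-shuffles (equivalently `1 / (k! q!)` times the sum over all permutations). -/
noncomputable def wedge {k q n : ℕ} (h : k + q = n) (w : A [⋀^Fin k]→ₗ[R] (EndMod R N))
    (u : A [⋀^Fin q]→ₗ[R] N) : A [⋀^Fin n]→ₗ[R] N :=
  ((TensorProduct.lift (LinearMap.id : (EndMod R N) →ₗ[R] (EndMod R N))).compAlternatingMap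
    (w.domCoprod u)).domDomCongr (finSumFinEquiv.trans (finCongr h))

theorem wedge_add {k q n : ℕ} (h : k + q = n) (w : A [⋀^Fin k]→ₗ[R] (EndMod R N))
    (u u' : A [⋀^Fin q]→ₗ[R] N) : wedge h w (u + u') = wedge h w u + wedge h w u' := by
  ext v
  simp only [wedge, ← AlternatingMap.domCoprod'_apply, TensorProduct.tmul_add, map_add]
  simp

theorem wedge_smul {k q n : ℕ} (h : k + q = n) (w : A [⋀^Fin k]→ₗ[R] (EndMod R N))
    (r : R) (u : A [⋀^Fin q]→ₗ[R] N) : wedge h w (r • u) = r • wedge h w u := by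
  ext v
  simp only [wedge, ← AlternatingMap.domCoprod'_apply, TensorProduct.tmul_smul, map_smul]
  simp

end wedge

/-- A superconnection along `g` on the graded module `(N, gr)`, given by its components: a connection
`∇` preserving the degree, and for every `k ≠ 1` a form `ω^(k) ∈ Ω^k(A, End_(1-k)(N))`. (The entry of
index `1` is zero by convention, the component of arity one being `d^∇`.) The corresponding
differential operator `∂ + d^∇ + ∑ k ≥ 2, ω^(k) ∧ ·`, with `∂ = ω^(0)`, is `Superconnection.op`. -/
structure Superconnection (g : LieRinehart R A) (N : Type*) [AddCommGroup N] [Module R N]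
    (gr : ℤ → Submodule R N) extends g.Connection N where
  form : ∀ k : ℕ, A [⋀^Fin k]→ₗ[R] (EndMod R N)
  form_one : form 1 = 0
  nabla_mem : ∀ i a, ∀ e ∈ gr i, nabla a e ∈ gr i
  form_mem : ∀ (k : ℕ) i v, ∀ e ∈ gr i, form k v e ∈ gr (i + (1 - k))

namespace Superconnection
variable {g : LieRinehart R A} {gr : ℤ → Submodule R N}

/-- The differential operator of a superconnection on `Ω(A, N)`, `D = d^∇ + ∑ k ≠ 1, ω^(k) ∧ ·`, with
the sign rule `(η ⊗ α) ∧ (θ ⊗ e) = (-1)^(i q) (η ∧ θ) ⊗ α(e)` for `α` of degree `i`, `θ` a `q`-form. -/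
noncomputable def op [Module ℝ N] [IsScalarTower ℝ R N] (D : g.Superconnection N gr) :
    (∀ k : ℕ, A [⋀^Fin k]→ₗ[R] N) →ₗ[ℝ] (∀ k : ℕ, A [⋀^Fin k]→ₗ[R] N) :=
  D.extDerivTotal +
  { toFun := fun u n => ∑ k : Fin (n + 1), ((1 - (k : ℤ)) * ((n : ℤ) - k)).negOnePow •
      wedge (show (k : ℕ) + (n - k) = n by omega) (D.form k) (u (n - k))
    map_add' := fun u u' => by
      funext n
      simp only [Pi.add_apply, wedge_add, smul_add, Finset.sum_add_distrib]
    map_smul' := fun c u => by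
      funext n
      have hu : ∀ k, c • u k = algebraMap ℝ R c • u k := fun k => by ext w; simp
      simp only [Pi.smul_apply, hu, wedge_smul, RingHom.id_apply, Finset.smul_sum]
      refine Finset.sum_congr rfl fun k _ => ?_
      rw [smul_comm]
      ext w; simp }

/-- `D ∘ D = 0`, i.e. `(N, D)` is a representation up to homotopy (a homotopy `A`-module). -/
def IsFlat [Module ℝ N] [IsScalarTower ℝ R N] (D : g.Superconnection N gr) : Prop :=
  ∀ u, D.op (D.op u) = 0

end Superconnection

/-- The forms of total degree `p`: the component of form degree `k` has values in degree `p - k`. -/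
def totalDegree [Module ℝ N] [IsScalarTower ℝ R N] (A : Type*) [AddCommGroup A] [Module R A]
    (gr : ℤ → Submodule R N) (p : ℤ) :
    Submodule ℝ (∀ k : ℕ, A [⋀^Fin k]→ₗ[R] N) where
  carrier := {u | ∀ (k : ℕ) v, u k v ∈ gr (p - k)}
  add_mem' hu hu' k v := add_mem (hu k v) (hu' k v)
  zero_mem' k v := zero_mem _
  smul_mem' c u hu k v := by
    have h := (gr (p - k)).smul_mem (algebraMap ℝ R c) (hu k v)
    rwa [algebraMap_smul] at h

/-- The forms that are concentrated in form degree `p` (only `0` if `p < 0`). -/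
def formDegree (R A N : Type*) [CommRing R] [Algebra ℝ R] [AddCommGroup A] [Module R A]
    [AddCommGroup N] [Module R N] [Module ℝ N] [IsScalarTower ℝ R N] (p : ℤ) :
    Submodule ℝ (∀ k : ℕ, A [⋀^Fin k]→ₗ[R] N) where
  carrier := {u | ∀ k : ℕ, (k : ℤ) ≠ p → u k = 0}
  add_mem' hu hu' k h := by simp [hu k h, hu' k h]
  zero_mem' k h := rfl
  smul_mem' c u hu k h := by simp [hu k h]

end LieRinehart
end

section
variable {W : Type*} [AddCommGroup W] [Module ℝ W]
/-- Cocycles of degree `p`. -/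
def cocycles (gr : ℤ → Submodule ℝ W) (d : W →ₗ[ℝ] W) (p : ℤ) : Submodule ℝ W :=
  gr p ⊓ LinearMap.ker d
/-- Coboundaries of degree `p`. -/
def coboundaries (gr : ℤ → Submodule ℝ W) (d : W →ₗ[ℝ] W) (p : ℤ) : Submodule ℝ W :=
  (gr (p - 1)).map d
/-- The degree `p` cohomology of the differential `d` on the graded vector space `(W, gr)`. -/
abbrev Cohomology (gr : ℤ → Submodule ℝ W) (d : W →ₗ[ℝ] W) (p : ℤ) : Type _ :=
  cocycles gr d p ⧸ (coboundaries gr d p).submoduleOf (cocycles gr d p)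

/-- The class of a cocycle. -/
abbrev cohomologyClass {gr : ℤ → Submodule ℝ W} {d : W →ₗ[ℝ] W} {p : ℤ} (z : cocycles gr d p) :
    Cohomology gr d p :=
  Submodule.Quotient.mk z
end

section
variable {R A L : Type*} [CommRing R] [Algebra ℝ R] [AddCommGroup A] [Module R A]
  [AddCommGroup L] [Module R L]
  {X : ℤ → Type*} [∀ i, AddCommGroup (X i)] [∀ i, Module R (X i)]

/-- The elements of degree `i` of the graded module `⨁ i, X i` (the family `X` having finitely many
nonzero members, the direct sum is the product). -/
def homogeneous (R : Type*) [CommRing R] (X : ℤ → Type*) [∀ i, AddCommGroup (X i)]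
    [∀ i, Module R (X i)] (i : ℤ) : Submodule R (∀ i, X i) where
  carrier := {e | ∀ j, j ≠ i → e j = 0}
  add_mem' h h' j hj := by simp [h j hj, h' j hj]
  zero_mem' j hj := rfl
  smul_mem' r e h j hj := by simp [h j hj]

/-- Endomorphisms of degree `j`. -/
def endDegree (R : Type*) [CommRing R] (X : ℤ → Type*) [∀ i, AddCommGroup (X i)]
    [∀ i, Module R (X i)] (j : ℤ) : Submodule R (EndMod R (∀ i, X i)) where
  carrier := {f | ∀ i, ∀ e ∈ homogeneous R X i, f e ∈ homogeneous R X (i + j)}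
  add_mem' h h' i e he := add_mem (h i e he) (h' i e he)
  zero_mem' i e he := zero_mem _
  smul_mem' r f h i e he := Submodule.smul_mem _ r (h i e he)

/-- The operator `e ↦ (-1)^(d i) e` for `e` of degree `i`. -/
def koszul (R : Type*) [CommRing R] (X : ℤ → Type*) [∀ i, AddCommGroup (X i)]
    [∀ i, Module R (X i)] (d : ℤ) : (EndMod R (∀ i, X i)) where
  toFun e i := (d * i).negOnePow • e i
  map_add' e e' := by funext i; simp
  map_smul' r e := by funext i; simp [smul_comm r]

theorem koszul_mem (d i : ℤ) (e : ∀ i, X i) (he : e ∈ homogeneous R X i) :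
    koszul R X d e ∈ homogeneous R X i := fun j hj => by
  simp [koszul, he j hj]

/-- The graded commutator `[x, f] = x ∘ f - (-1)^(d q) f ∘ x` of `x` of degree `d` and `f` of degree
`q`, extended linearly in `f`. -/
def gradedCommutator (R : Type*) [CommRing R] (X : ℤ → Type*) [∀ i, AddCommGroup (X i)]
    [∀ i, Module R (X i)] (d : ℤ) :
    (EndMod R (∀ i, X i)) →ₗ[R] (EndMod R (∀ i, X i)) →ₗ[R] (EndMod R (∀ i, X i)) :=
  LinearMap.mk₂ R (fun x f => x ∘ₗ f - koszul R X d ∘ₗ f ∘ₗ koszul R X d ∘ₗ x)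
    (by intros; ext1; simp [LinearMap.add_comp, LinearMap.comp_add]; abel)
    (by intros; ext1; simp [LinearMap.smul_comp, LinearMap.comp_smul, smul_sub])
    (by intros; ext1; simp [LinearMap.add_comp, LinearMap.comp_add]; abel)
    (by intros; ext1; simp [LinearMap.smul_comp, LinearMap.comp_smul, smul_sub])

theorem gradedCommutator_mem (d j : ℤ) (x f : (EndMod R (∀ i, X i)))
    (hx : x ∈ endDegree R X d) (hf : f ∈ endDegree R X j) :
    gradedCommutator R X d x f ∈ endDegree R X (j + d) := fun i e he => by
  refine sub_mem ?_ ?_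
  · have := hx _ _ (hf i e he)
    rwa [add_assoc] at this
  · have := koszul_mem d _ _ (hf _ _ (koszul_mem d _ _ (hx i e he)))
    rwa [add_assoc, add_comm d j] at this

namespace LieRinehart
variable {gA : LieRinehart R A} {gL : LieRinehart R L}

/-- The elements of `Γ(A° ⊗ End_j(X))`. -/
def Hom.annDegree (ι : Hom gA gL) (X : ℤ → Type*) [∀ i, AddCommGroup (X i)]
    [∀ i, Module R (X i)] (j : ℤ) :
    Submodule R (ι.AnnEnd (∀ i, X i)) where
  carrier := {f | ∀ l, f.toHom l ∈ endDegree R X j}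
  add_mem' h h' l := add_mem (h l) (h' l)
  zero_mem' l := zero_mem _
  smul_mem' r f h l := Submodule.smul_mem _ r (h l)

/-- The operator `φ ↦ (l ↦ (-1)^d [x, φ(l)])` on `A° ⊗ End(X)`, for `x` of degree `d`. -/
def Hom.annAd (ι : Hom gA gL) (X : ℤ → Type*) [∀ i, AddCommGroup (X i)]
    [∀ i, Module R (X i)] (d : ℤ) :
    (EndMod R (∀ i, X i)) →ₗ[R] (ι.AnnEnd (∀ i, X i) →ₗ[R]
      ι.AnnEnd (∀ i, X i)) where
  toFun x :=
    { toFun := fun f => .mk (d.negOnePow • (gradedCommutator R X d x ∘ₗ f.toHom)) fun a => by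
        simp [f.toHom_incl a]
      map_add' := fun f f' => by ext1; simp
      map_smul' := fun r f => by ext1; simp [smul_comm r] }
  map_add' x y := by ext1 f; ext1 l; simp
  map_smul' r x := by ext1 f; ext1 l; simp [smul_comm r]

/-- The superconnection `s` on `A° ⊗ End(X)` induced by `D`. Its component of arity one is `d^∇̂`; on a
`p`-form `ϖ` its component of arity `k ≠ 1` is
`s^(k)(ϖ)(a_1, …, a_(k+p); l) = ± ∑ sgn(σ) [ω^(k)(a_σ(1), …), ϖ(a_σ(k+1), …; l)]`, with
`± = (-1)^((1-k)(p+1))`, that is, `[ω^(k), ϖ](a_1, …, a_(k+p), l)` with `ϖ` read as a `(p+1)`-form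
whose last argument is `l`. -/
def Superconnection.onAnnEnd (D : gA.Superconnection (∀ i, X i) (homogeneous R X))
    (ι : Hom gA gL) :
    gA.Superconnection (ι.AnnEnd (∀ i, X i)) (ι.annDegree X) where
  toConnection := D.toConnection.onAnnEnd ι
  form k := (ι.annAd X (1 - k)).compAlternatingMap (D.form k)
  form_one := by rw [D.form_one]; ext1; simp
  nabla_mem j a f hf l := by
    refine sub_mem (fun i e he => ?_) (hf _)
    exact sub_mem (D.nabla_mem _ _ _ (hf l i e he)) (hf l i _ (D.nabla_mem _ _ _ he))
  form_mem k j v f hf l := by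
    have h := gradedCommutator_mem (1 - (k : ℤ)) j (D.form k v) (f.toHom l)
      (fun i e he => D.form_mem k i v e he) (hf l)
    change (1 - (k : ℤ)).negOnePow • (gradedCommutator R X _ (D.form k v) (f.toHom l)) ∈ _
    rw [Units.smul_def]
    exact zsmul_mem h _

variable [∀ i, Module ℝ (X i)] [∀ i, IsScalarTower ℝ R (X i)]

/-- The component `∂ : X i → X j` of `∂ = ω^(0)` (of interest for `j = i + 1`). -/
def Superconnection.diff (D : gA.Superconnection (∀ i, X i) (homogeneous R X)) (i j : ℤ) :
    X i →ₗ[R] X j :=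
  LinearMap.proj j ∘ₗ D.form 0 ![] ∘ₗ LinearMap.single R X i

/-- `K = X 0 / Im(∂ : X (-1) → X 0)`. For `X i = Γ(E i)`, with `∂` of constant rank, it is the module of
sections of the vector bundle `E 0 / Im ∂`, the degree zero cohomology of `(E, ∂)` if `E 1 = 0`. -/
abbrev Superconnection.cokernel (D : gA.Superconnection (∀ i, X i) (homogeneous R X)) : Type _ :=
  X 0 ⧸ LinearMap.range (D.diff (-1) 0)

theorem wedge_zero {N : Type*} [AddCommGroup N] [Module R N] {q n : ℕ} (h : 0 + q = n) (hq : q ≤ 1)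
    (w : A [⋀^Fin 0]→ₗ[R] EndMod R N)
    (u : A [⋀^Fin q]→ₗ[R] N) (v : Fin n → A) :
    wedge h w u v = w ![] (u (fun i => v (Fin.cast (by omega) i))) := by
  obtain rfl : q = n := by omega
  have hsub : Subsingleton (Fin 0 ⊕ Fin q) := by
    rw [← Fintype.card_le_one_iff_subsingleton]; simpa using hq
  have hs : ∀ σ : Equiv.Perm.ModSumCongr (Fin 0) (Fin q), σ = Quotient.mk'' 1 := by
    intro σ
    induction σ using Quotient.inductionOn' with
    | _ σ => rw [Subsingleton.elim σ 1]
  have hc := (AlternatingMap.domCoprod_coe w u).trans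
    (Finset.sum_eq_single (Quotient.mk'' 1) (fun σ _ hσ => absurd (hs σ) hσ)
      (fun h => absurd (Finset.mem_univ _) h))
  rw [AlternatingMap.domCoprod.summand_mk''] at hc
  have hc' : ∀ x, w.domCoprod u x = w (fun i => x (Sum.inl i)) ⊗ₜ[R] u (fun i => x (Sum.inr i)) := by
    intro x
    have := congrArg (fun m => m x) hc
    simpa using this
  change TensorProduct.lift _ (w.domCoprod u _) = _
  rw [hc', TensorProduct.lift.tmul, LinearMap.id_apply]
  rw [Subsingleton.elim (fun i : Fin 0 => _) ![]]
  congr 2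
  funext i
  exact congrArg v (Fin.ext (by simp))

theorem zero_wedge {N : Type*} [AddCommGroup N] [Module R N] {k q n : ℕ} (h : k + q = n)
    (u : A [⋀^Fin q]→ₗ[R] N) : wedge h (0 : A [⋀^Fin k]→ₗ[R] EndMod R N) u = 0 := by
  ext v
  simp only [wedge, ← AlternatingMap.domCoprod'_apply, TensorProduct.zero_tmul, map_zero]
  simp

/-- An element of `N`, as a form of degree zero. -/
def constForm {N : Type*} [AddCommGroup N] [Module R N] (e : N) :
    ∀ k : ℕ, A [⋀^Fin k]→ₗ[R] N
  | 0 => AlternatingMap.constOfIsEmpty R A (Fin 0) e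
  | _ + 1 => 0

theorem Superconnection.IsFlat.diff_conn {D : gA.Superconnection (∀ i, X i) (homogeneous R X)}
    (hD : D.IsFlat) (a : A) (e : ∀ i, X i) :
    D.nabla a (D.form 0 ![] e) = D.form 0 ![] (D.nabla a e) := by
  have h0 : D.op (constForm e) 0 ![] = D.form 0 ![] e := by
    simp [op, Connection.extDerivTotal, wedge_zero, constForm]
  have h1 : ∀ a : A, D.op (constForm e) 1 ![a] = D.nabla a e := by
    intro a
    simp [op, Connection.extDerivTotal, Fin.sum_univ_succ, wedge_zero, zero_wedge, constForm, form_one,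
      Connection.extDeriv, Connection.extDerivFun]
  have h2 := congrArg (fun w => w ![a]) (congrFun (hD (constForm e)) 1)
  simp [op, Connection.extDerivTotal, Fin.sum_univ_succ, wedge_zero, zero_wedge, constForm, form_one,
      Connection.extDeriv, Connection.extDerivFun] at h2
  rwa [add_neg_eq_zero] at h2

theorem Superconnection.diff_single (D : gA.Superconnection (∀ i, X i) (homogeneous R X))
    (i j : ℤ) (hj : j = i + 1) (e : X i) :
    D.form 0 ![] (Pi.single i e) = Pi.single j (D.diff i j e) := by
  have h := D.form_mem 0 i ![] (Pi.single i e) (fun j hj => by simp [hj])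
  funext k
  by_cases hk : k = j
  · subst hk; simp [diff]
  · rw [Pi.single_eq_of_ne hk]
    exact h k (by subst hj; simpa using hk)

theorem Superconnection.nabla_single (D : gA.Superconnection (∀ i, X i) (homogeneous R X))
    (a : A) (i : ℤ) (e : X i) :
    D.nabla a (Pi.single i e) = Pi.single i (D.nabla a (Pi.single i e) i) := by
  have h := D.nabla_mem i a (Pi.single i e) (fun j hj => by simp [hj])
  funext k
  by_cases hk : k = i
  · subst hk; simp
  · rw [Pi.single_eq_of_ne hk]
    exact h k hk

/-- The connection on `K` induced by `D`, i.e. `∇_a [e] = [∇_a e]`. -/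
def Superconnection.cokernelConnection
    (D : gA.Superconnection (∀ i, X i) (homogeneous R X)) (hD : D.IsFlat) :
    gA.Connection D.cokernel where
  nabla a := Quotient.map' (fun e => D.nabla a (Pi.single 0 e) 0) (fun e e' h => by
    rw [Submodule.quotientRel_def] at h ⊢
    obtain ⟨x, hx⟩ := h
    refine ⟨D.nabla a (Pi.single (-1) x) (-1), ?_⟩
    have h1 := hD.diff_conn a (Pi.single (-1) x)
    rw [D.nabla_single, D.diff_single (-1) 0 (by simp), D.diff_single (-1) 0 (by simp), hx,
      Pi.single_sub, sub_eq_add_neg, D.add_right, D.toConnection.neg_right] at h1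
    have h2 := congrFun h1 0
    simp only [Pi.single_eq_same] at h2
    rw [← h2, Pi.add_apply, Pi.neg_apply, ← sub_eq_add_neg])
  add_left a b := by
    rintro ⟨e⟩
    exact congrArg (Submodule.Quotient.mk) (congrFun (D.add_left a b (Pi.single 0 e)) 0)
  smul_left f a := by
    rintro ⟨e⟩
    exact congrArg (Submodule.Quotient.mk) (congrFun (D.smul_left f a (Pi.single 0 e)) 0)
  add_right a := by
    rintro ⟨e⟩ ⟨e'⟩
    refine congrArg (Submodule.Quotient.mk) ?_
    change D.nabla a (Pi.single 0 (e + e')) 0 = _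
    rw [Pi.single_add, D.add_right]; rfl
  leibniz a f := by
    rintro ⟨e⟩
    refine congrArg (Submodule.Quotient.mk) ?_
    change D.nabla a (Pi.single 0 (f • e)) 0 = _
    rw [Pi.single_smul, D.leibniz]
    simp

/-- The form `κ ∈ Ω(A, A° ⊗ End(K))` is induced by `ϖ ∈ Ω(A, A° ⊗ End(X))` on the quotient `K` of
`X 0`: `κ(v; l)([e]) = [ϖ(v; l)(e)]` for `e ∈ X 0`, the class being that of the component in `X 0`. -/
def Superconnection.Induces (D : gA.Superconnection (∀ i, X i) (homogeneous R X))
    (ι : Hom gA gL) (ϖ : ∀ k : ℕ, A [⋀^Fin k]→ₗ[R] ι.AnnEnd (∀ i, X i))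
    (κ : ∀ k : ℕ, A [⋀^Fin k]→ₗ[R] ι.AnnEnd D.cokernel) : Prop :=
  ∀ (k : ℕ) (v : Fin k → A) (l : L) (e : X 0),
    (κ k v).toHom l (Submodule.Quotient.mk e) =
      Submodule.Quotient.mk ((ϖ k v).toHom l (Pi.single 0 e) 0)

end LieRinehart
end

section
variable {R A L N : Type*} [CommRing R] [Algebra ℝ R] [AddCommGroup A] [Module R A]
  [AddCommGroup L] [Module R L] [AddCommGroup N] [Module R N]
  {gA : LieRinehart R A} {gL : LieRinehart R L}

namespace LieRinehart

/-- The curvature `R_∇(a, b) = [∇_a, ∇_b] - ∇_[a, b]`. -/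
def Connection.curvature (D : gL.Connection N) (a b : L) (e : N) : N :=
  D.nabla a (D.nabla b e) - D.nabla b (D.nabla a e) - D.nabla (gL.bracket a b) e

/-- The connection `D` along `L` extends the connection `DA` along `A`. -/
def Connection.Extends (D : gL.Connection N) (ι : Hom gA gL) (DA : gA.Connection N) : Prop :=
  ∀ a e, D.nabla (ι.toLinearMap a) e = DA.nabla a e

/-- The superconnection `D` along `L` extends the superconnection `DA` along `A`: restricting to `A`
the components of `D` gives those of `DA`. -/
def Superconnection.Extends {gr : ℤ → Submodule R N} (D : gL.Superconnection N gr) (ι : Hom gA gL)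
    (DA : gA.Superconnection N gr) : Prop :=
  D.toConnection.Extends ι DA.toConnection ∧
    ∀ (k : ℕ) (v : Fin k → A), D.form k (fun i => ι.toLinearMap (v i)) = DA.form k v

variable [Module ℝ N] [IsScalarTower ℝ R N]

/-- `α` is the Atiyah form of the superconnection `D` along `L`, i.e. the restriction of its
curvature `D²`: `α(a_1, …, a_k; l)(e) = (D² e)(a_1, …, a_k, l)`. -/
def Superconnection.IsAtiyahForm {gr : ℤ → Submodule R N} (D : gL.Superconnection N gr)
    (ι : Hom gA gL) (α : ∀ k : ℕ, A [⋀^Fin k]→ₗ[R] ι.AnnEnd N) : Prop :=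
  ∀ (k : ℕ) (v : Fin k → A) (l : L) (e : N),
    (α k v).toHom l e = D.op (D.op (constForm e)) (k + 1)
      (Fin.snoc (α := fun _ => L) (fun i => ι.toLinearMap (v i)) l)

/-- The form `at` (concentrated in form degree one) is the Atiyah form of the connection `D` along
`L`: `at(a; l) = R_∇(a, l)`. -/
def Connection.IsAtiyahForm (D : gL.Connection N) (ι : Hom gA gL)
    (at' : ∀ k : ℕ, A [⋀^Fin k]→ₗ[R] ι.AnnEnd N) : Prop :=
  (∀ k, k ≠ 1 → at' k = 0) ∧
    ∀ (v : Fin 1 → A) (l : L) (e : N),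
      (at' 1 v).toHom l e = D.curvature (ι.toLinearMap (v 0)) l e

/-- The cohomology `H^p(A, A° ⊗ End(N))`, for `N` with the (flat) connection `D`. -/
noncomputable abbrev Connection.AnnEndCohomology (D : gA.Connection N) (ι : Hom gA gL) (p : ℤ) : Type _ :=
  Cohomology (formDegree R A (ι.AnnEnd N)) (D.onAnnEnd ι).extDerivTotal p

/-- The cocycles of `Ω^p(A, A° ⊗ End(N))`. -/
noncomputable abbrev Connection.annEndCocycles (D : gA.Connection N) (ι : Hom gA gL) (p : ℤ) :
    Submodule ℝ (∀ k : ℕ, A [⋀^Fin k]→ₗ[R] ι.AnnEnd N) :=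
  cocycles (formDegree R A (ι.AnnEnd N)) (D.onAnnEnd ι).extDerivTotal p

variable {X : ℤ → Type*} [∀ i, AddCommGroup (X i)] [∀ i, Module R (X i)]
  [∀ i, Module ℝ (X i)] [∀ i, IsScalarTower ℝ R (X i)]

/-- The cohomology `Ĥ^p(X, s)` of `Ω(A, A° ⊗ End(X))`, graded by the total degree, under `s`. -/
noncomputable abbrev Superconnection.AnnEndCohomology
    (D : gA.Superconnection (∀ i, X i) (homogeneous R X)) (ι : Hom gA gL) (p : ℤ) : Type _ :=
  Cohomology (totalDegree A (ι.annDegree X)) (D.onAnnEnd ι).op p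

/-- The cocycles of total degree `p` of `Ω(A, A° ⊗ End(X))` under `s`. -/
noncomputable abbrev Superconnection.annEndCocycles
    (D : gA.Superconnection (∀ i, X i) (homogeneous R X)) (ι : Hom gA gL) (p : ℤ) :
    Submodule ℝ (∀ k : ℕ, A [⋀^Fin k]→ₗ[R] ι.AnnEnd (∀ i, X i)) :=
  cocycles (totalDegree A (ι.annDegree X)) (D.onAnnEnd ι).op p

end LieRinehart
end

/-- The ring `C^∞(M)`. -/
abbrev SmoothFun (EM M : Type*) [NormedAddCommGroup EM] [NormedSpace ℝ EM] [TopologicalSpace M]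
    [ChartedSpace EM M] : Type _ := C^∞⟮𝓘(ℝ, EM), M; ℝ⟯

section
variable {EM : Type*} [NormedAddCommGroup EM] [NormedSpace ℝ EM]
  {M : Type*} [TopologicalSpace M] [ChartedSpace EM M]
  {F : Type*} [NormedAddCommGroup F] [NormedSpace ℝ F]
  {V : M → Type*} [TopologicalSpace (TotalSpace F V)] [∀ x, TopologicalSpace (V x)]
  [∀ x, AddCommGroup (V x)] [∀ x, Module ℝ (V x)] [FiberBundle F V] [VectorBundle ℝ F V]

/-- `Γ(V)` as a `C^∞(M)`-module. -/
noncomputable instance : SMul (SmoothFun EM M) Cₛ^∞⟮𝓘(ℝ, EM); F, V⟯ where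
  smul f e := ⟨fun x => f x • e x, f.contMDiff.smul_section e.contMDiff⟩

@[simp] theorem section_smul_apply (f : SmoothFun EM M) (e : Cₛ^∞⟮𝓘(ℝ, EM); F, V⟯) (x : M) :
    (f • e) x = f x • e x := rfl

noncomputable instance : Module (SmoothFun EM M) Cₛ^∞⟮𝓘(ℝ, EM); F, V⟯ where
  one_smul e := by ext x; simp
  mul_smul f f' e := by ext x; simp [mul_smul]
  smul_zero f := by ext x; simp
  smul_add f e e' := by ext x; simp
  add_smul f f' e := by ext x; simp [add_smul]
  zero_smul e := by ext x; simp

noncomputable instance : IsScalarTower ℝ (SmoothFun EM M) Cₛ^∞⟮𝓘(ℝ, EM); F, V⟯ where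
  smul_assoc c f e := by ext x; simp [mul_smul]

/-- A smooth vector field as a derivation of `C^∞(M)`: `X(f)(x) = df_x(X(x))`. -/
noncomputable def vectorFieldDerivation [IsManifold 𝓘(ℝ, EM) ∞ M]
    (X : Cₛ^∞⟮𝓘(ℝ, EM); EM, (TangentSpace 𝓘(ℝ, EM) : M → Type _)⟯) :
    Derivation ℝ (SmoothFun EM M) (SmoothFun EM M) :=
  Derivation.mk'
    { toFun := fun f => ⟨fun x => (mfderiv 𝓘(ℝ, EM) 𝓘(ℝ, ℝ) f x (X x) : ℝ), by
        have h1 : ContMDiff 𝓘(ℝ, EM) 𝓘(ℝ, ℝ).tangent ∞ (fun x : M =>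
            tangentMap 𝓘(ℝ, EM) 𝓘(ℝ, ℝ) f (⟨x, X x⟩ : TangentBundle 𝓘(ℝ, EM) M)) :=
          (f.contMDiff.contMDiff_tangentMap (m := ∞) (by simp)).comp X.contMDiff
        exact ((contMDiff_snd_tangentBundle_modelSpace ℝ 𝓘(ℝ, ℝ)).comp h1)⟩
      map_add' := fun f f' => by
        ext x
        change (mfderiv 𝓘(ℝ, EM) 𝓘(ℝ, ℝ) (⇑f + ⇑f') x (X x) : ℝ) = _
        rw [mfderiv_add (f.contMDiff.mdifferentiableAt (by simp))
          (f'.contMDiff.mdifferentiableAt (by simp))]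
        rfl
      map_smul' := fun c f => by
        ext x
        change (mfderiv 𝓘(ℝ, EM) 𝓘(ℝ, ℝ) (c • ⇑f) x (X x) : ℝ) = _
        rw [const_smul_mfderiv (f.contMDiff.mdifferentiableAt (by simp))]
        rfl }
    (fun f f' => by
      ext x
      change (mfderiv 𝓘(ℝ, EM) 𝓘(ℝ, ℝ) (⇑f * ⇑f') x (X x) : ℝ) = _
      rw [((f.contMDiff.mdifferentiableAt (by simp)).hasMFDerivAt.mul
          (f'.contMDiff.mdifferentiableAt (by simp)).hasMFDerivAt).mfderiv]
      rfl)

theorem vectorFieldDerivation_apply [IsManifold 𝓘(ℝ, EM) ∞ M]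
    (X : Cₛ^∞⟮𝓘(ℝ, EM); EM, (TangentSpace 𝓘(ℝ, EM) : M → Type _)⟯) (f : SmoothFun EM M) (x : M) :
    vectorFieldDerivation X f x = mfderiv 𝓘(ℝ, EM) 𝓘(ℝ, ℝ) f x (X x) := rfl
end

section
variable {EM : Type*} [NormedAddCommGroup EM] [NormedSpace ℝ EM]
  {M : Type*} [TopologicalSpace M] [ChartedSpace EM M]
  {F : Type*} [NormedAddCommGroup F] [NormedSpace ℝ F]
  {V : M → Type*} [TopologicalSpace (TotalSpace F V)] [∀ x, TopologicalSpace (V x)]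
  [∀ x, AddCommGroup (V x)] [∀ x, Module ℝ (V x)] [FiberBundle F V] [VectorBundle ℝ F V]
  {F' : Type*} [NormedAddCommGroup F'] [NormedSpace ℝ F']
  {W : M → Type*} [TopologicalSpace (TotalSpace F' W)] [∀ x, TopologicalSpace (W x)]
  [∀ x, AddCommGroup (W x)] [∀ x, Module ℝ (W x)] [FiberBundle F' W] [VectorBundle ℝ F' W]

/-- The image of `T_x : V_x → W_x`, for the vector bundle morphism `T` that is given by its
`C^∞(M)`-linear action on sections (`T_x (e(x)) = (T e)(x)`). -/
def fiberImage (T : Cₛ^∞⟮𝓘(ℝ, EM); F, V⟯ →ₗ[SmoothFun EM M] Cₛ^∞⟮𝓘(ℝ, EM); F', W⟯) (x : M) :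
    Submodule ℝ (W x) where
  carrier := {w | ∃ e, T e x = w}
  add_mem' := by
    rintro _ _ ⟨e, rfl⟩ ⟨e', rfl⟩
    exact ⟨e + e', by rw [map_add]; rfl⟩
  zero_mem' := ⟨0, by rw [map_zero]; rfl⟩
  smul_mem' := by
    rintro c _ ⟨e, rfl⟩
    exact ⟨algebraMap ℝ (SmoothFun EM M) c • e, by rw [map_smul]; rfl⟩

/-- The kernel of `T_x : V_x → W_x`, in the same setting. -/
def fiberKernel (T : Cₛ^∞⟮𝓘(ℝ, EM); F, V⟯ →ₗ[SmoothFun EM M] Cₛ^∞⟮𝓘(ℝ, EM); F', W⟯) (x : M) :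
    Submodule ℝ (V x) where
  carrier := {w | ∃ e, e x = w ∧ T e x = 0}
  add_mem' := by
    rintro _ _ ⟨e, rfl, h⟩ ⟨e', rfl, h'⟩
    exact ⟨e + e', rfl, by rw [map_add, ContMDiffSection.coe_add, Pi.add_apply, h, h', add_zero]⟩
  zero_mem' := ⟨0, rfl, by rw [map_zero]; rfl⟩
  smul_mem' := by
    rintro c _ ⟨e, rfl, h⟩
    exact ⟨algebraMap ℝ (SmoothFun EM M) c • e, rfl, by
      rw [map_smul, section_smul_apply, h, smul_zero]⟩

end

/-- A Lie algebroid structure on the smooth vector bundle `V → M`: a smooth bundle map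
`ρ : V → TM` over the identity and a Lie bracket on `Γ(V)` with
`[a, f b] = f [a, b] + ρ(a)(f) b` and `ρ([a, b]) = [ρ(a), ρ(b)]`. -/
structure LieAlgebroid (EM : Type*) [NormedAddCommGroup EM] [NormedSpace ℝ EM]
    {M : Type*} [TopologicalSpace M] [ChartedSpace EM M] [IsManifold 𝓘(ℝ, EM) ∞ M]
    (F : Type*) [NormedAddCommGroup F] [NormedSpace ℝ F]
    (V : M → Type*) [TopologicalSpace (TotalSpace F V)] [∀ x, TopologicalSpace (V x)]
    [∀ x, AddCommGroup (V x)] [∀ x, Module ℝ (V x)] [FiberBundle F V] [VectorBundle ℝ F V] where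
  anchor : ∀ x, V x →ₗ[ℝ] TangentSpace 𝓘(ℝ, EM) x
  anchor_smooth : ∀ a : Cₛ^∞⟮𝓘(ℝ, EM); F, V⟯,
    ContMDiff 𝓘(ℝ, EM) (𝓘(ℝ, EM).prod 𝓘(ℝ, EM)) ∞
      (fun x => (⟨x, anchor x (a x)⟩ : TangentBundle 𝓘(ℝ, EM) M))
  bracket : Cₛ^∞⟮𝓘(ℝ, EM); F, V⟯ → Cₛ^∞⟮𝓘(ℝ, EM); F, V⟯ → Cₛ^∞⟮𝓘(ℝ, EM); F, V⟯
  bracket_add_left : ∀ a b c, bracket (a + b) c = bracket a c + bracket b c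
  bracket_add_right : ∀ a b c, bracket a (b + c) = bracket a b + bracket a c
  bracket_self : ∀ a, bracket a a = 0
  jacobi : ∀ a b c, bracket a (bracket b c) = bracket (bracket a b) c + bracket b (bracket a c)
  leibniz : ∀ a (f : SmoothFun EM M) b,
    bracket a (f • b) = f • bracket a b + vectorFieldDerivation ⟨_, anchor_smooth a⟩ f • b
  anchor_bracket : ∀ a b (f : SmoothFun EM M),
    vectorFieldDerivation ⟨_, anchor_smooth (bracket a b)⟩ f =
      vectorFieldDerivation ⟨_, anchor_smooth a⟩ (vectorFieldDerivation ⟨_, anchor_smooth b⟩ f) -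
        vectorFieldDerivation ⟨_, anchor_smooth b⟩ (vectorFieldDerivation ⟨_, anchor_smooth a⟩ f)

namespace LieAlgebroid
variable {EM : Type*} [NormedAddCommGroup EM] [NormedSpace ℝ EM]
  {M : Type*} [TopologicalSpace M] [ChartedSpace EM M] [IsManifold 𝓘(ℝ, EM) ∞ M]
  {F : Type*} [NormedAddCommGroup F] [NormedSpace ℝ F]
  {V : M → Type*} [TopologicalSpace (TotalSpace F V)] [∀ x, TopologicalSpace (V x)]
  [∀ x, AddCommGroup (V x)] [∀ x, Module ℝ (V x)] [FiberBundle F V] [VectorBundle ℝ F V]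
  {F' : Type*} [NormedAddCommGroup F'] [NormedSpace ℝ F']
  {W : M → Type*} [TopologicalSpace (TotalSpace F' W)] [∀ x, TopologicalSpace (W x)]
  [∀ x, AddCommGroup (W x)] [∀ x, Module ℝ (W x)] [FiberBundle F' W] [VectorBundle ℝ F' W]

/-- The structure on `Γ(V)` defined by a Lie algebroid `V`. -/
noncomputable def toLieRinehart (𝒜 : LieAlgebroid EM F V) :
    LieRinehart (SmoothFun EM M) Cₛ^∞⟮𝓘(ℝ, EM); F, V⟯ where
  anchor :=
    { toFun := fun a => vectorFieldDerivation ⟨_, 𝒜.anchor_smooth a⟩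
      map_add' := fun a b => by
        ext f x
        change mfderiv 𝓘(ℝ, EM) 𝓘(ℝ, ℝ) f x (𝒜.anchor x (a x + b x)) = _
        rw [map_add, map_add]; rfl
      map_smul' := fun r a => by
        ext f x
        change mfderiv 𝓘(ℝ, EM) 𝓘(ℝ, ℝ) f x (𝒜.anchor x (r x • a x)) = _
        rw [map_smul, map_smul]; rfl }
  bracket := 𝒜.bracket
  bracket_add_left := 𝒜.bracket_add_left
  bracket_add_right := 𝒜.bracket_add_right
  bracket_self := 𝒜.bracket_self
  bracket_smul := 𝒜.leibniz
  jacobi := 𝒜.jacobi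
  anchor_bracket := 𝒜.anchor_bracket

end LieAlgebroid

/-- A Lie pair `𝒜 ↪ ℒ`: a smooth, fibrewise injective bundle map over the identity of `M` that
is compatible with the anchors and with the brackets. -/
structure LiePair {EM : Type*} [NormedAddCommGroup EM] [NormedSpace ℝ EM]
    {M : Type*} [TopologicalSpace M] [ChartedSpace EM M] [IsManifold 𝓘(ℝ, EM) ∞ M]
    {F : Type*} [NormedAddCommGroup F] [NormedSpace ℝ F]
    {V : M → Type*} [TopologicalSpace (TotalSpace F V)] [∀ x, TopologicalSpace (V x)]
    [∀ x, AddCommGroup (V x)] [∀ x, Module ℝ (V x)] [FiberBundle F V] [VectorBundle ℝ F V]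
    {F' : Type*} [NormedAddCommGroup F'] [NormedSpace ℝ F']
    {W : M → Type*} [TopologicalSpace (TotalSpace F' W)] [∀ x, TopologicalSpace (W x)]
    [∀ x, AddCommGroup (W x)] [∀ x, Module ℝ (W x)] [FiberBundle F' W] [VectorBundle ℝ F' W]
    (𝒜 : LieAlgebroid EM F V) (ℒ : LieAlgebroid EM F' W) where
  incl : ∀ x, V x →ₗ[ℝ] W x
  incl_injective : ∀ x, Function.Injective (incl x)
  incl_smooth : ∀ a : Cₛ^∞⟮𝓘(ℝ, EM); F, V⟯,
    ContMDiff 𝓘(ℝ, EM) (𝓘(ℝ, EM).prod 𝓘(ℝ, F')) ∞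
      (fun x => (⟨x, incl x (a x)⟩ : TotalSpace F' W))
  anchor_incl : ∀ x v, ℒ.anchor x (incl x v) = 𝒜.anchor x v
  bracket_incl : ∀ a b x,
    ℒ.bracket ⟨_, incl_smooth a⟩ ⟨_, incl_smooth b⟩ x = incl x (𝒜.bracket a b x)

namespace LiePair
variable {EM : Type*} [NormedAddCommGroup EM] [NormedSpace ℝ EM]
  {M : Type*} [TopologicalSpace M] [ChartedSpace EM M] [IsManifold 𝓘(ℝ, EM) ∞ M]
  {F : Type*} [NormedAddCommGroup F] [NormedSpace ℝ F]
  {V : M → Type*} [TopologicalSpace (TotalSpace F V)] [∀ x, TopologicalSpace (V x)]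
  [∀ x, AddCommGroup (V x)] [∀ x, Module ℝ (V x)] [FiberBundle F V] [VectorBundle ℝ F V]
  {F' : Type*} [NormedAddCommGroup F'] [NormedSpace ℝ F']
  {W : M → Type*} [TopologicalSpace (TotalSpace F' W)] [∀ x, TopologicalSpace (W x)]
  [∀ x, AddCommGroup (W x)] [∀ x, Module ℝ (W x)] [FiberBundle F' W] [VectorBundle ℝ F' W]
  {𝒜 : LieAlgebroid EM F V} {ℒ : LieAlgebroid EM F' W}

/-- The inclusion `Γ(𝒜) → Γ(ℒ)`. -/
noncomputable def toHom (ι : LiePair 𝒜 ℒ) : LieRinehart.Hom 𝒜.toLieRinehart ℒ.toLieRinehart where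
  toFun a := ⟨fun x => ι.incl x (a x), ι.incl_smooth a⟩
  map_add' a b := by ext x; exact map_add (ι.incl x) (a x) (b x)
  map_smul' r a := by ext x; exact map_smul (ι.incl x) (r x) (a x)
  anchor_map a := by
    ext f x
    exact congrArg (mfderiv 𝓘(ℝ, EM) 𝓘(ℝ, ℝ) f x) (ι.anchor_incl x (a x))
  bracket_map a b := by
    ext x
    exact (ι.bracket_incl a b x).symm

end LiePair

end HomotopyModules

open HomotopyModules LieRinehart

/-! Geometry enters through three facts about modules over `C^∞(M)`: the inclusion of `Γ(A)` into
`Γ(L)` has a linear retraction (`LiePair.exists_retraction`), every `E_i` carries an `L`-connection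
(`exists_connection`), and exactness in negative degrees gives a linear `h` of degree `-1` with `∂h
+ h∂ = 1` there (`nonempty_contraction`). All three are local constructions glued by a partition of
unity. With `π : E → K` the projection, the contraction yields a section `σ` of `π` with `1 - σπ =
∂h + h∂` in all degrees. The rest is algebra.

Forms are treated as elements of a graded algebra in which a form of positive degree is determined
by its interior products, so identities follow by induction on the degree from Cartan's formulas.
With coefficients acting from the right, a superconnection is `u ↦ du + (-1)^|u| u·ω`, its square is
multiplication by a curvature form (`op_op`), and `D²∘D = D∘D²` is the Bianchi identity. Up to sign,
`s²` is the commutator with `D²`, hence zero.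

For the comparison, let Stab consist of the forms whose values preserve `ker π`, and Null of those
whose values map `E` into `ker π`. Since `π` kills the values of every `ω^(k)` and intertwines `∇`
with `∇^K`, both are stable under `s`, and reduction modulo Null maps Stab onto the forms with
values in `A° ⊗ End(K)`, with `s` becoming the covariant derivative (`red_op`). The part of `s` of
lowest form degree is the commutator with `∂`. Composing the lowest component of a form with `h` on
the left therefore shows that Null is acyclic (`exists_op_eq`), and on the right that each cocycle
is cohomologous to one in Stab (`exists_sub_op_mem`); both recursions on the form degree stop
because `E` lives in finitely many degrees `≤ 0`. Thus `Φ` is the isomorphism given by the two maps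
out of the Stab cocycles.

The Atiyah form is a cocycle by the Bianchi identity for `D_L`, whose curvature vanishes on `A`. The
failure `π∇_l - ∇^K_l π` of the two `L`-connections to match is tensorial and vanishes on `A`, so it
lifts to a cochain `b` of degree zero; `α - s b` lies in Stab and induces `at_K`
(`exists_induces_isAtiyahForm`). -/

namespace HomotopyModules
open Function Bundle
open scoped TensorProduct

/-! ### Shuffle products of alternating maps and their interior products. -/

section
variable {R A P Q S : Type*} [CommRing R] [AddCommGroup A] [Module R A]
  [AddCommGroup P] [Module R P] [AddCommGroup Q] [Module R Q] [AddCommGroup S] [Module R S]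

/-- The shuffle product of a `k`-form and a `q`-form along a bilinear pairing. -/
noncomputable def pairWedge (B : P →ₗ[R] Q →ₗ[R] S) {k q n : ℕ} (h : k + q = n)
    (w : A [⋀^Fin k]→ₗ[R] P) (u : A [⋀^Fin q]→ₗ[R] Q) : A [⋀^Fin n]→ₗ[R] S :=
  ((TensorProduct.lift B).compAlternatingMap
    (w.domCoprod u)).domDomCongr (finSumFinEquiv.trans (finCongr h))

theorem wedge_eq_pairWedge {k q n : ℕ} (h : k + q = n) (w : A [⋀^Fin k]→ₗ[R] (EndMod R P))
    (u : A [⋀^Fin q]→ₗ[R] P) : LieRinehart.wedge h w u = pairWedge LinearMap.id h w u := rfl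

variable (B : P →ₗ[R] Q →ₗ[R] S)

theorem pairWedge_add_right {k q n : ℕ} (h : k + q = n) (w : A [⋀^Fin k]→ₗ[R] P)
    (u u' : A [⋀^Fin q]→ₗ[R] Q) :
    pairWedge B h w (u + u') = pairWedge B h w u + pairWedge B h w u' := by
  ext v
  simp only [pairWedge, ← AlternatingMap.domCoprod'_apply, TensorProduct.tmul_add, map_add]
  simp

theorem pairWedge_add_left {k q n : ℕ} (h : k + q = n) (w w' : A [⋀^Fin k]→ₗ[R] P)
    (u : A [⋀^Fin q]→ₗ[R] Q) :
    pairWedge B h (w + w') u = pairWedge B h w u + pairWedge B h w' u := by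
  ext v
  simp only [pairWedge, ← AlternatingMap.domCoprod'_apply, TensorProduct.add_tmul, map_add]
  simp

theorem pairWedge_smul_right {k q n : ℕ} (h : k + q = n) (w : A [⋀^Fin k]→ₗ[R] P)
    (r : R) (u : A [⋀^Fin q]→ₗ[R] Q) : pairWedge B h w (r • u) = r • pairWedge B h w u := by
  ext v
  simp only [pairWedge, ← AlternatingMap.domCoprod'_apply, TensorProduct.tmul_smul, map_smul]
  simp

theorem pairWedge_smul_left {k q n : ℕ} (h : k + q = n) (w : A [⋀^Fin k]→ₗ[R] P)
    (r : R) (u : A [⋀^Fin q]→ₗ[R] Q) : pairWedge B h (r • w) u = r • pairWedge B h w u := by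
  ext v
  simp only [pairWedge, ← AlternatingMap.domCoprod'_apply, ← TensorProduct.smul_tmul', map_smul]
  simp

/-- A shuffle product is valued in every subgroup that contains the pairings of the values. -/
theorem pairWedge_mem (T : AddSubgroup S) {k q n : ℕ} (h : k + q = n) (w : A [⋀^Fin k]→ₗ[R] P)
    (u : A [⋀^Fin q]→ₗ[R] Q) (hT : ∀ x y, B (w x) (u y) ∈ T) (v : Fin n → A) :
    pairWedge B h w u v ∈ T := by
  change TensorProduct.lift B (w.domCoprod u _) ∈ T
  rw [AlternatingMap.domCoprod_apply, sum_apply, map_sum]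
  refine sum_mem fun σ _ => ?_
  induction σ using Quotient.inductionOn' with
  | _ σ =>
  rw [AlternatingMap.domCoprod.summand_mk'']
  change TensorProduct.lift B ((Equiv.Perm.sign σ : ℤ) • (w _ ⊗ₜ[R] u _)) ∈ T
  rw [map_zsmul, TensorProduct.lift.tmul]
  exact zsmul_mem (hT _ _) _

/-- Each shuffle class contains `k! q!` permutations with the same summand. Sums over all
permutations can be reindexed freely, and the factor is cancelled again because `R` is a real
algebra. -/
theorem factorial_smul_pairWedge {k q n : ℕ} (h : k + q = n) (w : A [⋀^Fin k]→ₗ[R] P)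
    (u : A [⋀^Fin q]→ₗ[R] Q) (v : Fin n → A) :
    (k.factorial * q.factorial) • pairWedge B h w u v =
      ∑ σ : Equiv.Perm (Fin n), (Equiv.Perm.sign σ : ℤ) •
        B (w fun i => v (σ (Fin.cast h (Fin.castAdd q i))))
          (u fun i => v (σ (Fin.cast h (Fin.natAdd k i)))) := by
  subst h
  have key := congrArg (fun m => TensorProduct.lift B (m (v ∘ finSumFinEquiv)))
    (MultilinearMap.domCoprod_alternization_eq w u)
  simp only [Fintype.card_fin, AlternatingMap.smul_apply, map_nsmul,
    MultilinearMap.alternatization_apply, map_sum] at key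
  change _ • TensorProduct.lift B (w.domCoprod u (v ∘ finSumFinEquiv)) = _
  rw [← key]
  refine Fintype.sum_equiv (Equiv.permCongr finSumFinEquiv) _ _ fun σ => ?_
  simp [Units.smul_def, Equiv.permCongr_apply, Equiv.Perm.sign_permCongr]

/-- Permutations are sorted by the position `p` in which the first vector `a` ends up; bringing it
there costs the sign of a cycle of length `p + 1`. -/
theorem sum_perm_cons {n : ℕ} (f : (Fin (n + 1) → A) → S) (a : A) (b : Fin n → A) :
    ∑ σ : Equiv.Perm (Fin (n + 1)), (Equiv.Perm.sign σ : ℤ) •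
        f (fun i => (Fin.cons a b : Fin (n + 1) → A) (σ i)) =
      ∑ p : Fin (n + 1), ∑ e : Equiv.Perm (Fin n), (-1 : ℤ) ^ (p : ℕ) •
        (Equiv.Perm.sign e : ℤ) • f (p.insertNth a fun i => b (e i)) := by
  rw [← Fintype.sum_prod_type']
  -- `cycleRange` sends `p` to `0` and `e` then permutes the remaining indices, so `p` is recovered
  -- as the preimage of `0`.
  let F : Fin (n + 1) × Equiv.Perm (Fin n) → Equiv.Perm (Fin (n + 1)) := fun pe =>
    Equiv.Perm.decomposeFin.symm (0, pe.2) * pe.1.cycleRange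
  have hF : Function.Bijective F := by
    rw [Fintype.bijective_iff_injective_and_card]
    constructor
    · rintro ⟨p, e⟩ ⟨p', e'⟩ hpe
      have h0 : ∀ (p : Fin (n + 1)) (e : Equiv.Perm (Fin n)), (F (p, e)).symm 0 = p := by
        intro p e
        rw [Equiv.symm_apply_eq]
        simp [F]
      have hp : p = p' := by rw [← h0 p e, hpe, h0]
      subst hp
      have := mul_right_cancel hpe
      simpa using this
    · simp [Fintype.card_perm, Nat.factorial_succ]
  refine (Fintype.sum_bijective F hF _ _ fun ⟨p, e⟩ => ?_).symm
  have h1 : (fun i => (Fin.cons a b : Fin (n + 1) → A) (F (p, e) i)) =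
      p.insertNth a fun i => b (e i) := by
    rw [← Fin.cons_comp_cycleRange]
    funext i
    simp only [F, Equiv.Perm.mul_apply, comp]
    generalize p.cycleRange i = j
    refine Fin.cases ?_ (fun j => ?_) j <;> simp
  rw [h1, smul_smul]
  congr 1
  simp [F, Equiv.Perm.decomposeFin.symm_sign, Fin.sign_cycleRange, mul_comm]

theorem insertNth_castAdd {k q n : ℕ} (h : k + 1 + q = n + 1) (h' : k + q = n) (p : Fin (k + 1))
    (a : A) (y : Fin n → A) :
    (fun i => (Fin.cast h (Fin.castAdd q p)).insertNth (α := fun _ => A) a y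
        (Fin.cast h (Fin.castAdd q i))) =
      p.insertNth (α := fun _ => A) a (fun i => y (Fin.cast h' (Fin.castAdd q i))) ∧
    (fun i => (Fin.cast h (Fin.castAdd q p)).insertNth (α := fun _ => A) a y
        (Fin.cast h (Fin.natAdd (k + 1) i))) = fun i => y (Fin.cast h' (Fin.natAdd k i)) := by
  subst h'
  constructor
  · funext i
    induction i using Fin.succAboveCases p with
    | x => simp
    | p j =>
      have : Fin.cast h (Fin.castAdd q (p.succAbove j)) =
          (Fin.cast h (Fin.castAdd q p)).succAbove (Fin.castAdd q j) := by
        ext; simp [Fin.succAbove, Fin.lt_def]; split_ifs <;> simp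
      rw [this]; simp
  · funext i
    have : Fin.cast h (Fin.natAdd (k + 1) i) =
          (Fin.cast h (Fin.castAdd q p)).succAbove (Fin.natAdd k i) := by
      have := p.2
      ext; simp [Fin.succAbove, Fin.lt_def]; split_ifs <;> simp <;> omega
    rw [this]; simp

theorem insertNth_natAdd {k q n : ℕ} (h : k + (q + 1) = n + 1) (h' : k + q = n) (p : Fin (q + 1))
    (a : A) (y : Fin n → A) :
    (fun i => (Fin.cast h (Fin.natAdd k p)).insertNth (α := fun _ => A) a y
        (Fin.cast h (Fin.natAdd k i))) =
      p.insertNth (α := fun _ => A) a (fun i => y (Fin.cast h' (Fin.natAdd k i))) ∧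
    (fun i => (Fin.cast h (Fin.natAdd k p)).insertNth (α := fun _ => A) a y
        (Fin.cast h (Fin.castAdd (q + 1) i))) = fun i => y (Fin.cast h' (Fin.castAdd q i)) := by
  subst h'
  constructor
  · funext i
    induction i using Fin.succAboveCases p with
    | x => simp
    | p j =>
      have : Fin.cast h (Fin.natAdd k (p.succAbove j)) =
          (Fin.cast h (Fin.natAdd k p)).succAbove (Fin.natAdd k j) := by
        ext; simp [Fin.succAbove, Fin.lt_def]; split_ifs <;> simp <;> omega
      rw [this]; simp
  · funext i
    have : Fin.cast h (Fin.castAdd (q + 1) i) =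
          (Fin.cast h (Fin.natAdd k p)).succAbove (Fin.castAdd q i) := by
      have := i.2
      ext; simp [Fin.succAbove, Fin.lt_def]; split_ifs <;> simp; omega
    rw [this]; simp

/-- The sign of the position of `a` cancels against moving `a` to the front inside `w`, so all
positions in the first block contribute equally. For the second block only the sign `(-1)^k` of
crossing the first block survives. -/
theorem sum_perm_first {k q n : ℕ} (h : k + 1 + q = n + 1) (h' : k + q = n)
    (w : A [⋀^Fin (k + 1)]→ₗ[R] P) (u : A [⋀^Fin q]→ₗ[R] Q) (a : A) (b : Fin n → A)
    (p : Fin (k + 1)) :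
    ∑ e : Equiv.Perm (Fin n), (-1 : ℤ) ^ (p : ℕ) • (Equiv.Perm.sign e : ℤ) •
      B (w fun i => (Fin.cast h (Fin.castAdd q p)).insertNth (α := fun _ => A) a
          (fun i => b (e i)) (Fin.cast h (Fin.castAdd q i)))
        (u fun i => (Fin.cast h (Fin.castAdd q p)).insertNth (α := fun _ => A) a
          (fun i => b (e i)) (Fin.cast h (Fin.natAdd (k + 1) i))) =
      (k.factorial * q.factorial) • pairWedge B h' (w.curryLeft a) u b := by
  rw [factorial_smul_pairWedge]
  refine Finset.sum_congr rfl fun e _ => ?_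
  rw [(insertNth_castAdd h h' p a _).1, (insertNth_castAdd h h' p a _).2, w.map_insertNth,
    map_zsmul, LinearMap.smul_apply, smul_comm, smul_smul ((-1 : ℤ) ^ _), ← pow_add,
    Even.neg_one_pow ⟨_, rfl⟩, one_smul]
  rfl

theorem sum_perm_second {k q n : ℕ} (h : k + (q + 1) = n + 1) (h' : k + q = n)
    (w : A [⋀^Fin k]→ₗ[R] P) (u : A [⋀^Fin (q + 1)]→ₗ[R] Q) (a : A) (b : Fin n → A)
    (p : Fin (q + 1)) :
    ∑ e : Equiv.Perm (Fin n), (-1 : ℤ) ^ (k + p : ℕ) • (Equiv.Perm.sign e : ℤ) •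
      B (w fun i => (Fin.cast h (Fin.natAdd k p)).insertNth (α := fun _ => A) a
          (fun i => b (e i)) (Fin.cast h (Fin.castAdd (q + 1) i)))
        (u fun i => (Fin.cast h (Fin.natAdd k p)).insertNth (α := fun _ => A) a
          (fun i => b (e i)) (Fin.cast h (Fin.natAdd k i))) =
      (k.factorial * q.factorial) • (-1 : ℤ) ^ k • pairWedge B h' w (u.curryLeft a) b := by
  rw [smul_comm, factorial_smul_pairWedge, Finset.smul_sum]
  refine Finset.sum_congr rfl fun e _ => ?_
  rw [(insertNth_natAdd h h' p a _).1, (insertNth_natAdd h h' p a _).2, u.map_insertNth,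
    map_zsmul, pow_add, smul_comm (Equiv.Perm.sign e : ℤ), mul_smul, smul_smul ((-1 : ℤ) ^ (p : ℕ)),
    ← pow_add, Even.neg_one_pow ⟨_, rfl⟩, one_smul]
  rfl

theorem factorial_smul_pairWedge_cons {k q n : ℕ} (h : k + q = n + 1) (w : A [⋀^Fin k]→ₗ[R] P)
    (u : A [⋀^Fin q]→ₗ[R] Q) (a : A) (b : Fin n → A) :
    (k.factorial * q.factorial) • pairWedge B h w u (Fin.cons a b) =
      (∑ p : Fin k, ∑ e : Equiv.Perm (Fin n), (-1 : ℤ) ^ (p : ℕ) • (Equiv.Perm.sign e : ℤ) •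
        B (w fun i => (Fin.cast h (Fin.castAdd q p)).insertNth (α := fun _ => A) a
            (fun i => b (e i)) (Fin.cast h (Fin.castAdd q i)))
          (u fun i => (Fin.cast h (Fin.castAdd q p)).insertNth (α := fun _ => A) a
            (fun i => b (e i)) (Fin.cast h (Fin.natAdd k i)))) +
      ∑ p : Fin q, ∑ e : Equiv.Perm (Fin n), (-1 : ℤ) ^ (k + p : ℕ) • (Equiv.Perm.sign e : ℤ) •
        B (w fun i => (Fin.cast h (Fin.natAdd k p)).insertNth (α := fun _ => A) a
            (fun i => b (e i)) (Fin.cast h (Fin.castAdd q i)))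
          (u fun i => (Fin.cast h (Fin.natAdd k p)).insertNth (α := fun _ => A) a
            (fun i => b (e i)) (Fin.cast h (Fin.natAdd k i))) := by
  rw [factorial_smul_pairWedge, sum_perm_cons (fun x => B (w fun i => x (Fin.cast h (Fin.castAdd q i)))
    (u fun i => x (Fin.cast h (Fin.natAdd k i)))), ← (finCongr h).sum_comp, Fin.sum_univ_add]
  rfl

variable [Algebra ℝ R]

theorem nsmul_left_cancel_of_real {R S : Type*} [CommRing R] [Algebra ℝ R] [AddCommGroup S]
    [Module R S] {m : ℕ} (hm : m ≠ 0) {x y : S} (h : m • x = m • y) : x = y := by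
  have : ∀ z : S, algebraMap ℝ R ((m : ℝ)⁻¹) • (m • z) = z := by
    intro z
    rw [← Nat.cast_smul_eq_nsmul R, smul_smul, ← map_natCast (algebraMap ℝ R), ← map_mul,
      inv_mul_cancel₀ (by exact_mod_cast hm), map_one, one_smul]
  rw [← this x, h, this]

/-- The interior product is an antiderivation. The `k + 1` equal contributions of the first block
and the `q + 1` of the second complete `k!` and `q!` to the factorials that are cancelled. -/
theorem pairWedge_curryLeft_succ_succ {k q n : ℕ} (h : k + 1 + (q + 1) = n + 1)
    (h₁ : k + (q + 1) = n) (h₂ : k + 1 + q = n)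
    (w : A [⋀^Fin (k + 1)]→ₗ[R] P) (u : A [⋀^Fin (q + 1)]→ₗ[R] Q) (a : A) :
    (pairWedge B h w u).curryLeft a = pairWedge B h₁ (w.curryLeft a) u +
      (-1 : ℤ) ^ (k + 1) • pairWedge B h₂ w (u.curryLeft a) := by
  ext b
  refine nsmul_left_cancel_of_real (R := R) (m := (k + 1).factorial * (q + 1).factorial)
    (by positivity) ?_
  change _ • pairWedge B h w u (Fin.cons a b) = _
  rw [factorial_smul_pairWedge_cons, Finset.sum_congr rfl fun p _ => sum_perm_first B h h₁ w u a b p,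
    Finset.sum_congr rfl fun p _ => sum_perm_second B h h₂ w u a b p]
  simp only [Finset.sum_const, Finset.card_univ, Fintype.card_fin, AlternatingMap.add_apply,
    AlternatingMap.smul_apply, smul_add, smul_smul, Nat.factorial_succ]
  congr 1 <;> congr 1 <;> ring

theorem pairWedge_curryLeft_zero_left {q n : ℕ} (h : 0 + (q + 1) = n + 1) (h₂ : 0 + q = n)
    (w : A [⋀^Fin 0]→ₗ[R] P) (u : A [⋀^Fin (q + 1)]→ₗ[R] Q) (a : A) :
    (pairWedge B h w u).curryLeft a = pairWedge B h₂ w (u.curryLeft a) := by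
  ext b
  refine nsmul_left_cancel_of_real (R := R) (m := (0).factorial * (q + 1).factorial)
    (by positivity) ?_
  change _ • pairWedge B h w u (Fin.cons a b) = _
  rw [factorial_smul_pairWedge_cons,
    Finset.sum_congr rfl fun p _ => sum_perm_second B h h₂ w u a b p]
  simp only [Finset.sum_const, Finset.card_univ, Fintype.card_fin, smul_smul, Nat.factorial_succ, Finset.univ_eq_empty,
    Finset.sum_empty, zero_add, pow_zero, one_smul, Nat.factorial_zero, one_mul]

theorem pairWedge_curryLeft_zero_right {k n : ℕ} (h : k + 1 + 0 = n + 1) (h₁ : k + 0 = n)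
    (w : A [⋀^Fin (k + 1)]→ₗ[R] P) (u : A [⋀^Fin 0]→ₗ[R] Q) (a : A) :
    (pairWedge B h w u).curryLeft a = pairWedge B h₁ (w.curryLeft a) u := by
  ext b
  refine nsmul_left_cancel_of_real (R := R) (m := (k + 1).factorial * (0).factorial)
    (by positivity) ?_
  change _ • pairWedge B h w u (Fin.cons a b) = _
  rw [factorial_smul_pairWedge_cons, Finset.sum_congr rfl fun p _ => sum_perm_first B h h₁ w u a b p]
  simp only [Finset.sum_const, Finset.card_univ, Fintype.card_fin, smul_smul, Nat.factorial_succ, Finset.univ_eq_empty,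
    Finset.sum_empty, add_zero, Nat.factorial_zero, mul_one]

/-- A shuffle product with a `0`-form is the pairing with its value. -/
theorem pairWedge_zero_left {q n : ℕ} (h : 0 + q = n) (w : A [⋀^Fin 0]→ₗ[R] P)
    (u : A [⋀^Fin q]→ₗ[R] Q) (v : Fin n → A) :
    pairWedge B h w u v = B (w ![]) (u fun i => v (Fin.cast (by omega) i)) := by
  induction n generalizing q with
  | zero =>
    obtain rfl : q = 0 := by omega
    refine nsmul_left_cancel_of_real (R := R) (m := (0).factorial * (0).factorial)
      (by positivity) ?_
    rw [factorial_smul_pairWedge]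
    simp [Subsingleton.elim (fun i : Fin 0 => _) ![]]
  | succ n ih =>
    obtain ⟨q, rfl⟩ : ∃ q', q = q' + 1 := ⟨n, by omega⟩
    rw [← Fin.cons_self_tail v]
    change (pairWedge B h w u).curryLeft (v 0) (Fin.tail v) = _
    rw [pairWedge_curryLeft_zero_left B h (by omega), ih]
    obtain rfl : q = n := by omega
    congr 2

end
end HomotopyModules

/-! ### The graded product on forms of all degrees. -/

namespace HomotopyModules
open Function Bundle
open scoped TensorProduct

/-- Differential forms of all degrees. -/
abbrev Form (R A P : Type*) [CommRing R] [AddCommGroup A] [Module R A]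
    [AddCommGroup P] [Module R P] : Type _ := ∀ k : ℕ, A [⋀^Fin k]→ₗ[R] P

namespace Form
section
variable {R A P Q S : Type*} [CommRing R] [AddCommGroup A] [Module R A]
  [AddCommGroup P] [Module R P] [AddCommGroup Q] [Module R Q] [AddCommGroup S] [Module R S]

theorem alternatingMap_sum_apply {ι : Type*} {n : ℕ} (s : Finset ι) (f : ι → A [⋀^Fin n]→ₗ[R] P)
    (v : Fin n → A) : (∑ i ∈ s, f i) v = ∑ i ∈ s, f i v :=
  map_sum (AddMonoidHom.mk' (fun f : A [⋀^Fin n]→ₗ[R] P => f v) fun _ _ => rfl) f s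

/-- The interior product. -/
def contr (a : A) : Form R A P →ₗ[R] Form R A P where
  toFun u k := (u (k + 1)).curryLeft a
  map_add' _ _ := rfl
  map_smul' _ _ := rfl

/-- The parity operator `(-1)^k` on `k`-forms. -/
def par : Form R A P →ₗ[R] Form R A P where
  toFun u k := (-1 : ℤ) ^ k • u k
  map_add' u v := by funext k; simp
  map_smul' r u := by funext k; simp [smul_comm r]

/-- Composition with a linear map on the values. -/
def map (f : P →ₗ[R] Q) : Form R A P →ₗ[R] Form R A Q where
  toFun u k := f.compAlternatingMap (u k)
  map_add' u v := by funext k; ext; simp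
  map_smul' r u := by funext k; ext; simp

theorem par_apply (u : Form R A P) (k : ℕ) : par u k = (-1 : ℤ) ^ k • u k := rfl
theorem contr_apply (a : A) (u : Form R A P) (k : ℕ) (v : Fin k → A) :
    contr a u k v = u (k + 1) (Fin.cons a v) := rfl
@[simp] theorem map_apply (f : P →ₗ[R] Q) (u : Form R A P) (k : ℕ) (v : Fin k → A) :
    map f u k v = f (u k v) := rfl

@[simp] theorem par_par (u : Form R A P) : par (par u) = u := by
  funext k
  rw [par_apply, par_apply, smul_smul, ← pow_add, Even.neg_one_pow ⟨_, rfl⟩, one_smul]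

@[simp] theorem contr_par (a : A) (u : Form R A P) : contr a (par u) = - par (contr a u) := by
  funext k; ext v
  simp [contr_apply, par_apply, pow_succ]

theorem map_par (f : P →ₗ[R] Q) (u : Form R A P) : map f (par u) = par (map f u) := by
  funext k; ext v; simp [par_apply]

theorem contr_add (a b : A) (u : Form R A P) : contr (a + b) u = contr a u + contr b u := by
  funext k
  exact map_add (u (k + 1)).curryLeft a b

theorem contr_smul (r : R) (a : A) (u : Form R A P) : contr (r • a) u = r • contr a u := by
  funext k
  exact map_smul (u (k + 1)).curryLeft r a

theorem map_contr (f : P →ₗ[R] Q) (a : A) (u : Form R A P) :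
    map f (contr a u) = contr a (map f u) := rfl

theorem contr_contr_self (a : A) (u : Form R A P) : contr a (contr a u) = 0 := by
  funext k
  exact AlternatingMap.curryLeft_same _ _

/-- The engine of the calculus: together with `apply_zero_eq` it reduces an identity of forms to
degree zero and to the behaviour of both sides under `contr`. The inductions keep the forms general,
since contraction changes them. -/
theorem apply_succ_eq {u u' : Form R A P} {n : ℕ} (h : ∀ a, contr a u n = contr a u' n) :
    u (n + 1) = u' (n + 1) := by
  ext v
  rw [← Fin.cons_self_tail v]
  exact congrArg (fun m => m (Fin.tail v)) (h (v 0))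

theorem apply_zero_eq {u u' : Form R A P} (h : u 0 ![] = u' 0 ![]) : u 0 = u' 0 := by
  ext v
  rwa [Subsingleton.elim v ![]]

variable (B : P →ₗ[R] Q →ₗ[R] S)

/-- The summand of index `k` in degree `n` of the product of two forms. -/
noncomputable def cupTerm (w : Form R A P) (u : Form R A Q) (n k : ℕ) : A [⋀^Fin n]→ₗ[R] S :=
  if h : k ≤ n then pairWedge B (show k + (n - k) = n by omega) (w k) (u (n - k)) else 0

theorem cupTerm_eq (w : Form R A P) (u : Form R A Q) {n k q : ℕ} (h : k + q = n) :
    cupTerm B w u n k = pairWedge B h (w k) (u q) := by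
  obtain rfl : q = n - k := by omega
  exact dif_pos (by omega)

theorem cupTerm_of_lt (w : Form R A P) (u : Form R A Q) {n k : ℕ} (h : n < k) :
    cupTerm B w u n k = 0 := dif_neg (by omega)

/-- The product of forms along a bilinear pairing of the values. -/
noncomputable def cup : Form R A P →ₗ[R] Form R A Q →ₗ[R] Form R A S :=
  LinearMap.mk₂ R (fun w u n => ∑ k ∈ Finset.range (n + 1), cupTerm B w u n k)
    (fun w w' u => by
      funext n
      rw [Pi.add_apply, ← Finset.sum_add_distrib]
      refine Finset.sum_congr rfl fun k hk => ?_
      have h : k + (n - k) = n := by have := Finset.mem_range.1 hk; omega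
      simp only [cupTerm_eq B _ _ h, Pi.add_apply, pairWedge_add_left])
    (fun r w u => by
      funext n
      rw [Pi.smul_apply, Finset.smul_sum]
      refine Finset.sum_congr rfl fun k hk => ?_
      have h : k + (n - k) = n := by have := Finset.mem_range.1 hk; omega
      simp only [cupTerm_eq B _ _ h, Pi.smul_apply, pairWedge_smul_left])
    (fun w u u' => by
      funext n
      rw [Pi.add_apply, ← Finset.sum_add_distrib]
      refine Finset.sum_congr rfl fun k hk => ?_
      have h : k + (n - k) = n := by have := Finset.mem_range.1 hk; omega
      simp only [cupTerm_eq B _ _ h, Pi.add_apply, pairWedge_add_right])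
    (fun r w u => by
      funext n
      rw [Pi.smul_apply, Finset.smul_sum]
      refine Finset.sum_congr rfl fun k hk => ?_
      have h : k + (n - k) = n := by have := Finset.mem_range.1 hk; omega
      simp only [cupTerm_eq B _ _ h, Pi.smul_apply, pairWedge_smul_right])

theorem cup_apply (w : Form R A P) (u : Form R A Q) (n : ℕ) :
    cup B w u n = ∑ k ∈ Finset.range (n + 1), cupTerm B w u n k := rfl

theorem cup_mem (T : AddSubgroup S) (w : Form R A P) (u : Form R A Q) (n : ℕ)
    (hT : ∀ k q, k + q = n → ∀ x y, B (w k x) (u q y) ∈ T) (v : Fin n → A) :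
    cup B w u n v ∈ T := by
  rw [cup_apply, alternatingMap_sum_apply]
  refine sum_mem fun k hk => ?_
  have h : k + (n - k) = n := by have := Finset.mem_range.1 hk; omega
  rw [cupTerm_eq B _ _ h]
  exact pairWedge_mem B T h _ _ (hT _ _ h) v

variable [Algebra ℝ R]

theorem contr_cupTerm_succ (w : Form R A P) (u : Form R A Q) (a : A) {n k : ℕ} (hk : k ≤ n) :
    (cupTerm B w u (n + 1) (k + 1)).curryLeft a =
      cupTerm B (contr a w) u n k + cupTerm B (par w) (contr a u) n (k + 1) := by
  obtain ⟨q, rfl⟩ := Nat.exists_eq_add_of_le hk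
  rw [cupTerm_eq B w u (show k + 1 + q = k + q + 1 by omega), cupTerm_eq B _ _ rfl]
  cases q with
  | zero =>
    -- Here `u` contributes its component of degree zero, which has nothing to contract; the second
    -- summand has index `k + 1` in degree `k` and vanishes by convention.
    rw [cupTerm_of_lt _ _ _ (by omega)]
    exact (pairWedge_curryLeft_zero_right B _ _ _ _ _).trans (add_zero _).symm
  | succ q =>
    rw [cupTerm_eq B (par w) _ (show k + 1 + q = k + (q + 1) by omega),
      pairWedge_curryLeft_succ_succ B _ rfl (show k + 1 + q = k + (q + 1) by omega), par_apply,
      ← Int.cast_smul_eq_zsmul R _ (w (k + 1)), pairWedge_smul_left, Int.cast_smul_eq_zsmul]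
    rfl

theorem contr_cupTerm_zero (w : Form R A P) (u : Form R A Q) (a : A) (n : ℕ) :
    (cupTerm B w u (n + 1) 0).curryLeft a = cupTerm B (par w) (contr a u) n 0 := by
  rw [cupTerm_eq B w u (show 0 + (n + 1) = n + 1 by omega),
    cupTerm_eq B _ _ (show 0 + n = n by omega), par_apply, pow_zero, one_smul]
  exact pairWedge_curryLeft_zero_left B _ _ _ _ _

/-- The antiderivation rule without explicit degrees. The terms differentiating `w` come from the
indices `k + 1`; those differentiating `u` fill the indices `0, …, n + 1`, the last of which is
zero. -/
theorem contr_cup (w : Form R A P) (u : Form R A Q) (a : A) :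
    contr a (cup B w u) = cup B (contr a w) u + cup B (par w) (contr a u) := by
  funext n
  change (cup B w u (n + 1)).curryLeft a = cup B _ _ n + cup B _ _ n
  have hs : (cup B w u (n + 1)).curryLeft a =
      ∑ k ∈ Finset.range (n + 2), (cupTerm B w u (n + 1) k).curryLeft a := by
    ext v
    rw [alternatingMap_sum_apply, AlternatingMap.curryLeft_apply_apply, cup_apply,
      alternatingMap_sum_apply]
    rfl
  rw [hs, Finset.sum_range_succ', contr_cupTerm_zero,
    Finset.sum_congr rfl fun k hk => contr_cupTerm_succ B w u a
      (Nat.lt_succ_iff.1 (Finset.mem_range.1 hk)), Finset.sum_add_distrib, add_assoc,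
    ← Finset.sum_range_succ' (fun k => cupTerm B (par w) (contr a u) n k),
    Finset.sum_range_succ _ (n + 1), cupTerm_of_lt _ _ _ (by omega), add_zero]
  rfl

theorem cup_zero_apply (w : Form R A P) (u : Form R A Q) :
    cup B w u 0 ![] = B (w 0 ![]) (u 0 ![]) := by
  rw [cup_apply]
  simp only [zero_add, Finset.range_one, Finset.sum_singleton]
  rw [cupTerm_eq B _ _ (show 0 + 0 = 0 from rfl), pairWedge_zero_left]
  congr 2

@[simp] theorem par_cup (w : Form R A P) (u : Form R A Q) :
    par (cup B w u) = cup B (par w) (par u) := by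
  funext n
  induction n generalizing w u with
  | zero =>
    apply apply_zero_eq
    simp [par_apply, cup_zero_apply]
  | succ n ih =>
    refine apply_succ_eq fun a => ?_
    simp only [contr_par, contr_cup, map_add, map_neg, LinearMap.neg_apply, Pi.neg_apply,
      Pi.add_apply, ih, par_par, neg_add]

theorem map_cup {T : Type*} [AddCommGroup T] [Module R T] (f : S →ₗ[R] T) (w : Form R A P)
    (u : Form R A Q) : map f (cup B w u) = cup (B.compr₂ f) w u := by
  funext n
  induction n generalizing w u with
  | zero =>
    apply apply_zero_eq
    simp [cup_zero_apply]
  | succ n ih =>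
    refine apply_succ_eq fun a => ?_
    simp only [← map_contr, contr_cup, map_add, Pi.add_apply, ih]

theorem cup_map_left {P' : Type*} [AddCommGroup P'] [Module R P'] (f : P' →ₗ[R] P)
    (w : Form R A P') (u : Form R A Q) : cup B (map f w) u = cup (B ∘ₗ f) w u := by
  funext n
  induction n generalizing w u with
  | zero =>
    apply apply_zero_eq
    simp [cup_zero_apply]
  | succ n ih =>
    refine apply_succ_eq fun a => ?_
    simp only [← map_contr, contr_cup, Pi.add_apply, ih, ← map_par]

theorem cup_map_right {Q' : Type*} [AddCommGroup Q'] [Module R Q'] (f : Q' →ₗ[R] Q)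
    (w : Form R A P) (u : Form R A Q') : cup B w (map f u) = cup (B.compl₂ f) w u := by
  funext n
  induction n generalizing w u with
  | zero =>
    apply apply_zero_eq
    simp [cup_zero_apply]
  | succ n ih =>
    refine apply_succ_eq fun a => ?_
    simp only [← map_contr, contr_cup, Pi.add_apply, ih]

/-- Associativity, for compatible pairings. -/
theorem cup_assoc {P₁ P₂ P₃ P₁₂ P₂₃ T : Type*} [AddCommGroup P₁] [Module R P₁] [AddCommGroup P₂]
    [Module R P₂] [AddCommGroup P₃] [Module R P₃] [AddCommGroup P₁₂] [Module R P₁₂]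
    [AddCommGroup P₂₃] [Module R P₂₃] [AddCommGroup T] [Module R T]
    (B₁₂ : P₁ →ₗ[R] P₂ →ₗ[R] P₁₂) (C : P₁₂ →ₗ[R] P₃ →ₗ[R] T) (B₂₃ : P₂ →ₗ[R] P₃ →ₗ[R] P₂₃)
    (C' : P₁ →ₗ[R] P₂₃ →ₗ[R] T) (hC : ∀ x y z, C (B₁₂ x y) z = C' x (B₂₃ y z))
    (x : Form R A P₁) (y : Form R A P₂) (z : Form R A P₃) :
    cup C (cup B₁₂ x y) z = cup C' x (cup B₂₃ y z) := by
  funext n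
  induction n generalizing x y z with
  | zero =>
    apply apply_zero_eq
    simp [cup_zero_apply, hC]
  | succ n ih =>
    refine apply_succ_eq fun a => ?_
    simp only [contr_cup, map_add, LinearMap.add_apply, Pi.add_apply, ih, par_cup, add_assoc]

/-- Graded commutativity. -/
theorem cup_comm (n : ℕ) : ∀ (w : Form R A P) (u : Form R A Q),
    (par w = w → cup B w u n = cup B.flip u w n) ∧
    (par w = -w → cup B w u n = cup B.flip (par u) w n) := by
  induction n with
  | zero =>
    intro w u
    refine ⟨fun _ => ?_, fun _ => ?_⟩ <;> apply apply_zero_eq <;>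
      simp [cup_zero_apply, par_apply]
  | succ n ih =>
    refine fun w u => ⟨fun h => ?_, fun h => ?_⟩ <;> refine apply_succ_eq fun a => ?_
    -- Contraction flips the parity of `w`, which is why the even and the odd case form a single
    -- induction.
    · have h' : par (contr a w) = - contr a w := by
        rw [eq_neg_iff_add_eq_zero, ← neg_eq_iff_add_eq_zero, ← contr_par, h]
      simp only [contr_cup, Pi.add_apply, h]
      rw [(ih _ _).2 h', (ih _ _).1 h, add_comm]
    · have h' : par (contr a w) = contr a w := by
        rw [← neg_inj, ← contr_par, h, map_neg]
      simp only [contr_cup, Pi.add_apply, h, contr_par, par_par, map_neg, LinearMap.neg_apply,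
        Pi.neg_apply]
      rw [(ih _ _).1 h', (ih _ _).2 h, add_comm]

theorem even_cup {w : Form R A P} (h : par w = w) (u : Form R A Q) :
    cup B w u = cup B.flip u w := funext fun n => (cup_comm B n w u).1 h

theorem odd_cup {w : Form R A P} (h : par w = -w) (u : Form R A Q) :
    cup B w u = cup B.flip (par u) w := funext fun n => (cup_comm B n w u).2 h

end
end Form
end HomotopyModules

/-! ### Cartan calculus of a connection and its curvature form. -/

namespace HomotopyModules
open Function Bundle
open scoped TensorProduct

section
variable {R A P Q S N : Type*} [CommRing R] [Algebra ℝ R] [AddCommGroup A] [Module R A]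
  [AddCommGroup P] [Module R P] [AddCommGroup Q] [Module R Q] [AddCommGroup S] [Module R S]
  [AddCommGroup N] [Module R N] {g : LieRinehart R A}

open Form

namespace LieRinehart.Connection

variable (D : g.Connection P)

/-- The exterior covariant derivative as an additive map. -/
def extD : Form R A P →+ Form R A P where
  toFun u
    | 0 => 0
    | k + 1 => D.extDeriv (u k)
  map_zero' := by
    funext k
    cases k with
    | zero => rfl
    | succ k =>
      have h := D.extDeriv_add (0 : A [⋀^Fin k]→ₗ[R] P) 0
      rw [add_zero] at h
      exact left_eq_add.1 h
  map_add' u u' := by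
    funext k
    cases k with
    | zero => simp
    | succ k => exact D.extDeriv_add _ _

theorem extDerivTotal_eq_extD [Module ℝ P] [IsScalarTower ℝ R P] (u : Form R A P) :
    D.extDerivTotal u = D.extD u := by
  funext k
  cases k <;> rfl

@[simp] theorem extD_zero_apply (u : Form R A P) : D.extD u 0 = 0 := rfl

/-- The Lie derivative of forms. -/
def lie (a : A) : Form R A P →+ Form R A P where
  toFun u k := D.lieDer a (u k)
  map_zero' := by
    funext k; ext v
    change D.nabla a 0 - ∑ i : Fin k, (0 : P) = 0
    simp [D.zero_right]
  map_add' u u' := by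
    funext k; ext v
    change D.nabla a (u k v + u' k v) - ∑ i : Fin k, (u k _ + u' k _) =
      (D.nabla a (u k v) - ∑ i : Fin k, u k _) + (D.nabla a (u' k v) - ∑ i : Fin k, u' k _)
    rw [D.add_right, Finset.sum_add_distrib]
    abel

theorem lie_apply (a : A) (u : Form R A P) (k : ℕ) (v : Fin k → A) :
    D.lie a u k v = D.nabla a (u k v) - ∑ i, u k (update v i (g.bracket a (v i))) := rfl

theorem lie_zero_apply (a : A) (u : Form R A P) :
    D.lie a u 0 ![] = D.nabla a (u 0 ![]) := by simp [lie_apply]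

/-- Cartan's formula. With `contr_lie` it determines `extD` recursively, so the explicit alternating
sums are not needed in the inductions that follow. -/
theorem contr_extD (a : A) (u : Form R A P) :
    contr a (D.extD u) = D.lie a u - D.extD (contr a u) := by
  funext k; ext b
  cases k with
  | zero =>
    change D.extDerivFun (u 0) (Fin.cons a b) = D.lieDer a (u 0) b - 0
    simp [extDerivFun, lieDer, Subsingleton.elim b ![]]
  | succ k => exact D.extDerivFun_cons (u (k + 1)) a b

theorem contr_lie (a b : A) (u : Form R A P) :
    contr b (D.lie a u) = D.lie a (contr b u) - contr (g.bracket a b) u := by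
  funext k; ext v
  change D.lie a u (k + 1) (Fin.cons b v) = D.lie a (contr b u) k v - u (k + 1) (Fin.cons _ v)
  rw [lie_apply, lie_apply, Fin.sum_univ_succ]
  simp only [Fin.cons_zero, Fin.update_cons_zero, Fin.cons_succ, ← Fin.cons_update, contr_apply]
  abel

theorem lie_par (a : A) (u : Form R A P) : D.lie a (par u) = par (D.lie a u) := by
  funext k; ext v
  have hn : ∀ (z : ℤ) x, D.nabla a (z • x) = z • D.nabla a x := fun z x =>
    map_zsmul (AddMonoidHom.mk' (D.nabla a) (D.add_right a)) z x
  simp [lie_apply, par_apply, hn, smul_sub, Finset.smul_sum]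

theorem par_extD (u : Form R A P) : par (D.extD u) = - D.extD (par u) := by
  funext n
  induction n generalizing u with
  | zero => apply apply_zero_eq; simp [par_apply]
  | succ n ih =>
    refine apply_succ_eq fun a => ?_
    rw [contr_par, map_neg, contr_extD, contr_extD, map_sub, contr_par, map_neg, lie_par]
    simp only [Pi.neg_apply, Pi.sub_apply, ih]

theorem map_extD (D' : g.Connection Q) (f : P →ₗ[R] Q)
    (hf : ∀ a e, f (D.nabla a e) = D'.nabla a (f e)) (u : Form R A P) :
    map f (D.extD u) = D'.extD (map f u) := by
  have hl : ∀ a (u : Form R A P), map f (D.lie a u) = D'.lie a (map f u) := by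
    intro a u
    funext k; ext v
    simp [lie_apply, hf]
  funext n
  induction n generalizing u with
  | zero => apply apply_zero_eq; simp
  | succ n ih =>
    refine apply_succ_eq fun a => ?_
    rw [← map_contr, contr_extD, contr_extD, map_sub, hl]
    simp only [Pi.sub_apply, ih, map_contr]

section leibniz
variable (D₁ : g.Connection P) (D₂ : g.Connection Q) (D₃ : g.Connection S)
  (B : P →ₗ[R] Q →ₗ[R] S)
  (hB : ∀ a p q, D₃.nabla a (B p q) = B (D₁.nabla a p) q + B p (D₂.nabla a q))
include hB

theorem lie_cup (a : A) (w : Form R A P) (u : Form R A Q) :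
    D₃.lie a (cup B w u) = cup B (D₁.lie a w) u + cup B w (D₂.lie a u) := by
  funext n
  induction n generalizing w u with
  | zero =>
    apply apply_zero_eq
    change D₃.lie a _ 0 ![] = cup B (D₁.lie a w) u 0 ![] + cup B w (D₂.lie a u) 0 ![]
    simp only [lie_zero_apply, cup_zero_apply, hB]
  | succ n ih =>
    refine apply_succ_eq fun b => ?_
    simp only [contr_lie, contr_cup, map_add, map_sub, LinearMap.sub_apply, Pi.add_apply,
      Pi.sub_apply, ih, lie_par]
    abel

/-- The hypothesis `hB` says that the pairing is parallel. The induction uses that the Lie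
derivative is then a derivation without signs (`lie_cup`). -/
theorem extD_cup (w : Form R A P) (u : Form R A Q) :
    D₃.extD (cup B w u) = cup B (D₁.extD w) u + cup B (par w) (D₂.extD u) := by
  funext n
  induction n generalizing w u with
  | zero =>
    apply apply_zero_eq
    change (0 : S) = cup B (D₁.extD w) u 0 ![] + cup B (par w) (D₂.extD u) 0 ![]
    simp [cup_zero_apply]
  | succ n ih =>
    refine apply_succ_eq fun b => ?_
    rw [contr_extD, D₁.lie_cup D₂ D₃ B hB]
    simp only [contr_cup, map_add, map_sub, LinearMap.sub_apply, Pi.add_apply,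
      Pi.sub_apply, ih, contr_extD, contr_par, map_neg, LinearMap.neg_apply, Pi.neg_apply, par_par,
      par_extD]
    abel

end leibniz

/-- The curvature as an endomorphism. -/
def curvEnd (a b : A) : EndMod R P where
  toFun := D.curvature a b
  map_add' e e' := by simp only [curvature, D.add_right]; abel
  map_smul' r e := by
    simp only [curvature, D.add_right, D.leibniz, g.anchor_bracket, RingHom.id_apply, smul_sub,
      sub_smul]
    abel

theorem curvEnd_add_left (a a' b : A) : D.curvEnd (a + a') b = D.curvEnd a b + D.curvEnd a' b := by
  ext e
  change D.curvature _ _ _ = D.curvature _ _ _ + D.curvature _ _ _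
  simp only [curvature, D.add_left, D.add_right, g.bracket_add_left]; abel

theorem curvEnd_smul_left (r : R) (a b : A) : D.curvEnd (r • a) b = r • D.curvEnd a b := by
  ext e
  change D.curvature _ _ _ = r • D.curvature _ _ _
  simp only [curvature, D.smul_left, D.leibniz, g.bracket_smul_left, sub_eq_add_neg, D.add_left,
    ← neg_smul, smul_add]
  simp only [smul_neg, neg_smul]
  abel

theorem curvEnd_swap (a b : A) : D.curvEnd a b = - D.curvEnd b a := by
  ext e
  change D.curvature _ _ _ = - D.curvature _ _ _
  have h : D.nabla (g.bracket a b) e = - D.nabla (g.bracket b a) e := by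
    rw [eq_neg_iff_add_eq_zero, ← D.add_left, g.bracket_skew a b, neg_add_cancel]
    simpa using D.smul_left 0 0 e
  simp only [curvature, h]
  abel

theorem curvEnd_self (a : A) : D.curvEnd a a = 0 := by
  ext e
  change D.curvature _ _ _ = 0
  have := D.smul_left 0 0 e
  simp only [zero_smul] at this
  simp [curvature, g.bracket_self, this]

/-- The curvature as a form. -/
def curvForm : Form R A (EndMod R P)
  | 2 =>
    { toFun := fun v => D.curvEnd (v 0) (v 1)
      map_update_add' := by
        intro inst v i x y
        obtain rfl : inst = instDecidableEqFin 2 := Subsingleton.elim _ _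
        fin_cases i
        · simp [curvEnd_add_left]
        -- Linearity in the second slot is transported from the first by antisymmetry.
        · simp [D.curvEnd_swap _ x, D.curvEnd_swap _ y, D.curvEnd_swap _ (x + y), curvEnd_add_left,
            add_comm]
      map_update_smul' := by
        intro inst v i r x
        obtain rfl : inst = instDecidableEqFin 2 := Subsingleton.elim _ _
        fin_cases i
        · simp [curvEnd_smul_left]
        · simp [D.curvEnd_swap _ x, D.curvEnd_swap _ (r • x), curvEnd_smul_left]
      map_eq_zero_of_eq' := by
        intro v i j hv hij
        have : v 0 = v 1 := by
          fin_cases i <;> fin_cases j <;> simp_all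
        change D.curvEnd (v 0) (v 1) = 0
        rw [this, curvEnd_self] }
  | _ => 0

theorem curvForm_two (v : Fin 2 → A) : D.curvForm 2 v = D.curvEnd (v 0) (v 1) := rfl

theorem curvForm_of_ne {k : ℕ} (hk : k ≠ 2) : D.curvForm k = 0 := by
  unfold curvForm
  split
  · exact absurd rfl hk
  · rfl

/-- A form all of whose contractions vanish is concentrated in degree zero, so the product only
applies its value there to the coefficients. -/
theorem _root_.HomotopyModules.Form.cup_of_contr_eq_zero (B : P →ₗ[R] Q →ₗ[R] S)
    (w : Form R A P) (u : Form R A Q) (hu : ∀ a, contr a u = 0) :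
    cup B w u = map (B.flip (u 0 ![])) w := by
  funext n
  induction n generalizing w with
  | zero => apply apply_zero_eq; simp [cup_zero_apply]
  | succ n ih =>
    refine apply_succ_eq fun b => ?_
    rw [contr_cup, hu, map_zero, add_zero, ih]
    rfl

/-- In degree zero this is the definition of the curvature. Contractions commute with the defect
because the brackets produced by `contr_lie` cancel by the Jacobi identity. -/
theorem lie_lie (a b : A) (u : Form R A P) :
    D.lie a (D.lie b u) - D.lie b (D.lie a u) - D.lie (g.bracket a b) u =
      map (D.curvEnd a b) u := by
  funext n
  induction n generalizing u with
  | zero =>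
    apply apply_zero_eq
    change D.lie a (D.lie b u) 0 ![] - D.lie b (D.lie a u) 0 ![] - D.lie (g.bracket a b) u 0 ![] = _
    simp only [lie_zero_apply]
    rfl
  | succ n ih =>
    refine apply_succ_eq fun c => ?_
    rw [← map_contr, ← ih]
    simp only [map_sub, contr_lie, g.jacobi a b c, Pi.sub_apply, contr_add, Pi.add_apply]
    abel

/-- The evaluation pairing `(e, f) ↦ f e`. -/
def _root_.HomotopyModules.evalPairing (R P : Type*) [CommRing R] [AddCommGroup P] [Module R P] :
    P →ₗ[R] EndMod R P →ₗ[R] P :=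
  (LinearMap.id : EndMod R P →ₗ[R] EndMod R P).flip

theorem contr_contr_curvForm (a b : A) :
    contr b (contr a D.curvForm) 0 ![] = D.curvEnd a b := rfl

theorem contr_contr_contr_curvForm (a b c : A) :
    contr c (contr b (contr a D.curvForm)) = 0 := by
  funext k
  ext1 v
  simp only [contr_apply, D.curvForm_of_ne (show k + 1 + 1 + 1 ≠ 2 by omega)]
  rfl

/-- A second contraction of the curvature form leaves only the endomorphism `curvEnd a b`, so the
inductive step is exactly `lie_lie`. -/
theorem lie_extD (a : A) (u : Form R A P) :
    D.lie a (D.extD u) - D.extD (D.lie a u) =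
      cup (evalPairing R P) (par u) (contr a D.curvForm) := by
  funext n
  induction n generalizing u with
  | zero =>
    apply apply_zero_eq
    rw [cup_zero_apply]
    change D.lie a (D.extD u) 0 ![] - 0 =
      evalPairing R P (par u 0 ![]) (D.curvForm 1 (Fin.cons a ![]))
    rw [lie_zero_apply, D.curvForm_of_ne (by omega)]
    simp [D.zero_right]
  | succ n ih =>
    refine apply_succ_eq fun b => ?_
    rw [contr_cup, contr_par, map_neg, LinearMap.neg_apply, Pi.add_apply, Pi.neg_apply, ← ih, par_par,
      cup_of_contr_eq_zero _ _ (contr b (contr a D.curvForm))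
        (fun c => D.contr_contr_contr_curvForm a b c), contr_contr_curvForm]
    change _ = _ + map (D.curvEnd a b) u n
    rw [← lie_lie]
    simp only [map_sub, contr_lie, contr_extD, Pi.sub_apply]
    abel

/-- Contracting `d²u` by Cartan's formula gives `[L_b, d]u + d²(i_b u)`; the commutator is the part
of `u·F` in which `F` is contracted. -/
theorem extD_extD (u : Form R A P) :
    D.extD (D.extD u) = cup (evalPairing R P) u D.curvForm := by
  funext n
  induction n generalizing u with
  | zero =>
    apply apply_zero_eq
    rw [cup_zero_apply, D.curvForm_of_ne (by omega)]
    rfl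
  | succ n ih =>
    refine apply_succ_eq fun b => ?_
    rw [contr_cup, Pi.add_apply, ← ih, ← lie_extD]
    simp only [map_sub, contr_extD, Pi.sub_apply]
    abel

end LieRinehart.Connection
end
end HomotopyModules

/-! ### Superconnections as right multiplications; curvature and Bianchi identity. -/

namespace HomotopyModules
open Function Bundle
open scoped TensorProduct

section
variable {R A P Q S N : Type*} [CommRing R] [Algebra ℝ R] [AddCommGroup A] [Module R A]
  [AddCommGroup P] [Module R P] [AddCommGroup Q] [Module R Q] [AddCommGroup S] [Module R S]
  [AddCommGroup N] [Module R N] {g : LieRinehart R A}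

namespace Form

/-- The components of even degree. -/
def evenPart (w : Form R A P) : Form R A P := fun k => if Even k then w k else 0

/-- The components of odd degree. -/
def oddPart (w : Form R A P) : Form R A P := fun k => if Even k then 0 else w k

theorem evenPart_add_oddPart (w : Form R A P) : evenPart w + oddPart w = w := by
  funext k
  by_cases h : Even k <;> simp [evenPart, oddPart, h]

theorem evenPart_sub_oddPart (w : Form R A P) : evenPart w - oddPart w = par w := by
  funext k
  by_cases h : Even k
  · simp [evenPart, oddPart, h, par_apply]
  · simp [evenPart, oddPart, h, par_apply, (Nat.not_even_iff_odd.1 h).neg_one_pow]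

theorem par_evenPart (w : Form R A P) : par (evenPart w) = evenPart w := by
  funext k
  by_cases h : Even k <;> simp [evenPart, h, par_apply]

theorem par_oddPart (w : Form R A P) : par (oddPart w) = - oddPart w := by
  funext k
  by_cases h : Even k
  · simp [oddPart, h, par_apply]
  · simp [oddPart, h, par_apply, (Nat.not_even_iff_odd.1 h).neg_one_pow]

end Form
open Form

/-- Composition of endomorphisms in the opposite order, `(f, g) ↦ g ∘ f`. -/
def compPairing (R N : Type*) [CommRing R] [AddCommGroup N] [Module R N] :
    EndMod R N →ₗ[R] EndMod R N →ₗ[R] EndMod R N :=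
  (LinearMap.llcomp R N N N).flip

@[simp] theorem compPairing_apply (f f' : EndMod R N) (e : N) :
    compPairing R N f f' e = f' (f e) := rfl

namespace LieRinehart.Superconnection
variable {gr : ℤ → Submodule R N} [Module ℝ N] [IsScalarTower ℝ R N]
  (D : g.Superconnection N gr)

/-- Write `q` for the form degree of `u`. For `k` even the sign rule gives `(-1)^q` and `ω^(k)`
commutes past `u`; for `k` odd the rule gives no sign but the exchange costs `(-1)^q`. Either way
the result is `(-1)^q u·ω`, with the coefficients acting from the right, and no case distinction
remains. -/
theorem op_eq (u : Form R A N) :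
    D.op u = D.extD u + cup (evalPairing R N) (par u) D.form := by
  have h1 : cup (evalPairing R N) (par u) D.form =
      cup (LinearMap.id : EndMod R N →ₗ[R] EndMod R N) (evenPart D.form) (par u) +
      cup (LinearMap.id : EndMod R N →ₗ[R] EndMod R N) (oddPart D.form) u := by
    rw [even_cup _ (par_evenPart _), odd_cup _ (par_oddPart _), ← map_add, evenPart_add_oddPart]
    rfl
  rw [h1]
  change D.extDerivTotal u + _ = _
  rw [Connection.extDerivTotal_eq_extD]
  congr 1
  funext n
  rw [Pi.add_apply, cup_apply, cup_apply, ← Finset.sum_add_distrib, Finset.sum_range]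
  change (∑ k : Fin (n + 1), ((1 - (k : ℤ)) * ((n : ℤ) - k)).negOnePow •
    LieRinehart.wedge (show (k : ℕ) + (n - k) = n by omega) (D.form k) (u (n - k))) = _
  refine Finset.sum_congr rfl fun k _ => ?_
  have h : (k : ℕ) + (n - k) = n := by omega
  rw [cupTerm_eq _ _ _ h, cupTerm_eq _ _ _ h, wedge_eq_pairWedge]
  by_cases hk : Even (k : ℕ)
  · have e1 : evenPart D.form k = D.form k := if_pos hk
    have e2 : oddPart D.form k = 0 := if_pos hk
    have e3 : pairWedge (LinearMap.id : EndMod R N →ₗ[R] EndMod R N) h (0 : A [⋀^Fin k]→ₗ[R] EndMod R N) (u (n - k)) = 0 := by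
      have := pairWedge_smul_left (R := R) (LinearMap.id : EndMod R N →ₗ[R] EndMod R N) h (0 : A [⋀^Fin k]→ₗ[R] EndMod R N) 0
        (u (n - k))
      rwa [zero_smul, zero_smul] at this
    rw [e1, e2, e3, add_zero, par_apply, ← Int.cast_smul_eq_zsmul R _ (u (n - k)),
      pairWedge_smul_right, Int.cast_smul_eq_zsmul, Units.smul_def]
    congr 1
    have h2 : Odd (1 - (k : ℤ)) := by
      obtain ⟨m, hm⟩ := hk
      exact ⟨-m, by omega⟩
    rcases Nat.even_or_odd (n - k) with hn | hn
    · rw [hn.neg_one_pow, Int.negOnePow_even]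
      · rfl
      · refine Even.mul_left ?_ _
        obtain ⟨m, hm⟩ := hn
        exact ⟨m, by omega⟩
    · rw [hn.neg_one_pow, Int.negOnePow_odd]
      · rfl
      · refine h2.mul ?_
        obtain ⟨m, hm⟩ := hn
        exact ⟨m, by omega⟩
  · have e1 : evenPart D.form k = 0 := if_neg hk
    have e2 : oddPart D.form k = D.form k := if_neg hk
    have e3 : pairWedge (LinearMap.id : EndMod R N →ₗ[R] EndMod R N) h (0 : A [⋀^Fin k]→ₗ[R] EndMod R N) (par u (n - k)) = 0 := by
      have := pairWedge_smul_left (R := R) (LinearMap.id : EndMod R N →ₗ[R] EndMod R N) h (0 : A [⋀^Fin k]→ₗ[R] EndMod R N) 0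
        (par u (n - k))
      rwa [zero_smul, zero_smul] at this
    rw [e1, e2, e3, zero_add, Int.negOnePow_even, one_smul]
    refine Even.mul_right ?_ _
    obtain ⟨m, hm⟩ := Nat.not_even_iff_odd.1 hk
    exact ⟨-m, by omega⟩

/-- The curvature of a superconnection, as a form with values in endomorphisms. -/
noncomputable def curvature : Form R A (EndMod R N) :=
  D.curvForm + D.onEnd.extD D.form + cup (compPairing R N) (par D.form) D.form

/-- The two terms containing both `du` and `ω` cancel, since `d` anticommutes with `par`;
associativity collects the others into one factor on the right of `u`. -/
theorem op_op (u : Form R A N) : D.op (D.op u) = cup (evalPairing R N) u D.curvature := by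
  have hB : ∀ a p q, D.nabla a (evalPairing R N p q) =
      evalPairing R N (D.nabla a p) q + evalPairing R N p (D.onEnd.nabla a q) := by
    intro a p q
    change D.nabla a (q p) = q (D.nabla a p) + (D.nabla a (q p) - q (D.nabla a p))
    abel
  have hA := fun x y z => cup_assoc (A := A) (evalPairing R N) (evalPairing R N) (compPairing R N)
    (evalPairing R N) (fun x y z => rfl) x y z
  simp only [op_eq, map_add, curvature, par_cup, par_par, D.extD_extD,
    D.extD_cup D.onEnd D.toConnection _ hB, hA, D.par_extD, map_neg, LinearMap.neg_apply]
  abel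

theorem cup_constForm {B : P →ₗ[R] Q →ₗ[R] S} (e : P) (w : Form R A Q) :
    cup B (constForm e) w = map (B e) w := by
  funext n
  induction n generalizing w with
  | zero =>
    apply apply_zero_eq
    rw [cup_zero_apply]; rfl
  | succ n ih =>
    refine apply_succ_eq fun a => ?_
    have h0 : contr a (constForm e : Form R A P) = 0 := by funext k; ext v; rfl
    have h1 : par (constForm e : Form R A P) = constForm e := by
      funext k
      cases k with
      | zero => simp [par_apply]
      | succ k => simp [par_apply, constForm]
    rw [contr_cup, h0, h1, map_zero, LinearMap.zero_apply, zero_add, ih, map_contr]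

/-- The square of the operator on constant sections recovers the whole curvature form, so flatness
becomes an identity of forms with values in endomorphisms. -/
theorem op_op_constForm (e : N) (k : ℕ) (v : Fin k → A) :
    D.op (D.op (constForm e)) k v = D.curvature k v e := by
  rw [op_op, cup_constForm]; rfl

theorem IsFlat.curvature_eq_zero {D : g.Superconnection N gr} (hD : D.IsFlat) :
    D.curvature = 0 := by
  funext k
  ext v e
  rw [← op_op_constForm, hD]; rfl

/-- The Bianchi identity. -/
theorem bianchi : D.onEnd.extD D.curvature + cup (compPairing R N) (par D.curvature) D.form -
    cup (compPairing R N) D.form D.curvature = 0 := by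
  have hB : ∀ a p q, D.nabla a (evalPairing R N p q) =
      evalPairing R N (D.nabla a p) q + evalPairing R N p (D.onEnd.nabla a q) := by
    intro a p q
    change D.nabla a (q p) = q (D.nabla a p) + (D.nabla a (q p) - q (D.nabla a p))
    abel
  have hA := fun x y z => cup_assoc (A := A) (evalPairing R N) (evalPairing R N) (compPairing R N)
    (evalPairing R N) (fun x y z => rfl) x y z
  have key : ∀ u : Form R A N, cup (evalPairing R N) (par u) (D.onEnd.extD D.curvature +
      cup (compPairing R N) (par D.curvature) D.form -
    cup (compPairing R N) D.form D.curvature) = 0 := by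
    intro u
    -- The triple application is read once as `D²` of `D u` and once as `D` of `D² u`; comparing the
    -- two expansions is the Bianchi identity multiplied by `par u`.
    have h1 : D.op (D.op (D.op u)) = D.op (D.op (D.op u)) := rfl
    conv at h1 => lhs; rw [op_op]
    conv at h1 => rhs; rw [op_op D u]
    simp only [op_eq, map_add, LinearMap.add_apply, par_cup,
      D.extD_cup D.onEnd D.toConnection _ hB, hA] at h1
    simp only [map_add, map_sub]
    rw [sub_eq_zero]
    rw [add_assoc] at h1
    exact (add_left_cancel h1).symm
  funext k
  ext v e
  have h := congrArg (fun w => w k v) (key (par (constForm e)))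
  rw [par_par] at h
  simp only [cup_constForm] at h
  exact h

theorem op_mem (p : ℤ) (u : Form R A N) (hu : u ∈ totalDegree A gr p) :
    D.op u ∈ totalDegree A gr (p + 1) := by
  intro k v
  rw [op_eq]
  refine add_mem ?_ ?_
  · cases k with
    | zero => exact zero_mem _
    | succ k =>
      have he : p + 1 - ((k + 1 : ℕ) : ℤ) = p - k := by push_cast; ring
      rw [he]
      change (∑ i : Fin (k + 1), (-1 : ℤ) ^ (i : ℕ) • D.nabla (v i) (u k (i.removeNth v))) +
        (∑ j : Fin (k + 1), ∑ i : Fin k, if i.castSucc < j then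
        (-1 : ℤ) ^ (j : ℕ) • u k (update (j.removeNth v) i (g.bracket (v i.castSucc) (v j)))
          else 0) ∈ _
      refine add_mem (sum_mem fun i _ => zsmul_mem (D.nabla_mem _ _ _ (hu _ _)) _)
        (sum_mem fun j _ => sum_mem fun i _ => ?_)
      split_ifs
      · exact zsmul_mem (hu _ _) _
      · exact zero_mem _
  · refine cup_mem _ (gr (p + 1 - k)).toAddSubgroup _ _ k (fun i j hij x y => ?_) v
    have := D.form_mem j _ y _ (hu i x)
    have he : p - i + (1 - j) = p + 1 - k := by subst hij; push_cast; ring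
    rw [he] at this
    rw [par_apply, AlternatingMap.smul_apply, map_zsmul]
    exact zsmul_mem this _

end LieRinehart.Superconnection
end
end HomotopyModules

/-! ### Parity operators, and the two actions of `End` on `A° ⊗ End`. -/

namespace HomotopyModules
open Function Bundle
open scoped TensorProduct
open Form

section
variable {R A L : Type*} [CommRing R] [Algebra ℝ R] [AddCommGroup A] [Module R A]
  [AddCommGroup L] [Module R L]
  {N : Type*} [AddCommGroup N] [Module R N]
  {X : ℤ → Type*} [∀ i, AddCommGroup (X i)] [∀ i, Module R (X i)]
  {gA : LieRinehart R A} {gL : LieRinehart R L}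

/-- The graded module is concentrated in the degrees `-n, …, 0`. -/
def Bounded (X : ℤ → Type*) (n : ℕ) : Prop :=
  ∀ i : ℤ, i < -(n : ℤ) ∨ 0 < i → Subsingleton (X i)

theorem Bounded.sum_single {n : ℕ} (hX : Bounded X n) (e : ∀ i, X i) :
    ∑ i ∈ Finset.Icc (-(n : ℤ)) 0, (Pi.single i (e i) : ∀ i, X i) = e := by
  funext j
  rw [Finset.sum_apply]
  by_cases hj : j ∈ Finset.Icc (-(n : ℤ)) 0
  · rw [Finset.sum_eq_single j]
    · simp
    · intro i _ hij
      rw [Pi.single_eq_of_ne hij.symm]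
    · exact fun h => absurd hj h
  · have := hX j (by rw [Finset.mem_Icc] at hj; omega)
    exact Subsingleton.elim _ _

theorem single_mem_homogeneous (i : ℤ) (x : X i) : Pi.single i x ∈ homogeneous R X i :=
  fun j hj => by simp [hj]

/-- Only additivity is required, so that the criterion also applies to the operators `∇_a`, which
are not `R`-linear. -/
theorem Bounded.ext_homogeneous {n : ℕ} (hX : Bounded X n) {P : Type*} [AddCommGroup P]
    (f f' : (∀ i, X i) → P) (hf : ∀ e e', f (e + e') = f e + f e')
    (hf' : ∀ e e', f' (e + e') = f' e + f' e')
    (h : ∀ i, ∀ e ∈ homogeneous R X i, f e = f' e) (e : ∀ i, X i) : f e = f' e := by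
  rw [← hX.sum_single e]
  have h1 := map_sum (AddMonoidHom.mk' f hf) (fun i => (Pi.single i (e i) : ∀ i, X i))
    (Finset.Icc (-(n : ℤ)) 0)
  have h2 := map_sum (AddMonoidHom.mk' f' hf') (fun i => (Pi.single i (e i) : ∀ i, X i))
    (Finset.Icc (-(n : ℤ)) 0)
  simp only [AddMonoidHom.mk'_apply] at h1 h2
  rw [h1, h2]
  exact Finset.sum_congr rfl fun i _ => h i _ (single_mem_homogeneous i (e i))

theorem koszul_apply (d : ℤ) (e : ∀ i, X i) (i : ℤ) :
    koszul R X d e i = (d * i).negOnePow • e i := rfl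

theorem koszul_of_mem (d i : ℤ) (e : ∀ i, X i) (he : e ∈ homogeneous R X i) :
    koszul R X d e = (d * i).negOnePow • e := by
  funext j
  by_cases hj : j = i
  · subst hj; rfl
  · rw [koszul_apply, Pi.smul_apply, he j hj, smul_zero, smul_zero]

theorem koszul_even {d : ℤ} (hd : Even d) : koszul R X d = LinearMap.id := by
  ext1 e; funext i
  rw [koszul_apply, Int.negOnePow_even _ (hd.mul_right i), one_smul]
  rfl

theorem koszul_odd {d : ℤ} (hd : Odd d) : koszul R X d = koszul R X 1 := by
  ext1 e; funext i
  rw [koszul_apply, koszul_apply, (Int.negOnePow_eq_iff _ _).2]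
  rw [← sub_mul]
  exact (hd.sub_odd odd_one).mul_right i

theorem koszul_koszul (e : ∀ i, X i) : koszul R X 1 (koszul R X 1 e) = e := by
  funext i
  rw [koszul_apply, koszul_apply, smul_smul, ← Int.negOnePow_add, Int.negOnePow_even _ ⟨_, rfl⟩,
    one_smul]

/-- Conjugation with the parity operator `e ↦ (-1)^i e`. -/
def conjKoszul (R : Type*) [CommRing R] (X : ℤ → Type*) [∀ i, AddCommGroup (X i)]
    [∀ i, Module R (X i)] : EndMod R (∀ i, X i) →ₗ[R] EndMod R (∀ i, X i) where
  toFun f := koszul R X 1 ∘ₗ f ∘ₗ koszul R X 1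
  map_add' f f' := by ext1 e; simp
  map_smul' r f := by ext1 e; simp

theorem conjKoszul_apply (f : EndMod R (∀ i, X i)) (e : ∀ i, X i) :
    conjKoszul R X f e = koszul R X 1 (f (koszul R X 1 e)) := rfl

theorem conjKoszul_conjKoszul (f : EndMod R (∀ i, X i)) :
    conjKoszul R X (conjKoszul R X f) = f := by
  ext1 e
  simp only [conjKoszul_apply, koszul_koszul]

theorem Bounded.conjKoszul_of_mem {n : ℕ} (hX : Bounded X n) {j : ℤ} {f : EndMod R (∀ i, X i)}
    (hf : f ∈ endDegree R X j) : conjKoszul R X f = j.negOnePow • f := by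
  ext1 e
  refine hX.ext_homogeneous (R := R) _ _ (map_add _) (map_add _) (fun i e he => ?_) e
  rw [conjKoszul_apply, koszul_of_mem 1 i e he, Units.smul_def, map_zsmul, map_zsmul,
    koszul_of_mem 1 (i + j) _ (hf i e he), LinearMap.smul_apply, ← Units.smul_def, smul_smul,
    ← Int.negOnePow_add]
  congr 1
  rw [Int.negOnePow_eq_iff]
  exact ⟨i, by ring⟩

namespace LieRinehart

section pairings
variable (ι : Hom gA gL) (N)

/-- `(φ, x) ↦ (l ↦ x ∘ φ(l))`. -/
def Hom.annPost : ι.AnnEnd N →ₗ[R] EndMod R N →ₗ[R] ι.AnnEnd N :=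
  LinearMap.mk₂ R (fun φ x => .mk (LinearMap.llcomp R N N N x ∘ₗ φ.toHom) fun a => by
      simp [φ.toHom_incl a])
    (by intros; ext1; simp) (by intros; ext1; simp) (by intros; ext1; simp)
    (by intros; ext1; simp)

/-- `(x, φ) ↦ (l ↦ φ(l) ∘ x)`. -/
def Hom.annPre : EndMod R N →ₗ[R] ι.AnnEnd N →ₗ[R] ι.AnnEnd N :=
  LinearMap.mk₂ R (fun x φ => .mk ((LinearMap.llcomp R N N N).flip x ∘ₗ φ.toHom) fun a => by
      simp [φ.toHom_incl a])
    (by intros; ext1; simp) (by intros; ext1; simp) (by intros; ext1; simp)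
    (by intros; ext1; simp)

variable {ι N}

@[simp] theorem Hom.annPost_apply (φ : ι.AnnEnd N) (x : EndMod R N) (l : L) :
    (ι.annPost N φ x).toHom l = x ∘ₗ φ.toHom l := rfl

@[simp] theorem Hom.annPre_apply (φ : ι.AnnEnd N) (x : EndMod R N) (l : L) :
    (ι.annPre N x φ).toHom l = φ.toHom l ∘ₗ x := rfl

/-- Conjugation with the parity operator on `A° ⊗ End(X)`. -/
def Hom.annConj (ι : Hom gA gL) (X : ℤ → Type*) [∀ i, AddCommGroup (X i)]
    [∀ i, Module R (X i)] : ι.AnnEnd (∀ i, X i) →ₗ[R] ι.AnnEnd (∀ i, X i) where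
  toFun φ := .mk (conjKoszul R X ∘ₗ φ.toHom) fun a => by simp [φ.toHom_incl a]
  map_add' φ φ' := by ext1; simp
  map_smul' r φ := by ext1; simp

@[simp] theorem Hom.annConj_apply (φ : ι.AnnEnd (∀ i, X i)) (l : L) :
    (ι.annConj X φ).toHom l = conjKoszul R X (φ.toHom l) := rfl

theorem Hom.annConj_annConj (φ : ι.AnnEnd (∀ i, X i)) : ι.annConj X (ι.annConj X φ) = φ := by
  ext1 l; simp [conjKoszul_conjKoszul]

/-- Only the parity of `d` matters. For odd `d` the factor `(-1)^d` exchanges the two terms of the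
commutator, and the Koszul signs become conjugation by the parity operator. -/
theorem Hom.annAd_apply (d : ℤ) (x : EndMod R (∀ i, X i)) (φ : ι.AnnEnd (∀ i, X i)) :
    ι.annAd X d x φ = if Even d then ι.annPost _ φ x - ι.annPre _ x φ else
      ι.annPre _ x (ι.annConj X φ) - ι.annPost _ φ x := by
  ext1 l
  change d.negOnePow • (x ∘ₗ φ.toHom l - koszul R X d ∘ₗ φ.toHom l ∘ₗ koszul R X d ∘ₗ x) = _
  split_ifs with hd
  · rw [Int.negOnePow_even _ hd, one_smul, koszul_even hd]
    rfl
  · have hd := Int.not_even_iff_odd.1 hd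
    rw [Int.negOnePow_odd _ hd, koszul_odd hd, Units.neg_smul, one_smul, neg_sub]
    rfl

end pairings

theorem Connection.onAnnEnd_apply (D : gA.Connection N) (ι : Hom gA gL) (a : A) (φ : ι.AnnEnd N)
    (l : L) : ((D.onAnnEnd ι).nabla a φ).toHom l =
      D.onEnd.nabla a (φ.toHom l) - φ.toHom (gL.bracket (ι.toLinearMap a) l) := rfl

theorem Connection.onEnd_apply (D : gA.Connection N) (a : A) (f : EndMod R N) (e : N) :
    D.onEnd.nabla a f e = D.nabla a (f e) - f (D.nabla a e) := rfl

theorem Connection.onEnd_comp (D : gA.Connection N) (a : A) (f f' : EndMod R N) :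
    D.onEnd.nabla a (f ∘ₗ f') = D.onEnd.nabla a f ∘ₗ f' + f ∘ₗ D.onEnd.nabla a f' := by
  ext1 e
  simp [onEnd_apply]

/-- Composition is parallel: the Bott term only changes the argument `l` of `φ`. Together with
`onAnnEnd_annPre` this supplies the hypothesis of `extD_cup`. -/
theorem Connection.onAnnEnd_annPost (D : gA.Connection N) (ι : Hom gA gL) (a : A) (φ : ι.AnnEnd N)
    (x : EndMod R N) : (D.onAnnEnd ι).nabla a (ι.annPost N φ x) =
      ι.annPost N ((D.onAnnEnd ι).nabla a φ) x + ι.annPost N φ (D.onEnd.nabla a x) := by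
  ext1 l
  simp only [onAnnEnd_apply, map_add, LinearMap.add_apply, Hom.annPost_apply, D.onEnd_comp,
    LinearMap.comp_sub]
  abel

theorem Connection.onAnnEnd_annPre (D : gA.Connection N) (ι : Hom gA gL) (a : A)
    (x : EndMod R N) (φ : ι.AnnEnd N) : (D.onAnnEnd ι).nabla a (ι.annPre N x φ) =
      ι.annPre N (D.onEnd.nabla a x) φ + ι.annPre N x ((D.onAnnEnd ι).nabla a φ) := by
  ext1 l
  simp only [onAnnEnd_apply, map_add, LinearMap.add_apply, Hom.annPre_apply, D.onEnd_comp,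
    LinearMap.sub_comp]
  abel

/-- The Bott part is flat by the Jacobi identity in `L`, so only the commutator with the curvature
of `∇` remains. -/
theorem Connection.onAnnEnd_curvEnd (D : gA.Connection N) (ι : Hom gA gL) (a b : A)
    (φ : ι.AnnEnd N) : (D.onAnnEnd ι).curvEnd a b φ =
      ι.annPost N φ (D.curvEnd a b) - ι.annPre N (D.curvEnd a b) φ := by
  ext1 l
  ext1 e
  change ((D.onAnnEnd ι).curvature a b φ).toHom l e =
    D.curvature a b (φ.toHom l e) - φ.toHom l (D.curvature a b e)
  simp only [curvature, map_sub, LinearMap.sub_apply, onAnnEnd_apply, onEnd_apply, ι.bracket_map,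
    gL.jacobi (ι.toLinearMap a) (ι.toLinearMap b) l, map_add, LinearMap.add_apply]
  have hs : ∀ a x y, D.nabla a (x - y) = D.nabla a x - D.nabla a y := by
    intro a x y
    rw [sub_eq_add_neg, D.add_right, D.neg_right, ← sub_eq_add_neg]
  simp only [hs]
  abel

theorem Connection.onAnnEnd_curvForm (D : gA.Connection N) (ι : Hom gA gL) :
    (D.onAnnEnd ι).curvForm = map ((ι.annPost N).flip - ι.annPre N) D.curvForm := by
  funext k
  by_cases hk : k = 2
  · subst hk
    ext1 v
    refine LinearMap.ext fun φ => ?_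
    exact D.onAnnEnd_curvEnd ι _ _ φ
  · rw [curvForm_of_ne _ hk]
    ext1 v
    rw [map_apply, D.curvForm_of_ne hk]
    simp

end LieRinehart

end
end HomotopyModules

/-! ### The operator `s` in terms of products, and `s² = 0`. -/

namespace HomotopyModules
open Function Bundle
open scoped TensorProduct
open Form

section
variable {R A P Q S : Type*} [CommRing R] [Algebra ℝ R] [AddCommGroup A] [Module R A]
  [AddCommGroup P] [Module R P] [AddCommGroup Q] [Module R Q] [AddCommGroup S] [Module R S]

theorem Form.cup_sub_pairing (B B' : P →ₗ[R] Q →ₗ[R] S) (x : Form R A P) (y : Form R A Q) :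
    cup (B - B') x y = cup B x y - cup B' x y := by
  funext k
  induction k generalizing x y with
  | zero =>
    apply apply_zero_eq
    change _ = cup B x y 0 ![] - cup B' x y 0 ![]
    simp [cup_zero_apply]
  | succ k ih =>
    refine apply_succ_eq fun a => ?_
    simp only [contr_cup, map_sub, Pi.add_apply, Pi.sub_apply, ih]
    abel

end

section
variable {R A L : Type*} [CommRing R] [Algebra ℝ R] [AddCommGroup A] [Module R A]
  [AddCommGroup L] [Module R L]
  {X : ℤ → Type*} [∀ i, AddCommGroup (X i)] [∀ i, Module R (X i)]
  {gA : LieRinehart R A} {gL : LieRinehart R L}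
  [∀ i, Module ℝ (X i)] [∀ i, IsScalarTower ℝ R (X i)]

namespace LieRinehart

variable (D : gA.Superconnection (∀ i, X i) (homogeneous R X)) (ι : Hom gA gL)

/-- The parity operator for the total degree on `Ω(A, A° ⊗ End(X))`. -/
def Hom.annStar (ι : Hom gA gL) (X : ℤ → Type*) [∀ i, AddCommGroup (X i)]
    [∀ i, Module R (X i)] :
    Form R A (ι.AnnEnd (∀ i, X i)) →ₗ[R] Form R A (ι.AnnEnd (∀ i, X i)) :=
  map (ι.annConj X) ∘ₗ par

theorem Hom.annStar_apply (ϖ : Form R A (ι.AnnEnd (∀ i, X i))) :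
    ι.annStar X ϖ = map (ι.annConj X) (par ϖ) := rfl

theorem Hom.annStar_annStar (ϖ : Form R A (ι.AnnEnd (∀ i, X i))) :
    ι.annStar X (ι.annStar X ϖ) = ϖ := by
  rw [annStar_apply, annStar_apply, ← map_par, par_par]
  funext k; ext1 v
  exact ι.annConj_annConj _

/-- Even arity means odd endomorphism degree and conversely. This splits composition on the right of
`φ` into two kinds of signs, while composition on the left carries a uniform one. -/
theorem Superconnection.onAnnEnd_form : (D.onAnnEnd ι).form =
    - map (ι.annPost _).flip (par D.form)
      + map ((ι.annPre _).compl₂ (ι.annConj X)) (evenPart D.form)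
      - map (ι.annPre _) (oddPart D.form) := by
  funext k; ext1 v
  refine LinearMap.ext fun φ => ?_
  change ι.annAd X (1 - k) (D.form k v) φ = -(ι.annPost _ φ (par D.form k v)) +
    ι.annPre _ (evenPart D.form k v) (ι.annConj X φ) - ι.annPre _ (oddPart D.form k v) φ
  rw [Hom.annAd_apply]
  by_cases hk : Even k
  · have h1 : ¬ Even (1 - (k : ℤ)) := by
      rw [Int.not_even_iff_odd]
      exact odd_one.sub_even ((Int.even_coe_nat k).2 hk)
    simp [h1, evenPart, oddPart, hk, par_apply, hk.neg_one_pow]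
    abel
  · have h1 : Even (1 - (k : ℤ)) :=
      odd_one.sub_odd ((Int.odd_coe_nat k).2 (Nat.not_even_iff_odd.1 hk))
    simp [h1, evenPart, oddPart, hk, par_apply, (Nat.not_even_iff_odd.1 hk).neg_one_pow]

theorem Superconnection.onAnnEnd_op (ϖ : Form R A (ι.AnnEnd (∀ i, X i))) :
    (D.onAnnEnd ι).op ϖ = (D.onAnnEnd ι).extD ϖ - cup (ι.annPost _) (par ϖ) (par D.form)
      + cup (ι.annPre _) (evenPart D.form) (ι.annStar X ϖ)
      - cup (ι.annPre _) (oddPart D.form) ϖ := by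
  rw [Superconnection.op_eq, D.onAnnEnd_form, map_sub, map_add, map_neg, cup_map_right,
    cup_map_right, cup_map_right, even_cup _ (par_evenPart _), odd_cup _ (par_oddPart _),
    Hom.annStar_apply, cup_map_left]
  change _ + (- cup (ι.annPost _) _ _ + cup ((ι.annPre _).flip ∘ₗ ι.annConj X) _ _ -
    cup (ι.annPre _).flip _ _) = _
  abel

/-- On the eigenspaces of the total parity the even and the odd components of `ω` recombine, and `s`
becomes a graded commutator with the whole form. -/
theorem Superconnection.onAnnEnd_op_even {ϖ : Form R A (ι.AnnEnd (∀ i, X i))}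
    (h : ι.annStar X ϖ = ϖ) :
    (D.onAnnEnd ι).op ϖ = (D.onAnnEnd ι).extD ϖ - cup (ι.annPost _) (par ϖ) (par D.form)
      + cup (ι.annPre _) (par D.form) ϖ := by
  rw [D.onAnnEnd_op, h, add_sub_assoc, ← LinearMap.sub_apply, ← map_sub, evenPart_sub_oddPart]

theorem Superconnection.onAnnEnd_op_odd {ϖ : Form R A (ι.AnnEnd (∀ i, X i))}
    (h : ι.annStar X ϖ = -ϖ) :
    (D.onAnnEnd ι).op ϖ = (D.onAnnEnd ι).extD ϖ - cup (ι.annPost _) (par ϖ) (par D.form)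
      - cup (ι.annPre _) D.form ϖ := by
  have hf : cup (ι.annPre _) D.form ϖ =
      cup (ι.annPre _) (evenPart D.form) ϖ + cup (ι.annPre _) (oddPart D.form) ϖ := by
    rw [← LinearMap.add_apply, ← map_add, evenPart_add_oddPart]
  rw [D.onAnnEnd_op, h, hf, map_neg]
  abel

section
variable {n : ℕ} (hX : Bounded X n)
include hX

theorem Superconnection.nabla_koszul (a : A) (e : ∀ i, X i) :
    D.nabla a (koszul R X 1 e) = koszul R X 1 (D.nabla a e) := by
  refine hX.ext_homogeneous (R := R) (fun e => D.nabla a (koszul R X 1 e))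
    (fun e => koszul R X 1 (D.nabla a e)) (fun e e' => ?_) (fun e e' => ?_) (fun i e he => ?_) e
  · simp only [map_add, D.add_right]
  · simp only [map_add, D.add_right]
  · simp only [koszul_of_mem 1 i e he, koszul_of_mem 1 i _ (D.nabla_mem i a e he), Units.smul_def]
    exact map_zsmul (AddMonoidHom.mk' (D.nabla a) (D.add_right a)) _ e

/-- The component `ω^(k)` has endomorphism degree `1 - k`, so its total parity is odd for every `k`.
-/
theorem Superconnection.conj_form : map (conjKoszul R X) D.form = - par D.form := by
  funext k; ext1 v
  have h := hX.conjKoszul_of_mem (R := R) (j := 1 - k) (f := D.form k v)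
    (fun i e he => D.form_mem k i v e he)
  rw [map_apply, h, Units.smul_def]
  change _ = -((-1 : ℤ) ^ k • D.form k v)
  rw [Int.negOnePow_sub, Int.negOnePow_one, Units.val_mul, Int.coe_negOnePow_natCast,
    Units.val_neg, Units.val_one, neg_one_mul, neg_smul]

/-- The operator `s` is odd for the total parity, hence exchanges the two eigenspaces. This permits
the formula for one eigenspace to be followed by the formula for the other. -/
theorem Superconnection.annStar_op (ϖ : Form R A (ι.AnnEnd (∀ i, X i))) :
    ι.annStar X ((D.onAnnEnd ι).op ϖ) = - (D.onAnnEnd ι).op (ι.annStar X ϖ) := by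
  have hpost : ∀ (φ : Form R A (ι.AnnEnd (∀ i, X i))) w,
      map (ι.annConj X) (cup (ι.annPost _) φ w) =
        cup (ι.annPost _) (map (ι.annConj X) φ) (map (conjKoszul R X) w) := by
    intro φ w
    rw [map_cup, cup_map_left, cup_map_right]
    congr 3
    refine LinearMap.ext₂ fun φ x => ?_
    ext1 l
    ext1 e
    change koszul R X 1 (x (φ.toHom l (koszul R X 1 e))) =
      koszul R X 1 (x (koszul R X 1 (koszul R X 1 (φ.toHom l (koszul R X 1 e)))))
    rw [koszul_koszul]
  have hpre : ∀ w (φ : Form R A (ι.AnnEnd (∀ i, X i))),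
      map (ι.annConj X) (cup (ι.annPre _) w φ) =
        cup (ι.annPre _) (map (conjKoszul R X) w) (map (ι.annConj X) φ) := by
    intro w φ
    rw [map_cup, cup_map_left, cup_map_right]
    congr 3
    refine LinearMap.ext₂ fun x φ => ?_
    ext1 l
    ext1 e
    change koszul R X 1 (φ.toHom l (x (koszul R X 1 e))) =
      koszul R X 1 (φ.toHom l (koszul R X 1 (koszul R X 1 (x (koszul R X 1 e)))))
    rw [koszul_koszul]
  have hd : ∀ ϖ, map (ι.annConj X) ((D.onAnnEnd ι).extD ϖ) =
      (D.onAnnEnd ι).extD (map (ι.annConj X) ϖ) := by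
    intro ϖ
    refine Connection.map_extD _ _ _ (fun a φ => ?_) _
    ext1 l
    ext1 e
    change koszul R X 1 (D.nabla a (φ.toHom l (koszul R X 1 e)) -
      φ.toHom l (D.nabla a (koszul R X 1 e)) - _) = D.nabla a (koszul R X 1 _) -
        koszul R X 1 (φ.toHom l (koszul R X 1 (D.nabla a e))) - _
    rw [map_sub, map_sub, D.nabla_koszul hX, D.nabla_koszul hX]
    rfl
  have he : map (conjKoszul R X) (evenPart D.form) = - evenPart D.form := by
    funext k; ext1 v
    by_cases hk : Even k
    · have := congrArg (fun w => w k v) (D.conj_form hX)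
      simpa [evenPart, hk, par_apply, hk.neg_one_pow] using this
    · simp [evenPart, hk]
  have ho : map (conjKoszul R X) (oddPart D.form) = oddPart D.form := by
    funext k; ext1 v
    by_cases hk : Even k
    · simp [oddPart, hk]
    · have := congrArg (fun w => w k v) (D.conj_form hX)
      simpa [oddPart, hk, par_apply, (Nat.not_even_iff_odd.1 hk).neg_one_pow] using this
  have hcc : map (ι.annConj X) (map (ι.annConj X) ϖ) = ϖ := by
    funext k; ext1 v
    exact ι.annConj_annConj _
  rw [D.onAnnEnd_op, D.onAnnEnd_op, Hom.annStar_annStar]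
  simp only [Hom.annStar_apply, map_add, map_sub, par_cup, par_evenPart, par_oddPart, hpre, hpost,
    he, ho, Connection.par_extD, par_par, map_neg, LinearMap.neg_apply, map_par, hd, hcc, D.conj_form hX]
  abel
end

theorem Connection.onAnnEnd_extD_extD {N : Type*} [AddCommGroup N] [Module R N]
    (D : gA.Connection N) (ϖ : Form R A (ι.AnnEnd N)) :
    (D.onAnnEnd ι).extD ((D.onAnnEnd ι).extD ϖ) = cup (ι.annPost N) ϖ D.curvForm -
      cup (ι.annPre N) D.curvForm ϖ := by
  have hR : par D.curvForm = D.curvForm := by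
    funext k
    by_cases hk : k = 2
    · subst hk; simp [par_apply]
    · simp [par_apply, D.curvForm_of_ne hk]
  rw [Connection.extD_extD, D.onAnnEnd_curvForm, cup_map_right]
  refine (cup_sub_pairing (ι.annPost N) (ι.annPre N).flip _ _).trans ?_
  rw [even_cup _ hR]

/-- Flatness expresses the curvature of `∇` as `-dω - (par ω)·ω`. After substitution in the square
of the covariant derivative, the left and right actions cancel separately and the mixed terms cancel
by associativity. -/
theorem Superconnection.IsFlat.onAnnEnd_op_op (hD : D.IsFlat) {n : ℕ} (hX : Bounded X n)
    {ϖ : Form R A (ι.AnnEnd (∀ i, X i))} (h : ι.annStar X ϖ = ϖ ∨ ι.annStar X ϖ = -ϖ) :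
    (D.onAnnEnd ι).op ((D.onAnnEnd ι).op ϖ) = 0 := by
  have hs := D.annStar_op ι hX ϖ
  have a1 := fun φ x y => cup_assoc (A := A) (ι.annPost (∀ i, X i)) (ι.annPost (∀ i, X i))
    (compPairing R _) (ι.annPost (∀ i, X i)) (fun x y z => rfl) φ x y
  have a2 := fun x y φ => cup_assoc (A := A) (compPairing R _) (ι.annPre (∀ i, X i))
    (ι.annPre (∀ i, X i)) (ι.annPre (∀ i, X i)) (fun x y z => rfl) x y φ
  have a3 := fun x φ y => cup_assoc (A := A) (ι.annPre (∀ i, X i)) (ι.annPost (∀ i, X i))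
    (ι.annPost (∀ i, X i)) (ι.annPre (∀ i, X i)) (fun x y z => rfl) x φ y
  have d1 := Connection.extD_cup (D.onAnnEnd ι).toConnection D.onEnd (D.onAnnEnd ι).toConnection
    (ι.annPost _) (D.onAnnEnd_annPost ι)
  have d2 := Connection.extD_cup D.onEnd (D.onAnnEnd ι).toConnection (D.onAnnEnd ι).toConnection
    (ι.annPre _) (D.onAnnEnd_annPre ι)
  have hF : D.curvForm = - D.onEnd.extD D.form - cup (compPairing R _) (par D.form) D.form := by
    have := hD.curvature_eq_zero
    rw [curvature, add_assoc] at this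
    rw [eq_neg_of_add_eq_zero_left this]
    abel
  -- The curvature of `∇` sits in form degree two, so `par` fixes it. Each occurrence needs the
  -- expression whose signs match the products it has to cancel.
  have hF' : D.curvForm = par (- D.onEnd.extD D.form - cup (compPairing R _) (par D.form) D.form) := by
    rw [← hF]
    funext k
    by_cases hk : k = 2
    · subst hk; simp [par_apply]
    · simp [par_apply, D.curvForm_of_ne hk]
  have hdd := D.toConnection.onAnnEnd_extD_extD ι ϖ
  change (D.onAnnEnd ι).extD ((D.onAnnEnd ι).extD ϖ) = _ at hdd
  conv at hdd => rhs; arg 1; rw [hF']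
  rcases h with h | h
  · rw [h] at hs
    conv at hdd => rhs; arg 2; rw [hF']
    rw [D.onAnnEnd_op_odd ι hs, D.onAnnEnd_op_even ι h]
    simp only [map_add, map_sub, map_neg, par_par, par_cup, LinearMap.add_apply, LinearMap.sub_apply,
      LinearMap.neg_apply, a1, a2, a3, d1, d2, hdd, Connection.par_extD, neg_neg]
    abel
  · rw [h, map_neg, neg_neg] at hs
    conv at hdd => rhs; arg 2; rw [hF]
    rw [D.onAnnEnd_op_even ι hs, D.onAnnEnd_op_odd ι h]
    simp only [map_sub, map_neg, par_par, par_cup, LinearMap.sub_apply, LinearMap.neg_apply, a1, a2,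
      a3, d1, d2, hdd, Connection.par_extD, neg_neg]
    abel

theorem Superconnection.IsFlat.onAnnEnd (hD : D.IsFlat) {n : ℕ} (hX : Bounded X n) :
    (D.onAnnEnd ι).IsFlat := by
  intro ϖ
  -- Twice any form is the sum of an even and an odd one for the total parity.
  have h1 := hD.onAnnEnd_op_op D ι hX (ϖ := ϖ + ι.annStar X ϖ)
    (Or.inl (by rw [map_add, Hom.annStar_annStar, add_comm]))
  have h2 := hD.onAnnEnd_op_op D ι hX (ϖ := ϖ - ι.annStar X ϖ)
    (Or.inr (by rw [map_sub, Hom.annStar_annStar, neg_sub]))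
  have h3 : (D.onAnnEnd ι).op ((D.onAnnEnd ι).op ((2 : ℝ) • ϖ)) = 0 := by
    rw [show (2 : ℝ) • ϖ = (ϖ + ι.annStar X ϖ) + (ϖ - ι.annStar X ϖ) by rw [two_smul]; abel,
      map_add, map_add, h1, h2, add_zero]
  rw [map_smul, map_smul] at h3
  exact (smul_eq_zero.1 h3).resolve_left two_ne_zero

end LieRinehart

end
end HomotopyModules

/-! ### Restriction of forms from `L` to `A`, and the Atiyah cocycle. -/

namespace HomotopyModules
open Function Bundle
open scoped TensorProduct
open Form

section
variable {R A L : Type*} [CommRing R] [Algebra ℝ R] [AddCommGroup A] [Module R A]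
  [AddCommGroup L] [Module R L] {gA : LieRinehart R A} {gL : LieRinehart R L}
  {P Q S N : Type*} [AddCommGroup P] [Module R P] [AddCommGroup Q] [Module R Q]
  [AddCommGroup S] [Module R S] [AddCommGroup N] [Module R N]

theorem Form.contr_contr (a b : A) (u : Form R A P) :
    contr a (contr b u) = - contr b (contr a u) := by
  have h := contr_contr_self (a + b) u
  simp only [contr_add, map_add, contr_contr_self, zero_add, add_zero] at h
  rw [add_comm] at h
  exact eq_neg_of_add_eq_zero_left h

namespace LieRinehart

/-- The restriction of forms from `L` to `A`. -/
def Hom.res (ι : Hom gA gL) : Form R L P →ₗ[R] Form R A P where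
  toFun w k := (w k).compLinearMap ι.toLinearMap
  map_add' _ _ := rfl
  map_smul' _ _ := rfl

variable (ι : Hom gA gL)

theorem Hom.res_apply (w : Form R L P) (k : ℕ) (v : Fin k → A) :
    ι.res w k v = w k (fun i => ι.toLinearMap (v i)) := rfl

theorem Hom.contr_res (a : A) (w : Form R L P) :
    contr a (ι.res w) = ι.res (contr (ι.toLinearMap a) w) := by
  funext k; ext1 v
  rw [contr_apply, res_apply, res_apply, contr_apply]
  congr 1
  funext i
  refine Fin.cases ?_ (fun i => ?_) i <;> rfl

theorem Hom.res_par (w : Form R L P) : ι.res (par w) = par (ι.res w) := rfl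

theorem Hom.res_cup (B : P →ₗ[R] Q →ₗ[R] S) (w : Form R L P) (u : Form R L Q) :
    ι.res (cup B w u) = cup B (ι.res w) (ι.res u) := by
  funext n
  induction n generalizing w u with
  | zero =>
    apply apply_zero_eq
    rw [cup_zero_apply, res_apply, res_apply, res_apply, Subsingleton.elim (fun i : Fin 0 => _) ![],
      cup_zero_apply]
  | succ n ih =>
    refine apply_succ_eq fun a => ?_
    rw [contr_res, contr_cup, contr_cup, contr_res, contr_res, map_add, Pi.add_apply, Pi.add_apply,
      ih, ih, res_par]

variable {ι} in
theorem Connection.Extends.res_lie {D' : gL.Connection P} {D : gA.Connection P}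
    (h : D'.Extends ι D) (a : A) (w : Form R L P) :
    ι.res (D'.lie (ι.toLinearMap a) w) = D.lie a (ι.res w) := by
  funext k; ext1 v
  rw [Hom.res_apply, Connection.lie_apply, Connection.lie_apply, h, Hom.res_apply]
  congr 1
  refine Finset.sum_congr rfl fun i _ => ?_
  rw [Hom.res_apply]
  congr 1
  funext j
  rw [← ι.bracket_map]
  by_cases hj : j = i
  · subst hj; simp
  · simp [update_of_ne hj]

variable {ι} in
theorem Connection.Extends.res_extD {D' : gL.Connection P} {D : gA.Connection P}
    (h : D'.Extends ι D) (w : Form R L P) : ι.res (D'.extD w) = D.extD (ι.res w) := by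
  funext n
  induction n generalizing w with
  | zero => apply apply_zero_eq; rfl
  | succ n ih =>
    refine apply_succ_eq fun a => ?_
    rw [Hom.contr_res, Connection.contr_extD, Connection.contr_extD, map_sub, h.res_lie,
      Pi.sub_apply, Pi.sub_apply, ih, Hom.contr_res]

variable {ι} in
theorem Connection.Extends.onEnd {D' : gL.Connection N} {D : gA.Connection N}
    (h : D'.Extends ι D) : D'.onEnd.Extends ι D.onEnd := by
  intro a f
  ext1 e
  rw [onEnd_apply, onEnd_apply, h, h]

variable {ι} in
theorem Connection.Extends.res_curvForm {D' : gL.Connection N} {D : gA.Connection N}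
    (h : D'.Extends ι D) : ι.res D'.curvForm = D.curvForm := by
  funext k; ext1 v
  by_cases hk : k = 2
  · subst hk
    ext1 e
    change D'.curvature _ _ e = D.curvature _ _ e
    simp only [curvature, ← ι.bracket_map, h _ _]
  · rw [Hom.res_apply, curvForm_of_ne _ hk, curvForm_of_ne _ hk]; rfl

variable {ι} in
theorem Superconnection.Extends.res_curvature [Module ℝ N] [IsScalarTower ℝ R N]
    {gr : ℤ → Submodule R N} {DL : gL.Superconnection N gr}
    {D : gA.Superconnection N gr} (h : DL.Extends ι D) : ι.res DL.curvature = D.curvature := by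
  have hf : ι.res DL.form = D.form := by
    funext k; ext1 v
    exact h.2 k v
  rw [curvature, map_add, map_add, h.1.res_curvForm, h.1.onEnd.res_extD, Hom.res_cup, Hom.res_par,
    hf]
  rfl

/-- For a form on `L`, the form on `A` with last argument fixed:
`(a_1, …, a_k) ↦ w(a_1, …, a_k, l)`. -/
def Hom.slot (l : L) : Form R L P →ₗ[R] Form R A P := par ∘ₗ ι.res ∘ₗ contr l

theorem Hom.slot_apply (l : L) (w : Form R L P) : ι.slot l w = par (ι.res (contr l w)) := rfl

theorem Hom.slot_eq_snoc (l : L) (w : Form R L P) (k : ℕ) (v : Fin k → A) :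
    ι.slot l w k v = w (k + 1) (Fin.snoc (α := fun _ => L) (fun i => ι.toLinearMap (v i)) l) := by
  rw [← Fin.insertNth_last' l (fun i => ι.toLinearMap (v i)), AlternatingMap.map_insertNth]
  rfl

/-- The sign that moves `l` to the last place absorbs the anticommutation of the two contractions.
-/
theorem Hom.contr_slot (a : A) (l : L) (w : Form R L P) :
    contr a (ι.slot l w) = ι.slot l (contr (ι.toLinearMap a) w) := by
  rw [slot_apply, contr_par, contr_res, contr_contr, map_neg, map_neg, neg_neg, slot_apply]

-- The correction by the slot of `[a, l]` is precisely the Bott term in the connection on `A° ⊗ P`.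
variable {ι} in
theorem Connection.Extends.slot_lie {D' : gL.Connection P} {D : gA.Connection P}
    (h : D'.Extends ι D) (a : A) (l : L) (w : Form R L P) :
    ι.slot l (D'.lie (ι.toLinearMap a) w) =
      D.lie a (ι.slot l w) - ι.slot (gL.bracket (ι.toLinearMap a) l) w := by
  rw [Hom.slot_apply, Connection.contr_lie, map_sub, map_sub, h.res_lie, ← lie_par]
  rfl

variable {ι} in
/-- The value at `l`. -/
def Hom.annEval (l : L) : ι.AnnEnd N →ₗ[R] EndMod R N :=
  LinearMap.applyₗ l ∘ₗ Hom.AnnEnd.toHom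

/-- `ϖ ∈ Ω(A, A° ⊗ End N)` is the restriction of the form `w` on `L`, which vanishes on `A`. -/
def Hom.IsSlotForm (w : Form R L (EndMod R N)) (ϖ : Form R A (ι.AnnEnd N)) : Prop :=
  ι.res w = 0 ∧ ∀ l, map (Hom.annEval l) ϖ = ι.slot l w

/-- For `l` in the image of `A` the slot is, up to sign, a contraction of the restriction of `w`,
which is zero; hence the values lie in `A° ⊗ End(N)`. -/
theorem Hom.exists_isSlotForm (w : Form R L (EndMod R N)) (hw : ι.res w = 0) :
    ∃ ϖ, ι.IsSlotForm w ϖ := by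
  refine ⟨fun k =>
    { toFun := fun v => .mk
        { toFun := fun l => ι.slot l w k v
          map_add' := fun l l' => by
            rw [slot_apply, slot_apply, slot_apply, contr_add, map_add, map_add]; rfl
          map_smul' := fun r l => by
            rw [slot_apply, slot_apply, contr_smul, map_smul, map_smul]; rfl }
        (fun a => by
          change ι.slot (ι.toLinearMap a) w k v = 0
          rw [slot_apply, ← contr_res, hw]; simp)
      map_update_add' := fun v i x y => by
        ext1 l; exact (ι.slot l w k).map_update_add v i x y
      map_update_smul' := fun v i r x => by
        ext1 l; exact (ι.slot l w k).map_update_smul v i r x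
      map_eq_zero_of_eq' := fun v i j h hij => by
        ext1 l; exact (ι.slot l w k).map_eq_zero_of_eq v h hij }, hw, fun l => ?_⟩
  rfl

-- For forms that vanish on `A`, the covariant derivative along `L` restricts to the one along `A`
-- twisted by the Bott connection. The hypothesis survives contraction with elements of `A`, so
-- Cartan's formula on both sides gives the induction.
variable {ι} in
theorem Connection.Extends.annEval_extD {D' : gL.Connection N} {D : gA.Connection N}
    (h : D'.Extends ι D) {w : Form R L (EndMod R N)} {ϖ : Form R A (ι.AnnEnd N)}
    (hw : ι.IsSlotForm w ϖ) (l : L) :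
    map (Hom.annEval l) ((D.onAnnEnd ι).extD ϖ) = ι.slot l (D'.onEnd.extD w) := by
  funext n
  induction n generalizing w ϖ with
  | zero =>
    apply apply_zero_eq
    -- A form of degree zero is unchanged by restriction, so vanishing on `A` makes it zero;
    -- otherwise the right side would contain `∇_l w`.
    have h0 : w 0 = 0 := by
      apply apply_zero_eq (u' := 0)
      have := congrArg (fun w => w 0 ![]) hw.1
      rwa [Hom.res_apply, Subsingleton.elim (fun i : Fin 0 => _) ![]] at this
    change (0 : EndMod R N) = par (ι.res (contr l (D'.onEnd.extD w))) 0 ![]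
    rw [contr_extD, map_sub, map_sub]
    change 0 = par (ι.res (D'.onEnd.lie l w)) 0 ![] - par (ι.res (D'.onEnd.extD _)) 0 ![]
    have h1 : D'.onEnd.lie l w 0 = 0 := by
      ext1 v
      rw [lie_apply, h0]
      simp [zero_right]
    simp [par_apply, Hom.res_apply, h1]
  | succ n ih =>
    refine apply_succ_eq fun a => ?_
    have hc : ι.IsSlotForm (contr (ι.toLinearMap a) w) (contr a ϖ) := by
      refine ⟨by rw [← Hom.contr_res, hw.1, map_zero], fun l => ?_⟩
      rw [map_contr, hw.2, Hom.contr_slot]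
    rw [← map_contr, Hom.contr_slot, contr_extD, contr_extD, map_sub, map_sub, Pi.sub_apply,
      Pi.sub_apply, ih hc, h.onEnd.slot_lie, ← hw.2, ← hw.2]
    congr 1
    ext1 v
    change ((D.onAnnEnd ι).nabla a (ϖ n v) - ∑ i, ϖ n _).toHom l = D.onEnd.nabla a ((ϖ n v).toHom l) -
      ∑ i, (ϖ n _).toHom l - (ϖ n v).toHom _
    rw [map_sub, map_sum, LinearMap.sub_apply, onAnnEnd_apply, LinearMap.sum_apply]
    abel

end LieRinehart
end

section
variable {R A L : Type*} [CommRing R] [Algebra ℝ R] [AddCommGroup A] [Module R A]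
  [AddCommGroup L] [Module R L]
  {X : ℤ → Type*} [∀ i, AddCommGroup (X i)] [∀ i, Module R (X i)]
  {gA : LieRinehart R A} {gL : LieRinehart R L}
  [∀ i, Module ℝ (X i)] [∀ i, IsScalarTower ℝ R (X i)]

namespace LieRinehart
variable {ι : Hom gA gL}

theorem Hom.annStar_of_mem {n : ℕ} (hX : Bounded X n) {p : ℤ}
    {ϖ : Form R A (ι.AnnEnd (∀ i, X i))} (h : ϖ ∈ totalDegree A (ι.annDegree X) p) :
    ι.annStar X ϖ = (p.negOnePow : ℤ) • ϖ := by
  funext k; ext1 v; ext1 l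
  change conjKoszul R X (((-1 : ℤ) ^ k • ϖ k v).toHom l) = ((p.negOnePow : ℤ) • ϖ k v).toHom l
  rw [map_zsmul, map_zsmul, LinearMap.smul_apply, LinearMap.smul_apply, map_zsmul,
    hX.conjKoszul_of_mem (h k v l), Units.smul_def, smul_smul, Int.negOnePow_sub, Units.val_mul,
    Int.coe_negOnePow_natCast, mul_comm, mul_assoc, ← pow_add, Even.neg_one_pow ⟨_, rfl⟩, mul_one]

variable {D : gA.Superconnection (∀ i, X i) (homogeneous R X)}
  {DL : gL.Superconnection (∀ i, X i) (homogeneous R X)}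

theorem Superconnection.curvature_mem (D : gA.Superconnection (∀ i, X i) (homogeneous R X)) (k : ℕ)
    (v : Fin k → A) : D.curvature k v ∈ endDegree R X (2 - k) := by
  intro i e he
  rw [← op_op_constForm]
  have h0 : constForm e ∈ totalDegree A (homogeneous R X) i := by
    intro k v
    cases k with
    | zero => simpa [constForm] using he
    | succ k => exact zero_mem _
  have := D.op_mem _ _ (D.op_mem _ _ h0) k v
  rwa [show i + 1 + 1 - (k : ℤ) = i + (2 - k) by ring] at this

/-- The Atiyah form exists and is a cocycle of degree one. -/
theorem Superconnection.Extends.exists_isAtiyahForm (h : DL.Extends ι D) (hD : D.IsFlat) {n : ℕ}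
    (hX : Bounded X n) : ∃ α : D.annEndCocycles ι 1, DL.IsAtiyahForm ι α.1 := by
  have hres : ι.res DL.curvature = 0 := by rw [h.res_curvature, hD.curvature_eq_zero]
  obtain ⟨α, hα⟩ := ι.exists_isSlotForm DL.curvature hres
  have hval : ∀ k v l, (α k v).toHom l = DL.curvature (k + 1)
      (Fin.snoc (α := fun _ => L) (fun i => ι.toLinearMap (v i)) l) := by
    intro k v l
    rw [← Hom.slot_eq_snoc, ← hα.2]; rfl
  have hdeg : α ∈ totalDegree A (ι.annDegree X) 1 := by
    intro k v l
    rw [hval, show (1 : ℤ) - k = 2 - (k + 1 : ℕ) by push_cast; ring]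
    exact DL.curvature_mem _ _
  have hstar : ι.annStar X α = - α := by
    rw [Hom.annStar_of_mem hX hdeg]; simp
  have hf : ι.res DL.form = D.form := by
    funext k; ext1 v
    exact h.2 k v
  refine ⟨⟨α, hdeg, ?_⟩, fun k v l e => by rw [hval, op_op_constForm]⟩
  change (D.onAnnEnd ι).op α = 0
  rw [D.onAnnEnd_op_odd ι hstar]
  have key : ∀ l, map (Hom.annEval l) ((D.onAnnEnd ι).extD α -
      cup (ι.annPost _) (par α) (par D.form) - cup (ι.annPre _) D.form α) = 0 := by
    intro l
    rw [map_sub, map_sub, map_cup, map_cup]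
    have e1 : map (Hom.annEval l) ((D.onAnnEnd ι).extD α) = ι.slot l (DL.onEnd.extD DL.curvature) :=
      h.1.annEval_extD hα l
    have e2 : cup ((ι.annPost _).compr₂ (Hom.annEval l)) (par α) (par D.form) =
        cup (compPairing R _) (par (ι.slot l DL.curvature)) (par D.form) := by
      rw [← hα.2, ← map_par, cup_map_left]; rfl
    have e3 : cup ((ι.annPre _).compr₂ (Hom.annEval l)) D.form α =
        cup (compPairing R _) D.form (ι.slot l DL.curvature) := by
      rw [← hα.2, cup_map_right]; rfl
    -- In the Bianchi identity for `D_L` with `l` in the last slot, the terms where `l` enters `ω`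
    -- contain the restricted curvature, which is the curvature of `D_A` and vanishes. The surviving
    -- terms are `s α` evaluated at `l`.
    have hb := congrArg (ι.slot l) DL.bianchi
    rw [map_sub, map_add, map_zero] at hb
    rw [e1, e2, e3, ← hb]
    simp only [Hom.slot_apply ι l (cup _ _ _), contr_cup, map_add, Hom.res_cup, hres, contr_par,
      map_neg, LinearMap.neg_apply, Hom.res_par, hf, map_zero, LinearMap.zero_apply, par_par,
      add_zero, zero_add, par_cup, Hom.slot_apply]
    abel
  funext k; ext1 v; ext1 l
  exact congrArg (fun w => w k v) (key l)

end LieRinehart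
end
end HomotopyModules

/-! ### Lowest components of forms; the projection onto `K` and its section. -/

namespace HomotopyModules
open Function Bundle
open scoped TensorProduct
open Form

section
variable {R A P Q S : Type*} [CommRing R] [Algebra ℝ R] [AddCommGroup A] [Module R A]
  [AddCommGroup P] [Module R P] [AddCommGroup Q] [Module R Q] [AddCommGroup S] [Module R S]
  {g : LieRinehart R A}

namespace Form
variable (B : P →ₗ[R] Q →ₗ[R] S)

theorem cup_right_of_lt (w : Form R A P) {u : Form R A Q} {m : ℕ} (hu : ∀ k < m, u k = 0) {n : ℕ}
    (hn : n < m) : cup B w u n = 0 := by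
  ext1 v
  refine cup_mem B ⊥ w u n (fun k q h x y => ?_) v
  rw [hu q (by omega)]
  simp

theorem cup_left_of_lt {w : Form R A P} (u : Form R A Q) {m : ℕ} (hw : ∀ k < m, w k = 0) {n : ℕ}
    (hn : n < m) : cup B w u n = 0 := by
  ext1 v
  refine cup_mem B ⊥ w u n (fun k q h x y => ?_) v
  rw [hw k (by omega)]
  simp

theorem contr_of_lt {u : Form R A Q} {m : ℕ} (hu : ∀ k < m + 1, u k = 0) (a : A) :
    ∀ k < m, contr a u k = 0 := by
  intro k hk
  ext1 v
  rw [contr_apply, hu _ (by omega)]; rfl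

theorem par_of_lt {u : Form R A Q} {m : ℕ} (hu : ∀ k < m, u k = 0) : ∀ k < m, par u k = 0 := by
  intro k hk
  rw [par_apply, hu k hk, smul_zero]

/-- Leading terms for the filtration by form degree: only the degree zero part of the other factor
contributes. For `s` this singles out `∂ = ω^(0)`. -/
theorem cup_left_lowest {m : ℕ} {w : Form R A P} (u : Form R A Q) (hw : ∀ k < m, w k = 0)
    (v : Fin m → A) : cup B w u m v = B (w m v) (u 0 ![]) := by
  induction m generalizing w with
  | zero => rw [Subsingleton.elim v ![], cup_zero_apply]
  | succ m ih =>
    rw [← Fin.cons_self_tail v, ← contr_apply, contr_cup, Pi.add_apply, AlternatingMap.add_apply,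
      ih (contr_of_lt hw _), cup_left_of_lt B _ (par_of_lt hw) (Nat.lt_succ_self m)]
    simp [contr_apply]

theorem cup_right_lowest {m : ℕ} (w : Form R A P) {u : Form R A Q} (hu : ∀ k < m, u k = 0)
    (v : Fin m → A) : cup B w u m v = B (w 0 ![]) (u m v) := by
  induction m generalizing w u with
  | zero => rw [Subsingleton.elim v ![], cup_zero_apply]
  | succ m ih =>
    rw [← Fin.cons_self_tail v, ← contr_apply, contr_cup, Pi.add_apply, AlternatingMap.add_apply,
      ih _ (contr_of_lt hu _), cup_right_of_lt B _ hu (Nat.lt_succ_self m)]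
    simp [contr_apply, par_apply]

/-- A form as a form with values in a submodule containing its values. -/
def codRestrict (T : Submodule R P) (u : Form R A P) (hu : ∀ k v, u k v ∈ T) : Form R A T :=
  fun k => (u k).codRestrict T (hu k)

theorem map_codRestrict (T : Submodule R P) (u : Form R A P) (hu : ∀ k v, u k v ∈ T) :
    map T.subtype (codRestrict T u hu) = u := rfl

/-- The form whose only component is `φ`, in degree `m`. -/
def single (m : ℕ) (φ : A [⋀^Fin m]→ₗ[R] P) : Form R A P := Pi.single m φ

theorem single_of_ne {m k : ℕ} (φ : A [⋀^Fin m]→ₗ[R] P) (h : k ≠ m) : single m φ k = 0 :=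
  Pi.single_eq_of_ne h _

@[simp] theorem single_same {m : ℕ} (φ : A [⋀^Fin m]→ₗ[R] P) : single m φ m = φ :=
  Pi.single_eq_same _ _

end Form

namespace LieRinehart.Connection
variable (D : g.Connection P)

theorem extDeriv_zero (k : ℕ) : D.extDeriv (0 : A [⋀^Fin k]→ₗ[R] P) = 0 := by
  have := D.extDeriv_add (0 : A [⋀^Fin k]→ₗ[R] P) 0
  rwa [add_zero, left_eq_add] at this

theorem extD_of_lt {u : Form R A P} {m : ℕ} (hu : ∀ k < m, u k = 0) {k : ℕ} (hk : k ≤ m) :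
    D.extD u k = 0 := by
  cases k with
  | zero => rfl
  | succ k =>
    change D.extDeriv (u k) = 0
    rw [hu k (by omega), extDeriv_zero]

/-- The restriction of a connection to a stable submodule. -/
def restrict (T : Submodule R P) (hT : ∀ a, ∀ e ∈ T, D.nabla a e ∈ T) : g.Connection T where
  nabla a e := ⟨D.nabla a e, hT a e e.2⟩
  add_left a b e := Subtype.ext (D.add_left a b e)
  smul_left r a e := Subtype.ext (D.smul_left r a e)
  add_right a e e' := Subtype.ext (D.add_right a e e')
  leibniz a r e := Subtype.ext (D.leibniz a r e)

variable {T : Submodule R P} (hT : ∀ a, ∀ e ∈ T, D.nabla a e ∈ T) {u : Form R A P}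
  (hu : ∀ k v, u k v ∈ T)
include hT hu

/-- Naturality under the inclusion of `T`, applied to the restricted connection, replaces an
inspection of the defining sums. -/
theorem extD_mem (k : ℕ) (v : Fin k → A) : D.extD u k v ∈ T := by
  have h := map_extD (D.restrict T hT) D T.subtype (fun _ _ => rfl) (codRestrict T u hu)
  rw [map_codRestrict] at h
  rw [← h]
  exact ((D.restrict T hT).extD (codRestrict T u hu) k v).2

theorem map_extD_of_mem (D' : g.Connection Q) (f : P →ₗ[R] Q)
    (hf : ∀ a, ∀ e ∈ T, f (D.nabla a e) = D'.nabla a (f e)) :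
    map f (D.extD u) = D'.extD (map f u) := by
  have h := map_extD (D.restrict T hT) D T.subtype (fun _ _ => rfl) (codRestrict T u hu)
  have h' := map_extD (D.restrict T hT) D' (f ∘ₗ T.subtype) (fun a e => hf a e e.2)
    (codRestrict T u hu)
  rw [map_codRestrict] at h
  rw [← h]
  exact h'

end LieRinehart.Connection
end

section
variable {R A L : Type*} [CommRing R] [Algebra ℝ R] [AddCommGroup A] [Module R A]
  [AddCommGroup L] [Module R L]
  {X : ℤ → Type*} [∀ i, AddCommGroup (X i)] [∀ i, Module R (X i)]
  {gA : LieRinehart R A} {gL : LieRinehart R L}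

theorem eq_zero_of_mem_homogeneous {i : ℤ} (h : Subsingleton (X i)) {e : ∀ i, X i}
    (he : e ∈ homogeneous R X i) : e = 0 := by
  funext j
  by_cases hj : j = i
  · subst hj; exact Subsingleton.elim _ _
  · exact he j hj

theorem eq_single_of_mem_homogeneous {i : ℤ} {e : ∀ i, X i} (he : e ∈ homogeneous R X i) :
    e = Pi.single i (e i) := by
  funext j
  by_cases hj : j = i
  · subst hj; simp
  · rw [Pi.single_eq_of_ne hj]; exact he j hj

/-- An endomorphism of negative degree has no component in degree zero. -/
theorem Bounded.apply_zero_of_mem_endDegree {n : ℕ} (hX : Bounded X n) {j : ℤ} (hj : j < 0)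
    {f : EndMod R (∀ i, X i)} (hf : f ∈ endDegree R X j) (e : ∀ i, X i) : f e 0 = 0 := by
  refine hX.ext_homogeneous (R := R) (fun e => f e 0) (fun _ => 0) (by simp) (by simp) (fun i e he => ?_) e
  by_cases hi : 0 < i
  · rw [eq_zero_of_mem_homogeneous (R := R) (hX i (Or.inr hi)) he, map_zero]; rfl
  · exact hf i e he 0 (by omega)

theorem Bounded.eq_zero_of_mem_endDegree {n : ℕ} (hX : Bounded X n) {j : ℤ} (hj : j < -n)
    {f : EndMod R (∀ i, X i)} (hf : f ∈ endDegree R X j) : f = 0 := by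
  ext1 e
  refine hX.ext_homogeneous (R := R) f (fun _ => 0) (by simp) (by simp) (fun i e he => ?_) e
  by_cases hi : 0 < i
  · rw [eq_zero_of_mem_homogeneous (R := R) (hX i (Or.inr hi)) he, map_zero]
  · exact eq_zero_of_mem_homogeneous (hX (i + j) (Or.inl (by omega))) (hf i e he)

variable [∀ i, Module ℝ (X i)] [∀ i, IsScalarTower ℝ R (X i)]

namespace LieRinehart.Superconnection
variable (D : gA.Superconnection (∀ i, X i) (homogeneous R X))

theorem IsFlat.form_zero_form_zero {D : gA.Superconnection (∀ i, X i) (homogeneous R X)}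
    (hD : D.IsFlat) (e : ∀ i, X i) : D.form 0 ![] (D.form 0 ![] e) = 0 := by
  have h := congrArg (fun w => w 0 ![] e) hD.curvature_eq_zero
  simp only [curvature, Pi.add_apply, AlternatingMap.add_apply, cup_zero_apply, LinearMap.add_apply,
    compPairing_apply, par_apply, pow_zero, one_smul] at h
  rw [Connection.curvForm_of_ne _ (by norm_num)] at h
  simpa using h

/-- The projection onto `K`. -/
def toCokernel : (∀ i, X i) →ₗ[R] D.cokernel :=
  (LinearMap.range (D.diff (-1) 0)).mkQ ∘ₗ LinearMap.proj 0

theorem toCokernel_apply (e : ∀ i, X i) : D.toCokernel e = Submodule.Quotient.mk (e 0) := rfl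

theorem toCokernel_single (x : X 0) :
    D.toCokernel (Pi.single 0 x) = Submodule.Quotient.mk x := by
  rw [toCokernel_apply, Pi.single_eq_same]

theorem toCokernel_of_ne {i : ℤ} (hi : i ≠ 0) {e : ∀ i, X i} (he : e ∈ homogeneous R X i) :
    D.toCokernel e = 0 := by
  rw [toCokernel_apply, he 0 hi.symm, Submodule.Quotient.mk_zero]

section
variable {n : ℕ} (hX : Bounded X n)
include hX

/-- For `k ≥ 2` the values strictly lower the degree, which is at most zero, so they miss degree
zero; for `k = 0` what lands in degree zero is a coboundary. Consequently every composite that ends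
with some `ω^(k)` is invisible in `K`. -/
theorem toCokernel_form (k : ℕ) (v : Fin k → A) (e : ∀ i, X i) :
    D.toCokernel (D.form k v e) = 0 := by
  refine hX.ext_homogeneous (R := R) (fun e => D.toCokernel (D.form k v e)) (fun _ => 0) (by simp) (by simp)
    (fun i e he => ?_) e
  by_cases hi : 0 < i
  · rw [eq_zero_of_mem_homogeneous (R := R) (hX i (Or.inr hi)) he, map_zero, map_zero]
  by_cases hk : k = 0
  · subst hk
    by_cases hi : i = -1
    · subst hi
      rw [Subsingleton.elim v ![], eq_single_of_mem_homogeneous he, D.diff_single (-1) 0 (by simp),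
        toCokernel_single]
      exact (Submodule.Quotient.mk_eq_zero _).2 ⟨_, rfl⟩
    · exact D.toCokernel_of_ne (by simpa using fun h => hi (by omega)) (D.form_mem 0 i v e he)
  · by_cases hk' : k = 1
    · subst hk'
      rw [D.form_one]; simp
    · exact D.toCokernel_of_ne (by omega) (D.form_mem k i v e he)

theorem toCokernel_nabla (hD : D.IsFlat) (a : A) (e : ∀ i, X i) :
    D.toCokernel (D.nabla a e) = (D.cokernelConnection hD).nabla a (D.toCokernel e) := by
  refine hX.ext_homogeneous (R := R) (fun e => D.toCokernel (D.nabla a e))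
    (fun e => (D.cokernelConnection hD).nabla a (D.toCokernel e)) (fun e e' => ?_) (fun e e' => ?_)
    (fun i e he => ?_) e
  · simp only [D.add_right, map_add]
  · simp only [Connection.add_right, map_add]
  · by_cases hi : i = 0
    · subst hi
      rw [eq_single_of_mem_homogeneous he, toCokernel_single]
      rfl
    · rw [D.toCokernel_of_ne hi he, D.toCokernel_of_ne hi (D.nabla_mem i a e he),
        Connection.zero_right]

/-- The connection on `K` is flat. -/
theorem cokernelConnection_curvature (hD : D.IsFlat) (a b : A) (e : D.cokernel) :
    (D.cokernelConnection hD).curvature a b e = 0 := by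
  obtain ⟨e, rfl⟩ := Submodule.Quotient.mk_surjective _ e
  have h := congrArg (fun w => D.toCokernel (w 2 ![a, b] (Pi.single 0 e))) hD.curvature_eq_zero
  -- The endomorphisms killed by the projection form a subgroup containing all composites `ω^(q) ∘
  -- ω^(k)`.
  have h1 : D.toCokernel (cup (compPairing R _) (par D.form) D.form 2 ![a, b] (Pi.single 0 e)) = 0 := by
    have := cup_mem (compPairing R (∀ i, X i))
      (LinearMap.ker (D.toCokernel.compRight R (M := ∀ i, X i))).toAddSubgroup (par D.form) D.form 2
      (fun k q hkq x y => by
        change D.toCokernel ∘ₗ _ = 0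
        ext1 e
        exact D.toCokernel_form hX _ _ _) ![a, b]
    exact LinearMap.congr_fun (show D.toCokernel ∘ₗ _ = 0 from this) _
  -- The derivative in degree two involves the entry of index one, which is zero by convention. Only
  -- the curvature of `∇` is left.
  have h2 : D.onEnd.extD D.form 2 = 0 := by
    change D.onEnd.extDeriv (D.form 1) = 0
    rw [D.form_one, Connection.extDeriv_zero]
  simp only [Superconnection.curvature, Pi.add_apply, AlternatingMap.add_apply, LinearMap.add_apply, map_add, h1, h2,
    Connection.curvForm_two, Pi.zero_apply, AlternatingMap.zero_apply, LinearMap.zero_apply, map_zero,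
    add_zero] at h
  change D.toCokernel (D.toConnection.curvature a b (Pi.single 0 e)) = 0 at h
  rw [← D.toCokernel_single, ← h]
  simp only [Connection.curvature, map_sub, D.toCokernel_nabla hX hD]

end

/-- A contraction of the complex `(X, ∂)` in negative degrees. -/
structure Contraction where
  h : EndMod R (∀ i, X i)
  h_mem : h ∈ endDegree R X (-1)
  h_diff : ∀ i < 0, ∀ e ∈ homogeneous R X i, D.form 0 ![] (h e) + h (D.form 0 ![] e) = e

namespace Contraction
variable {D} (C : D.Contraction)

/-- The homotopically trivial part `1 - ∂ h - h ∂` of the identity. -/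
def idem : EndMod R (∀ i, X i) := LinearMap.id - D.form 0 ![] ∘ₗ C.h - C.h ∘ₗ D.form 0 ![]

theorem idem_apply (e : ∀ i, X i) :
    C.idem e = e - D.form 0 ![] (C.h e) - C.h (D.form 0 ![] e) := rfl

theorem idem_of_neg {i : ℤ} (hi : i < 0) {e : ∀ i, X i} (he : e ∈ homogeneous R X i) :
    C.idem e = 0 := by
  rw [idem_apply, sub_sub, C.h_diff i hi e he, sub_self]

theorem idem_mem (i : ℤ) {e : ∀ i, X i} (he : e ∈ homogeneous R X i) :
    C.idem e ∈ homogeneous R X i := by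
  refine sub_mem (sub_mem he ?_) ?_
  · have := D.form_mem 0 _ ![] _ (C.h_mem i e he)
    simpa using this
  · have := C.h_mem _ _ (D.form_mem 0 i ![] e he)
    simpa using this

/-- The section of the projection onto `K` defined by the contraction. -/
def sec (hD : D.IsFlat) : D.cokernel →ₗ[R] ∀ i, X i :=
  Submodule.liftQ _ (C.idem ∘ₗ LinearMap.single R X 0) (by
    rintro _ ⟨x, rfl⟩
    have h : (Pi.single 0 (D.diff (-1) 0 x) : ∀ i, X i) = D.form 0 ![] (Pi.single (-1) x) :=
      (D.diff_single (-1) 0 (by simp) x).symm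
    -- On a coboundary the idempotent gives `∂x - ∂h∂x = ∂(x - h∂x)`, which equals `∂∂hx = 0` by the
    -- contraction identity in degree `-1`.
    rw [LinearMap.mem_ker, LinearMap.comp_apply, LinearMap.single_apply, h, idem_apply,
      hD.form_zero_form_zero, map_zero, sub_zero, ← map_sub]
    have h1 := C.h_diff (-1) (by norm_num) _ (single_mem_homogeneous (-1) x)
    rw [← eq_sub_iff_add_eq] at h1
    rw [← h1, hD.form_zero_form_zero])

variable {n : ℕ} (hX : Bounded X n) (hD : D.IsFlat)
include hX

/-- The homotopy formula `σπ = 1 - ∂h - h∂` in all degrees: in negative degrees both sides vanish,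
in degree zero it defines `σ`, and there is nothing above. In particular each `e` in `ker π` is `∂he
+ h∂e`. -/
theorem sec_toCokernel (e : ∀ i, X i) :
    C.sec hD (D.toCokernel e) = e - D.form 0 ![] (C.h e) - C.h (D.form 0 ![] e) := by
  rw [← idem_apply]
  refine hX.ext_homogeneous (R := R) (fun e => C.sec hD (D.toCokernel e)) C.idem (by simp) (by simp)
    (fun i e he => ?_) e
  rcases lt_trichotomy i 0 with hi | rfl | hi
  · rw [C.idem_of_neg hi he, D.toCokernel_of_ne hi.ne he, map_zero]
  · conv_rhs => rw [eq_single_of_mem_homogeneous he]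
    rfl
  · rw [eq_zero_of_mem_homogeneous (R := R) (hX i (Or.inr hi)) he, map_zero, map_zero, map_zero]

theorem toCokernel_h (e : ∀ i, X i) : D.toCokernel (C.h e) = 0 := by
  rw [toCokernel_apply, hX.apply_zero_of_mem_endDegree (by norm_num) C.h_mem,
    Submodule.Quotient.mk_zero]

theorem toCokernel_sec (x : D.cokernel) : D.toCokernel (C.sec hD x) = x := by
  obtain ⟨x, rfl⟩ := Submodule.Quotient.mk_surjective _ x
  rw [← toCokernel_single, C.sec_toCokernel hX, map_sub, map_sub, D.toCokernel_form hX,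
    C.toCokernel_h hX, sub_zero, sub_zero]

omit hX in
theorem sec_mem (x : D.cokernel) : C.sec hD x ∈ homogeneous R X 0 := by
  obtain ⟨x, rfl⟩ := Submodule.Quotient.mk_surjective _ x
  exact C.idem_mem 0 (single_mem_homogeneous 0 x)

end Contraction
end LieRinehart.Superconnection
end
end HomotopyModules

/-! ### Reduction of the complex with coefficients in `A° ⊗ End(E)` to `K`. -/

namespace HomotopyModules
open Function Bundle
open scoped TensorProduct
open Form

section
variable {R A P Q : Type*} [CommRing R] [Algebra ℝ R] [AddCommGroup A] [Module R A]
  [AddCommGroup P] [Module R P] [Module ℝ P] [IsScalarTower ℝ R P]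
  [AddCommGroup Q] [Module R Q] [Module ℝ Q] [IsScalarTower ℝ R Q]

/-- The forms with values in a submodule. -/
def Form.valued (A : Type*) [AddCommGroup A] [Module R A] (T : Submodule R P) :
    Submodule ℝ (Form R A P) where
  carrier := {u | ∀ k v, u k v ∈ T}
  add_mem' h h' k v := add_mem (h k v) (h' k v)
  zero_mem' k v := zero_mem _
  smul_mem' c u h k v := by
    have := T.smul_mem (algebraMap ℝ R c) (h k v)
    rwa [algebraMap_smul] at this

theorem Form.single_mem_valued {T : Submodule R P} {m : ℕ} {φ : A [⋀^Fin m]→ₗ[R] P}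
    (h : ∀ v, φ v ∈ T) : single m φ ∈ valued A T := by
  intro k v
  by_cases hk : k = m
  · subst hk; rw [single_same]; exact h v
  · rw [single_of_ne _ hk]; exact zero_mem _

theorem Form.single_mem_totalDegree {gr : ℤ → Submodule R P} {m : ℕ} {φ : A [⋀^Fin m]→ₗ[R] P} {p : ℤ}
    (h : ∀ v, φ v ∈ gr (p - m)) : single m φ ∈ totalDegree A gr p := by
  intro k v
  by_cases hk : k = m
  · subst hk; rw [single_same]; exact h v
  · rw [single_of_ne _ hk]; exact zero_mem _

/-- Composition with an `R`-linear map on the values, as a real linear map. -/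
def Form.mapReal (A : Type*) [AddCommGroup A] [Module R A] (f : P →ₗ[R] Q) :
    Form R A P →ₗ[ℝ] Form R A Q where
  toFun := map f
  map_add' := map_add _
  map_smul' c u := by
    funext k; ext1 v
    change f (c • u k v) = c • f (u k v)
    rw [← algebraMap_smul R c (u k v), map_smul, algebraMap_smul]

end

/-- Used with `Z` the cocycles that induce forms on `K`: it maps onto both cohomologies, and `Φ` is
the isomorphism of the two quotients. -/
theorem exists_linearEquiv_of_ker_eq {Z H H' : Type*} [AddCommGroup Z] [Module ℝ Z]
    [AddCommGroup H] [Module ℝ H] [AddCommGroup H'] [Module ℝ H'] (f : Z →ₗ[ℝ] H) (g : Z →ₗ[ℝ] H')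
    (hf : Surjective f) (hg : Surjective g) (h : ∀ z, f z = 0 ↔ g z = 0) :
    ∃ e : H ≃ₗ[ℝ] H', ∀ z, e (f z) = g z := by
  have hk : LinearMap.ker f = LinearMap.ker g := Submodule.ext h
  refine ⟨(f.quotKerEquivOfSurjective hf).symm.trans ((Submodule.quotEquivOfEq _ _ hk).trans
    (g.quotKerEquivOfSurjective hg)), fun z => ?_⟩
  have : (f.quotKerEquivOfSurjective hf).symm (f z) = Submodule.Quotient.mk z := by
    rw [LinearEquiv.symm_apply_eq]; rfl
  rw [LinearEquiv.trans_apply, this]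
  rfl

section
variable {R A L : Type*} [CommRing R] [Algebra ℝ R] [AddCommGroup A] [Module R A]
  [AddCommGroup L] [Module R L]
  {gA : LieRinehart R A} {gL : LieRinehart R L}
  {P Q : Type*} [AddCommGroup P] [Module R P] [AddCommGroup Q] [Module R Q]

/-- `φ ↦ (l ↦ f ∘ φ(l) ∘ f')`. -/
def LieRinehart.Hom.annMap (ι : Hom gA gL) (f : P →ₗ[R] Q) (f' : Q →ₗ[R] P) :
    ι.AnnEnd P →ₗ[R] ι.AnnEnd Q where
  toFun φ := .mk ((LinearMap.llcomp R Q P Q f ∘ₗ (LinearMap.llcomp R Q P P).flip f') ∘ₗ φ.toHom)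
    fun a => by simp [φ.toHom_incl a]
  map_add' φ φ' := by ext1; simp
  map_smul' r φ := by ext1; simp

end

section
variable {R A L : Type*} [CommRing R] [Algebra ℝ R] [AddCommGroup A] [Module R A]
  [AddCommGroup L] [Module R L]
  {X : ℤ → Type*} [∀ i, AddCommGroup (X i)] [∀ i, Module R (X i)]
  {gA : LieRinehart R A} {gL : LieRinehart R L}
  [∀ i, Module ℝ (X i)] [∀ i, IsScalarTower ℝ R (X i)]

namespace LieRinehart.Superconnection
variable (D : gA.Superconnection (∀ i, X i) (homogeneous R X)) (ι : Hom gA gL)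

/-- The elements of `A° ⊗ End(X)` that induce an element of `A° ⊗ End(K)`. -/
def annStab : Submodule R (ι.AnnEnd (∀ i, X i)) where
  carrier := {φ | ∀ l e, D.toCokernel e = 0 → D.toCokernel (φ.toHom l e) = 0}
  add_mem' h h' l e he := by
    rw [map_add, LinearMap.add_apply, LinearMap.add_apply, map_add, h l e he, h' l e he, add_zero]
  zero_mem' l e he := by simp
  smul_mem' r φ h l e he := by
    rw [map_smul, LinearMap.smul_apply, LinearMap.smul_apply, map_smul, h l e he, smul_zero]

/-- The elements of `A° ⊗ End(X)` that induce zero on `K`. -/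
def annNull : Submodule R (ι.AnnEnd (∀ i, X i)) where
  carrier := {φ | ∀ l e, D.toCokernel (φ.toHom l e) = 0}
  add_mem' h h' l e := by
    rw [map_add, LinearMap.add_apply, LinearMap.add_apply, map_add, h l e, h' l e, add_zero]
  zero_mem' l e := by simp
  smul_mem' r φ h l e := by
    rw [map_smul, LinearMap.smul_apply, LinearMap.smul_apply, map_smul, h l e, smul_zero]

theorem annNull_le : D.annNull ι ≤ D.annStab ι := fun φ h l e _ => h l e

section
variable {n : ℕ} (hX : Bounded X n) {p : ℤ} {ϖ : Form R A (ι.AnnEnd (∀ i, X i))}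
  (h : ϖ ∈ totalDegree A (ι.annDegree X) p)
include hX h

theorem onAnnEnd_op_of_mem :
    (D.onAnnEnd ι).op ϖ = (D.onAnnEnd ι).extD ϖ - cup (ι.annPost _) (par ϖ) (par D.form)
      + (p.negOnePow : ℤ) • cup (ι.annPre _) (evenPart D.form) ϖ
      - cup (ι.annPre _) (oddPart D.form) ϖ := by
  rw [onAnnEnd_op, Hom.annStar_of_mem hX h, map_zsmul]

theorem onAnnEnd_op_of_lt {m : ℕ} (hm : ∀ k < m, ϖ k = 0) {k : ℕ} (hk : k < m) :
    (D.onAnnEnd ι).op ϖ k = 0 := by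
  rw [D.onAnnEnd_op_of_mem ι hX h]
  simp only [Pi.sub_apply, Pi.add_apply, Pi.smul_apply, Connection.extD_of_lt _ hm hk.le,
    cup_left_of_lt _ _ (par_of_lt hm) hk, cup_right_of_lt _ _ hm hk, smul_zero, sub_zero, add_zero]

/-- On lowest components `s` is, up to sign, the graded commutator with `∂`, so the contraction `h`
can act there. -/
theorem onAnnEnd_op_lowest {m : ℕ} (hm : ∀ k < m, ϖ k = 0) (v : Fin m → A) (l : L) (e : ∀ i, X i) :
    ((D.onAnnEnd ι).op ϖ m v).toHom l e =
      (p.negOnePow : ℤ) • (ϖ m v).toHom l (D.form 0 ![] e) -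
      (-1 : ℤ) ^ m • D.form 0 ![] ((ϖ m v).toHom l e) := by
  rw [D.onAnnEnd_op_of_mem ι hX h]
  simp only [Pi.sub_apply, Pi.add_apply, Pi.smul_apply, Connection.extD_of_lt _ hm le_rfl,
    AlternatingMap.sub_apply, AlternatingMap.add_apply, AlternatingMap.smul_apply,
    cup_left_lowest _ _ (par_of_lt hm), cup_right_lowest _ _ hm]
  simp only [par_apply, evenPart, oddPart, pow_zero, one_smul, Even.zero, if_true,
    AlternatingMap.zero_apply, AlternatingMap.smul_apply, map_zero, LinearMap.zero_apply, map_sub,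
    map_add, map_zsmul, LinearMap.sub_apply, LinearMap.add_apply, LinearMap.smul_apply,
    Hom.annPost_apply, Hom.annPre_apply, LinearMap.comp_apply]
  abel

/-- The operator `s` preserves the forms with values in a stable submodule. -/
theorem onAnnEnd_op_mem_valued (T : Submodule R (ι.AnnEnd (∀ i, X i)))
    (h₁ : ∀ a, ∀ φ ∈ T, (D.toConnection.onAnnEnd ι).nabla a φ ∈ T)
    (h₂ : ∀ k v, ∀ φ ∈ T, ι.annPost _ φ (D.form k v) ∈ T)
    (h₃ : ∀ k v, ∀ φ ∈ T, ι.annPre _ (D.form k v) φ ∈ T) (hT : ϖ ∈ valued A T) :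
    (D.onAnnEnd ι).op ϖ ∈ valued A T := by
  rw [D.onAnnEnd_op_of_mem ι hX h]
  intro k v
  refine sub_mem (add_mem (sub_mem (Connection.extD_mem _ h₁ hT k v) ?_) (zsmul_mem ?_ _)) ?_
  · refine cup_mem _ T.toAddSubgroup _ _ _ (fun k q _ x y => ?_) v
    simp only [par_apply, AlternatingMap.smul_apply, map_zsmul, LinearMap.smul_apply]
    exact zsmul_mem (zsmul_mem (h₂ _ _ _ (hT _ _)) _) _
  · refine cup_mem _ T.toAddSubgroup _ _ _ (fun k q _ x y => ?_) v
    unfold evenPart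
    split_ifs
    · exact h₃ _ _ _ (hT _ _)
    · simp
  · refine cup_mem _ T.toAddSubgroup _ _ _ (fun k q _ x y => ?_) v
    unfold oddPart
    split_ifs
    · simp
    · exact h₃ _ _ _ (hT _ _)

end

section
variable {n : ℕ} (hX : Bounded X n) (hD : D.IsFlat)
include hX hD

theorem nabla_mem_annStab (a : A) (φ : ι.AnnEnd (∀ i, X i)) (h : φ ∈ D.annStab ι) :
    (D.toConnection.onAnnEnd ι).nabla a φ ∈ D.annStab ι := by
  intro l e he
  rw [Connection.onAnnEnd_apply, LinearMap.sub_apply, Connection.onEnd_apply, map_sub, map_sub,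
    D.toCokernel_nabla hX hD, h l e he, h _ e he, h l _ (by rw [D.toCokernel_nabla hX hD, he,
    Connection.zero_right]), Connection.zero_right, sub_zero, sub_zero]

theorem nabla_mem_annNull (a : A) (φ : ι.AnnEnd (∀ i, X i)) (h : φ ∈ D.annNull ι) :
    (D.toConnection.onAnnEnd ι).nabla a φ ∈ D.annNull ι := by
  intro l e
  rw [Connection.onAnnEnd_apply, LinearMap.sub_apply, Connection.onEnd_apply, map_sub, map_sub,
    D.toCokernel_nabla hX hD, h l e, h _ e, h l _, Connection.zero_right, sub_zero, sub_zero]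

theorem op_mem_annStab {p : ℤ} {ϖ : Form R A (ι.AnnEnd (∀ i, X i))}
    (h : ϖ ∈ totalDegree A (ι.annDegree X) p) (hT : ϖ ∈ valued A (D.annStab ι)) :
    (D.onAnnEnd ι).op ϖ ∈ valued A (D.annStab ι) :=
  D.onAnnEnd_op_mem_valued ι hX h _ (D.nabla_mem_annStab ι hX hD)
    (fun k v φ _ l e _ => D.toCokernel_form hX _ _ _)
    (fun k v φ hφ l e _ => hφ l _ (D.toCokernel_form hX _ _ _)) hT

theorem op_mem_annNull {p : ℤ} {ϖ : Form R A (ι.AnnEnd (∀ i, X i))}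
    (h : ϖ ∈ totalDegree A (ι.annDegree X) p) (hT : ϖ ∈ valued A (D.annNull ι)) :
    (D.onAnnEnd ι).op ϖ ∈ valued A (D.annNull ι) :=
  D.onAnnEnd_op_mem_valued ι hX h _ (D.nabla_mem_annNull ι hX hD)
    (fun k v φ _ l e => D.toCokernel_form hX _ _ _)
    (fun k v φ hφ l e => hφ l _) hT

end

namespace Contraction
variable {D} (C : D.Contraction) (hD : D.IsFlat)

/-- The element of `A° ⊗ End(K)` induced by an element of `A° ⊗ End(X)`. -/
def red : ι.AnnEnd (∀ i, X i) →ₗ[R] ι.AnnEnd D.cokernel := ι.annMap D.toCokernel (C.sec hD)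

/-- The extension of an element of `A° ⊗ End(K)` to `A° ⊗ End(X)`. -/
def lift : ι.AnnEnd D.cokernel →ₗ[R] ι.AnnEnd (∀ i, X i) := ι.annMap (C.sec hD) D.toCokernel

theorem red_apply (φ : ι.AnnEnd (∀ i, X i)) (l : L) (x : D.cokernel) :
    (C.red ι hD φ).toHom l x = D.toCokernel (φ.toHom l (C.sec hD x)) := rfl

theorem lift_apply (κ : ι.AnnEnd D.cokernel) (l : L) (e : ∀ i, X i) :
    (C.lift ι hD κ).toHom l e = C.sec hD (κ.toHom l (D.toCokernel e)) := rfl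

theorem red_of_ne {j : ℤ} (hj : j ≠ 0) {φ : ι.AnnEnd (∀ i, X i)} (h : φ ∈ ι.annDegree X j) :
    C.red ι hD φ = 0 := by
  ext1 l
  refine LinearMap.ext fun x => ?_
  rw [red_apply]
  exact D.toCokernel_of_ne (by simpa using hj) (h l 0 _ (C.sec_mem hD x))

theorem lift_mem (κ : ι.AnnEnd D.cokernel) : C.lift ι hD κ ∈ ι.annDegree X 0 := by
  intro l i e he
  rw [lift_apply]
  by_cases hi : i = 0
  · subst hi; exact C.sec_mem hD _
  · rw [D.toCokernel_of_ne hi he, map_zero, map_zero]; exact zero_mem _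

variable {n : ℕ} (hX : Bounded X n)
include hX

theorem red_toCokernel {φ : ι.AnnEnd (∀ i, X i)} (h : φ ∈ D.annStab ι) (l : L) (e : ∀ i, X i) :
    (C.red ι hD φ).toHom l (D.toCokernel e) = D.toCokernel (φ.toHom l e) := by
  rw [red_apply, ← sub_eq_zero, ← map_sub, ← map_sub]
  exact h l _ (by rw [map_sub, C.toCokernel_sec hX, sub_self])

theorem red_eq_zero_iff {φ : ι.AnnEnd (∀ i, X i)} (h : φ ∈ D.annStab ι) :
    C.red ι hD φ = 0 ↔ φ ∈ D.annNull ι := by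
  constructor
  · intro h0 l e
    rw [← C.red_toCokernel ι hD hX h, h0]; simp
  · intro h0
    ext1 l
    refine LinearMap.ext fun x => ?_
    exact h0 l _

theorem red_lift (κ : ι.AnnEnd D.cokernel) : C.red ι hD (C.lift ι hD κ) = κ := by
  ext1 l
  refine LinearMap.ext fun x => ?_
  rw [red_apply, lift_apply, C.toCokernel_sec hX, C.toCokernel_sec hX]

theorem lift_mem_annStab (κ : ι.AnnEnd D.cokernel) : C.lift ι hD κ ∈ D.annStab ι := by
  intro l e he
  rw [lift_apply, he, map_zero, map_zero, map_zero]

theorem red_nabla (a : A) (φ : ι.AnnEnd (∀ i, X i)) (h : φ ∈ D.annStab ι) :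
    C.red ι hD ((D.toConnection.onAnnEnd ι).nabla a φ) =
      ((D.cokernelConnection hD).onAnnEnd ι).nabla a (C.red ι hD φ) := by
  ext1 l
  refine LinearMap.ext fun x => ?_
  rw [red_apply, Connection.onAnnEnd_apply, Connection.onAnnEnd_apply, LinearMap.sub_apply,
    LinearMap.sub_apply, Connection.onEnd_apply, Connection.onEnd_apply, map_sub, map_sub,
    D.toCokernel_nabla hX hD, ← C.red_toCokernel ι hD hX h l (D.nabla _ _),
    D.toCokernel_nabla hX hD, C.toCokernel_sec hX]
  rfl

/-- The reduction to `K` is a morphism of complexes. -/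
theorem red_op {p : ℤ} {ϖ : Form R A (ι.AnnEnd (∀ i, X i))}
    (h : ϖ ∈ totalDegree A (ι.annDegree X) p) (hT : ϖ ∈ valued A (D.annStab ι)) :
    map (C.red ι hD) ((D.onAnnEnd ι).op ϖ) =
      ((D.cokernelConnection hD).onAnnEnd ι).extDerivTotal (map (C.red ι hD) ϖ) := by
  have e1 : map (C.red ι hD) ((D.onAnnEnd ι).extD ϖ) =
      ((D.cokernelConnection hD).onAnnEnd ι).extD (map (C.red ι hD) ϖ) :=
    Connection.map_extD_of_mem _ (D.nabla_mem_annStab ι hX hD) hT _ _ (C.red_nabla ι hD hX)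
  -- Only the covariant derivative survives the reduction: composites that end with `ω` die in `K`,
  -- and those that begin with `ω` feed elements of `ker π` to a map preserving `ker π`.
  have hker : ∀ φ : ι.AnnEnd (∀ i, X i), φ ∈ D.annNull ι → C.red ι hD φ = 0 := fun φ hφ =>
    (C.red_eq_zero_iff ι hD hX (D.annNull_le ι hφ)).2 hφ
  have hpre : ∀ (x : EndMod R (∀ i, X i)), (∀ e, D.toCokernel (x e) = 0) →
      ∀ φ ∈ D.annStab ι, C.red ι hD (ι.annPre _ x φ) = 0 := by
    intro x hx φ hφ
    ext1 l
    refine LinearMap.ext fun e => ?_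
    exact hφ l _ (hx _)
  rw [Connection.extDerivTotal_eq_extD, D.onAnnEnd_op_of_mem ι hX h, map_sub, map_add, map_sub, e1,
    map_zsmul]
  have e2 : map (C.red ι hD) (cup (ι.annPost _) (par ϖ) (par D.form)) = 0 := by
    funext k; ext1 v
    refine cup_mem _ (LinearMap.ker (C.red ι hD)).toAddSubgroup _ _ k (fun k q _ x y => ?_) v
    refine hker _ fun l e => ?_
    change D.toCokernel (((-1 : ℤ) ^ q • D.form q y) _) = 0
    rw [LinearMap.smul_apply, map_zsmul, D.toCokernel_form hX, smul_zero]
  have e3 : map (C.red ι hD) (cup (ι.annPre _) (evenPart D.form) ϖ) = 0 := by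
    funext k; ext1 v
    refine cup_mem _ (LinearMap.ker (C.red ι hD)).toAddSubgroup _ _ k (fun k q _ x y => ?_) v
    refine hpre _ (fun e => ?_) _ (hT _ _)
    unfold evenPart
    split_ifs
    · exact D.toCokernel_form hX _ _ _
    · simp
  have e4 : map (C.red ι hD) (cup (ι.annPre _) (oddPart D.form) ϖ) = 0 := by
    funext k; ext1 v
    refine cup_mem _ (LinearMap.ker (C.red ι hD)).toAddSubgroup _ _ k (fun k q _ x y => ?_) v
    refine hpre _ (fun e => ?_) _ (hT _ _)
    unfold oddPart
    split_ifs
    · simp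
    · exact D.toCokernel_form hX _ _ _
  rw [e2, e3, e4, smul_zero, sub_zero, add_zero, sub_zero]

omit hX in
theorem map_red_mem {p : ℤ} {ϖ : Form R A (ι.AnnEnd (∀ i, X i))}
    (h : ϖ ∈ totalDegree A (ι.annDegree X) p) :
    map (C.red ι hD) ϖ ∈ formDegree R A (ι.AnnEnd D.cokernel) p := by
  intro k hk
  ext1 v
  exact C.red_of_ne ι hD (sub_ne_zero.2 (Ne.symm hk)) (h k v)

omit hX in
theorem map_lift_mem {p : ℤ} {κ : Form R A (ι.AnnEnd D.cokernel)}
    (h : κ ∈ formDegree R A (ι.AnnEnd D.cokernel) p) :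
    map (C.lift ι hD) κ ∈ totalDegree A (ι.annDegree X) p := by
  intro k v
  by_cases hk : (k : ℤ) = p
  · rw [← hk, sub_self]; exact C.lift_mem ι hD _
  · rw [map_apply, h k hk, AlternatingMap.zero_apply, map_zero]; exact zero_mem _

include C hD

/-- The complex of forms that induce zero on `K` is acyclic. -/
theorem exists_op_eq {p : ℤ} {z : Form R A (ι.AnnEnd (∀ i, X i))}
    (hz : z ∈ totalDegree A (ι.annDegree X) p) (hT : z ∈ valued A (D.annNull ι))
    (hs : (D.onAnnEnd ι).op z = 0) :
    ∃ y ∈ totalDegree A (ι.annDegree X) (p - 1), y ∈ valued A (D.annNull ι) ∧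
      (D.onAnnEnd ι).op y = z := by
  -- The number `m` bounds the form degrees of `z` from below and `j` counts the remaining steps: a
  -- component of form degree above `p + n` has endomorphism degree below `-n` and vanishes.
  suffices key : ∀ (j m : ℕ) (z : Form R A (ι.AnnEnd (∀ i, X i))),
      p + n < m + j → (∀ k < m, z k = 0) → z ∈ totalDegree A (ι.annDegree X) p →
      z ∈ valued A (D.annNull ι) → (D.onAnnEnd ι).op z = 0 →
      ∃ y ∈ totalDegree A (ι.annDegree X) (p - 1), y ∈ valued A (D.annNull ι) ∧
        (D.onAnnEnd ι).op y = z from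
    key ((p + n).toNat + 1) 0 z (by push_cast; omega) (by simp) hz hT hs
  intro j
  induction j with
  | zero =>
    intro m z hm hlow hz hT hs
    refine ⟨0, zero_mem _, zero_mem _, ?_⟩
    rw [map_zero]
    funext k
    by_cases hk : k < m
    · rw [hlow k hk]; rfl
    · ext1 v; ext1 l
      exact (hX.eq_zero_of_mem_endDegree (by push_cast at hm; omega) (hz k v l)).symm
  | succ j ih =>
    intro m z hm hlow hz hT hs
    -- The sign is chosen so that the lowest component of `s y` is `(∂h + h∂) ∘ z_m`, once
    -- closedness has moved `∂` across `z_m`. As `π z_m = 0`, this is `z_m` itself.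
    obtain ⟨y, hy⟩ : ∃ y : Form R A (ι.AnnEnd (∀ i, X i)), y = single m (((-1 : ℤ) ^ (m + 1)) •
      map ((ι.annPost _).flip C.h) z m) := ⟨_, rfl⟩
    have hyv : ∀ v l e, (y m v).toHom l e = (-1 : ℤ) ^ (m + 1) • C.h ((z m v).toHom l e) := by
      intro v l e
      rw [hy, single_same, AlternatingMap.smul_apply, map_zsmul]; rfl
    have hylow : ∀ k < m, y k = 0 := fun k hk => by rw [hy, single_of_ne _ hk.ne]
    have hydeg : y ∈ totalDegree A (ι.annDegree X) (p - 1) := by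
      rw [hy]
      refine single_mem_totalDegree fun v => zsmul_mem ?_ _
      intro l i e he
      have := C.h_mem _ _ (hz m v l i e he)
      rwa [show i + (p - m) + -1 = i + (p - 1 - m) by ring] at this
    have hyT : y ∈ valued A (D.annNull ι) := by
      rw [hy]
      refine single_mem_valued fun v => zsmul_mem ?_ _
      exact fun l e => C.toCokernel_h hX _
    have hop : (D.onAnnEnd ι).op y ∈ totalDegree A (ι.annDegree X) p := by
      have := (D.onAnnEnd ι).op_mem _ _ hydeg
      rwa [sub_add_cancel] at this
    have hlow' : ∀ k < m + 1, (z - (D.onAnnEnd ι).op y) k = 0 := by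
      intro k hk
      rcases (Nat.lt_succ_iff.1 hk).lt_or_eq with hk | rfl
      · rw [Pi.sub_apply, hlow k hk, D.onAnnEnd_op_of_lt ι hX hydeg hylow hk, sub_zero]
      · ext1 v
        ext1 l
        refine LinearMap.ext fun e => ?_
        have h0 := D.onAnnEnd_op_lowest ι hX hz hlow v l e
        rw [hs] at h0
        have h1 := C.sec_toCokernel hX hD ((z k v).toHom l e)
        rw [hT k v l e, map_zero] at h1
        rw [Pi.sub_apply, AlternatingMap.sub_apply, map_sub, LinearMap.sub_apply,
          LinearMap.sub_apply, D.onAnnEnd_op_lowest ι hX hydeg hylow, hyv, hyv, Int.negOnePow_sub, Int.negOnePow_one]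
        simp only [Pi.zero_apply, AlternatingMap.zero_apply, map_zero, LinearMap.zero_apply] at h0 ⊢
        -- The lowest component of `s z = 0`: `z_k` commutes with `∂` up to the sign of the total
        -- degree.
        have h2 : (z k v).toHom l (D.form 0 ![] e) =
            ((p.negOnePow : ℤ) * (-1) ^ k) • D.form 0 ![] ((z k v).toHom l e) := by
          rw [mul_smul, ← sub_eq_zero.1 h0.symm, smul_smul]
          rcases Int.units_eq_one_or p.negOnePow with h | h <;> simp [h]
        rw [h2, pow_succ]
        rcases Int.units_eq_one_or p.negOnePow with h | h <;>
          rcases neg_one_pow_eq_or ℤ k with h' | h' <;> simp [h, h'] <;>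
          rw [← sub_sub, sub_right_comm, ← h1]
    obtain ⟨y', hy', hyT', hopy'⟩ := ih (m + 1) (z - (D.onAnnEnd ι).op y) (by push_cast at hm ⊢; omega)
      hlow' (sub_mem hz hop) (sub_mem hT (D.op_mem_annNull ι hX hD hydeg hyT))
      (by rw [map_sub, hs, hD.onAnnEnd D ι hX, sub_zero])
    exact ⟨y + y', add_mem hydeg hy', add_mem hyT hyT', by rw [map_add, hopy']; abel⟩

/-- Every form is cohomologous to a form that induces a form on `K`, provided that its
differential induces a form on `K`. -/
theorem exists_sub_op_mem {p : ℤ} {y : Form R A (ι.AnnEnd (∀ i, X i))}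
    (hy : y ∈ totalDegree A (ι.annDegree X) p)
    (hs : (D.onAnnEnd ι).op y ∈ valued A (D.annStab ι)) :
    ∃ w ∈ totalDegree A (ι.annDegree X) (p - 1),
      y - (D.onAnnEnd ι).op w ∈ valued A (D.annStab ι) := by
  -- The same recursion, stopping earlier: components of form degree above `p` have negative
  -- endomorphism degree, hence no part in `E_0`, and preserve `ker π` trivially.
  suffices key : ∀ (j m : ℕ) (y : Form R A (ι.AnnEnd (∀ i, X i))),
      p < m + j → (∀ k < m, y k = 0) → y ∈ totalDegree A (ι.annDegree X) p →
      (D.onAnnEnd ι).op y ∈ valued A (D.annStab ι) →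
      ∃ w ∈ totalDegree A (ι.annDegree X) (p - 1),
        y - (D.onAnnEnd ι).op w ∈ valued A (D.annStab ι) from
    key (p.toNat + 1) 0 y (by push_cast; omega) (by simp) hy hs
  intro j
  induction j with
  | zero =>
    intro m y hm hlow hy hs
    refine ⟨0, zero_mem _, ?_⟩
    rw [map_zero, sub_zero]
    intro k v
    by_cases hk : k < m
    · rw [hlow k hk]; exact zero_mem _
    · intro l e _
      rw [toCokernel_apply, hX.apply_zero_of_mem_endDegree (by push_cast at hm; omega) (hy k v l),
        Submodule.Quotient.mk_zero]
  | succ j ih =>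
    intro m y hm hlow hy hs
    -- With this sign the lowest component of `s w` is `y_m ∘ h∂` modulo the image of `∂`.
    obtain ⟨w, hw⟩ : ∃ w : Form R A (ι.AnnEnd (∀ i, X i)), w = single m ((-(p.negOnePow : ℤ)) •
      map (ι.annPre _ C.h) y m) := ⟨_, rfl⟩
    have hwv : ∀ v l e, (w m v).toHom l e = (-(p.negOnePow : ℤ)) • (y m v).toHom l (C.h e) := by
      intro v l e
      rw [hw, single_same, AlternatingMap.smul_apply, map_zsmul]; rfl
    have hwlow : ∀ k < m, w k = 0 := fun k hk => by rw [hw, single_of_ne _ hk.ne]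
    have hwdeg : w ∈ totalDegree A (ι.annDegree X) (p - 1) := by
      rw [hw]
      refine single_mem_totalDegree fun v => zsmul_mem ?_ _
      intro l i e he
      have := hy m v l _ _ (C.h_mem _ _ he)
      rwa [show i + -1 + (p - m) = i + (p - 1 - m) by ring] at this
    have hop : (D.onAnnEnd ι).op w ∈ totalDegree A (ι.annDegree X) p := by
      have := (D.onAnnEnd ι).op_mem _ _ hwdeg
      rwa [sub_add_cancel] at this
    obtain ⟨y₁, hy₁⟩ : ∃ y₁, y₁ = y - (D.onAnnEnd ι).op w := ⟨_, rfl⟩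
    have hy₁deg : y₁ ∈ totalDegree A (ι.annDegree X) p := hy₁ ▸ sub_mem hy hop
    have hm₁ : ∀ v, y₁ m v ∈ D.annStab ι := by
      intro v l e he
      have h0 := D.onAnnEnd_op_lowest ι hX hy hlow v l (C.h e)
      have h1 := C.sec_toCokernel hX hD e
      rw [he, map_zero] at h1
      have h2 : D.toCokernel (((D.onAnnEnd ι).op y m v).toHom l (C.h e)) = 0 :=
        hs m v l _ (C.toCokernel_h hX e)
      rw [hy₁, Pi.sub_apply, AlternatingMap.sub_apply, map_sub, LinearMap.sub_apply,
        LinearMap.sub_apply, D.onAnnEnd_op_lowest ι hX hwdeg hwlow, hwv, hwv, Int.negOnePow_sub, Int.negOnePow_one]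
      rw [h0] at h2
      -- For `e` in `ker π`, subtracting `s w` removes the contribution of `h∂e`. That of `∂he`
      -- vanishes in `K` because `s y` preserves `ker π` and `he` lies in it.
      have h3 : e = D.form 0 ![] (C.h e) + C.h (D.form 0 ![] e) := by
        rw [← sub_eq_zero, ← sub_sub, ← h1]
      have h4 : (y m v).toHom l e = (y m v).toHom l (D.form 0 ![] (C.h e)) +
          (y m v).toHom l (C.h (D.form 0 ![] e)) := by
        rw [← map_add, ← h3]
      rw [h4]
      simp only [map_sub, map_add, map_zsmul, D.toCokernel_form hX, smul_zero, sub_zero] at h2 ⊢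
      rcases Int.units_eq_one_or p.negOnePow with h | h <;> simp [h] at h2 ⊢ <;> simp [h2]
    -- The corrected component can now be split off: it is stable and so is its image under `s`,
    -- hence the remainder, which starts in form degree `m + 1`, satisfies the same hypothesis.
    have hsdeg : single m (y₁ m) ∈ totalDegree A (ι.annDegree X) p :=
      single_mem_totalDegree fun v => hy₁deg m v
    have hsT : single m (y₁ m) ∈ valued A (D.annStab ι) := single_mem_valued hm₁
    have hlow' : ∀ k < m + 1, (y₁ - single m (y₁ m)) k = 0 := by
      intro k hk
      rcases (Nat.lt_succ_iff.1 hk).lt_or_eq with hk | rfl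
      · rw [Pi.sub_apply, single_of_ne _ hk.ne, hy₁, Pi.sub_apply, hlow k hk,
          D.onAnnEnd_op_of_lt ι hX hwdeg hwlow hk, sub_zero, sub_zero]
      · rw [Pi.sub_apply, single_same, sub_self]
    have hs' : (D.onAnnEnd ι).op (y₁ - single m (y₁ m)) ∈ valued A (D.annStab ι) := by
      rw [map_sub]
      refine sub_mem ?_ (D.op_mem_annStab ι hX hD hsdeg hsT)
      rw [hy₁, map_sub, hD.onAnnEnd D ι hX, sub_zero]
      exact hs
    obtain ⟨w', hw', hwT'⟩ := ih (m + 1) (y₁ - single m (y₁ m)) (by push_cast at hm ⊢; omega)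
      hlow' (sub_mem hy₁deg hsdeg) hs'
    refine ⟨w + w', add_mem hwdeg hw', ?_⟩
    have := add_mem hwT' hsT
    rw [sub_right_comm, sub_add_cancel, hy₁] at this
    rwa [map_add, ← sub_sub]

/-- The differential of a cocycle is zero, hence certainly stable, so the correction applies to
every class. -/
theorem exists_cocycle_annStab {p : ℤ} {z : Form R A (ι.AnnEnd (∀ i, X i))}
    (hz : z ∈ D.annEndCocycles ι p) :
    ∃ z' ∈ D.annEndCocycles ι p, z' ∈ valued A (D.annStab ι) ∧
      z' - z ∈ coboundaries (totalDegree A (ι.annDegree X)) (D.onAnnEnd ι).op p := by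
  have hz0 : (D.onAnnEnd ι).op z = 0 := hz.2
  obtain ⟨w, hw, hwT⟩ := C.exists_sub_op_mem ι hD hX hz.1 (by rw [hz0]; exact zero_mem _)
  have hop := (D.onAnnEnd ι).op_mem _ _ hw
  rw [sub_add_cancel] at hop
  refine ⟨z - (D.onAnnEnd ι).op w, ⟨sub_mem hz.1 hop, ?_⟩, hwT, -w, neg_mem hw, ?_⟩
  · change (D.onAnnEnd ι).op _ = 0
    rw [map_sub, hz0, hD.onAnnEnd D ι hX, sub_zero]
  · rw [map_neg]; abel

theorem map_red_eq_zero_iff {u : Form R A (ι.AnnEnd (∀ i, X i))}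
    (hu : u ∈ valued A (D.annStab ι)) :
    map (C.red ι hD) u = 0 ↔ u ∈ valued A (D.annNull ι) := by
  refine ⟨fun h0 k v => (C.red_eq_zero_iff ι hD hX (hu k v)).1 (congrArg (fun w => w k v) h0),
    fun h => ?_⟩
  funext k; ext1 v
  exact (C.red_eq_zero_iff ι hD hX (hu k v)).2 (h k v)

theorem map_red_map_lift (κ : Form R A (ι.AnnEnd D.cokernel)) :
    map (C.red ι hD) (map (C.lift ι hD) κ) = κ := by
  funext k; ext1 v; exact C.red_lift ι hD hX _

theorem map_lift_mem_valued (κ : Form R A (ι.AnnEnd D.cokernel)) :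
    map (C.lift ι hD) κ ∈ valued A (D.annStab ι) :=
  fun k v => C.lift_mem_annStab ι hD hX _

/-- Lifting a form along the reduction, up to its differential. -/
theorem exists_lift {p : ℤ} {κ : Form R A (ι.AnnEnd D.cokernel)}
    (hκ : κ ∈ formDegree R A (ι.AnnEnd D.cokernel) p) {u : Form R A (ι.AnnEnd (∀ i, X i))}
    (hu : u ∈ totalDegree A (ι.annDegree X) (p + 1)) (huT : u ∈ valued A (D.annStab ι))
    (hu0 : (D.onAnnEnd ι).op u = 0)
    (h : ((D.cokernelConnection hD).onAnnEnd ι).extDerivTotal κ = map (C.red ι hD) u) :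
    ∃ z ∈ totalDegree A (ι.annDegree X) p, z ∈ valued A (D.annStab ι) ∧
      map (C.red ι hD) z = κ ∧ (D.onAnnEnd ι).op z = u := by
  have hdeg := C.map_lift_mem ι hD hκ
  have hop := (D.onAnnEnd ι).op_mem _ _ hdeg
  have hT := C.map_lift_mem_valued ι hD hX κ
  have hopT := D.op_mem_annStab ι hX hD hdeg hT
  -- The naive lift of `κ` fails to have differential `u` by a cocycle that induces zero on `K`.
  -- Acyclicity provides a correction `y` that does not change the induced form.
  obtain ⟨y, hy, hyT, hy0⟩ := C.exists_op_eq ι hD hX (sub_mem hop hu)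
    ((C.map_red_eq_zero_iff ι hD hX (sub_mem hopT huT)).1 (by
      rw [map_sub, C.red_op ι hD hX hdeg hT, C.map_red_map_lift ι hD hX, h, sub_self]))
    (by rw [map_sub, hu0, hD.onAnnEnd D ι hX, sub_zero])
  rw [add_sub_cancel_right] at hy
  have hyT' : y ∈ valued A (D.annStab ι) := fun k v => D.annNull_le ι (hyT k v)
  refine ⟨map (C.lift ι hD) κ - y, sub_mem hdeg hy, sub_mem hT hyT', ?_, ?_⟩
  · rw [map_sub, C.map_red_map_lift ι hD hX, (C.map_red_eq_zero_iff ι hD hX hyT').2 hyT, sub_zero]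
  · rw [map_sub, hy0, sub_sub_cancel]

/-- A primitive upstairs has stable differential and can be made stable itself, hence reduces to
`K`; a primitive on `K` lifts by `exists_lift` with `u = z`. -/
theorem mem_coboundaries_iff {p : ℤ} {z : Form R A (ι.AnnEnd (∀ i, X i))}
    (hz : z ∈ D.annEndCocycles ι p) (hT : z ∈ valued A (D.annStab ι)) :
    z ∈ coboundaries (totalDegree A (ι.annDegree X)) (D.onAnnEnd ι).op p ↔
      map (C.red ι hD) z ∈ coboundaries (formDegree R A (ι.AnnEnd D.cokernel))
        ((D.cokernelConnection hD).onAnnEnd ι).extDerivTotal p := by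
  constructor
  · rintro ⟨w, hw, hwz⟩
    obtain ⟨w', hw', hwT'⟩ := C.exists_sub_op_mem ι hD hX hw (by rw [hwz]; exact hT)
    have hop := (D.onAnnEnd ι).op_mem _ _ hw'
    rw [sub_add_cancel] at hop
    refine ⟨map (C.red ι hD) (w - (D.onAnnEnd ι).op w'), C.map_red_mem ι hD (sub_mem hw hop), ?_⟩
    rw [← C.red_op ι hD hX (sub_mem hw hop) hwT', map_sub, hD.onAnnEnd D ι hX, sub_zero, hwz]
  · rintro ⟨κ, hκ, hκz⟩
    obtain ⟨y, hy, -, -, hyz⟩ := C.exists_lift ι hD hX hκ (by rw [sub_add_cancel]; exact hz.1) hT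
      hz.2 hκz
    exact ⟨y, hy, hyz⟩

/-- The isomorphism between the cohomology of `A° ⊗ End(X)` and that of `A° ⊗ End(K)`. -/
theorem exists_cohomology_equiv (p : ℤ) :
    ∃ Φ : D.AnnEndCohomology ι p ≃ₗ[ℝ] (D.cokernelConnection hD).AnnEndCohomology ι p,
      ∀ z : D.annEndCocycles ι p, z.1 ∈ valued A (D.annStab ι) →
        ∃ κ : (D.cokernelConnection hD).annEndCocycles ι p, κ.1 = map (C.red ι hD) z.1 ∧
          Φ (cohomologyClass z) = cohomologyClass κ := by
  -- Stable cocycles map to both sides: onto the cohomology of `E` by `exists_cocycle_annStab`, onto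
  -- that of `K` by `exists_lift` with `u = 0`. The kernels agree by `mem_coboundaries_iff`.
  obtain ⟨Z, hZ⟩ : ∃ Z : Submodule ℝ (D.annEndCocycles ι p),
    Z = (valued A (D.annStab ι)).comap (D.annEndCocycles ι p).subtype := ⟨_, rfl⟩
  have hmem : ∀ z : Z, z.1.1 ∈ valued A (D.annStab ι) := by
    rintro ⟨z, hz⟩; rw [hZ] at hz; exact hz
  obtain ⟨c, hc⟩ : ∃ c : Z →ₗ[ℝ] (D.cokernelConnection hD).annEndCocycles ι p,
      ∀ z, (c z).1 = map (C.red ι hD) z.1.1 := by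
    refine ⟨LinearMap.codRestrict _ (mapReal A (C.red ι hD) ∘ₗ Submodule.subtype _ ∘ₗ Z.subtype)
      (fun z => ⟨C.map_red_mem ι hD z.1.2.1, ?_⟩), fun _ => rfl⟩
    change ((D.cokernelConnection hD).onAnnEnd ι).extDerivTotal (map (C.red ι hD) z.1.1) = 0
    rw [← C.red_op ι hD hX z.1.2.1 (hmem z), show (D.onAnnEnd ι).op z.1.1 = 0 from z.1.2.2, map_zero]
  suffices key : ∃ Φ : D.AnnEndCohomology ι p ≃ₗ[ℝ] (D.cokernelConnection hD).AnnEndCohomology ι p,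
      ∀ z : Z, Φ (cohomologyClass z.1) = cohomologyClass (c z) by
    obtain ⟨Φ, hΦ⟩ := key
    refine ⟨Φ, fun z hz => ?_⟩
    have hz' : z ∈ Z := by rw [hZ]; exact hz
    exact ⟨c ⟨z, hz'⟩, hc _, hΦ ⟨z, hz'⟩⟩
  refine exists_linearEquiv_of_ker_eq (Z := Z) (H := D.AnnEndCohomology ι p)
    (H' := (D.cokernelConnection hD).AnnEndCohomology ι p)
    (Submodule.mkQ _ ∘ₗ Z.subtype) (Submodule.mkQ _ ∘ₗ c) ?_ ?_ ?_
  · intro x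
    obtain ⟨z, rfl⟩ := Submodule.Quotient.mk_surjective _ x
    obtain ⟨z', hz', hT, hd⟩ := C.exists_cocycle_annStab ι hD hX z.2
    exact ⟨⟨⟨z', hz'⟩, by rw [hZ]; exact hT⟩, (Submodule.Quotient.eq _).2 hd⟩
  · intro x
    obtain ⟨κ, rfl⟩ := Submodule.Quotient.mk_surjective _ x
    obtain ⟨z, hz, hT, hzκ, hz0⟩ := C.exists_lift ι hD hX κ.2.1 (zero_mem _) (zero_mem _) (map_zero _)
      (by rw [map_zero]; exact κ.2.2)
    refine ⟨⟨⟨z, hz, hz0⟩, by rw [hZ]; exact hT⟩, ?_⟩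
    exact congrArg (Submodule.Quotient.mk) (Subtype.ext ((hc _).trans hzκ))
  · intro z
    have h := C.mem_coboundaries_iff ι hD hX z.1.2 (hmem z)
    rw [← hc] at h
    have e₁ : cohomologyClass z.1 = 0 ↔ z.1.1 ∈ coboundaries _ _ p := Submodule.Quotient.mk_eq_zero _
    have e₂ : cohomologyClass (c z) = 0 ↔ (c z).1 ∈ coboundaries _ _ p :=
      Submodule.Quotient.mk_eq_zero _
    exact e₁.trans (h.trans e₂.symm)

end Contraction
end LieRinehart.Superconnection
end
end HomotopyModules

/-! ### Extensions to `L` and comparison of the Atiyah classes. -/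

namespace HomotopyModules
open Function Bundle
open scoped TensorProduct
open Form

section
variable {R A L : Type*} [CommRing R] [Algebra ℝ R] [AddCommGroup A] [Module R A]
  [AddCommGroup L] [Module R L]
  {X : ℤ → Type*} [∀ i, AddCommGroup (X i)] [∀ i, Module R (X i)]
  {gA : LieRinehart R A} {gL : LieRinehart R L}
  [∀ i, Module ℝ (X i)] [∀ i, IsScalarTower ℝ R (X i)]

namespace LieRinehart.Superconnection

/-- Superconnections extend along a Lie pair with a retraction. -/
theorem exists_extends (D : gA.Superconnection (∀ i, X i) (homogeneous R X)) (ι : Hom gA gL)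
    (r : L →ₗ[R] A) (hr : ∀ a, r (ι.toLinearMap a) = a) (N : ∀ i, gL.Connection (X i)) :
    ∃ DL : gL.Superconnection (∀ i, X i) (homogeneous R X), DL.Extends ι D := by
  refine ⟨{
    -- An `L`-connection corrected by a difference of two `A`-connections in the direction `r l`.
    -- The difference is tensorial, so the Leibniz rule persists, and for `l` in `A` only `D` is
    -- left.
    nabla := fun l e i => (N i).nabla l (e i) - (N i).nabla (ι.toLinearMap (r l)) (e i) +
      D.nabla (r l) e i
    add_left := fun l l' e => ?_
    smul_left := fun f l e => ?_
    add_right := fun l e e' => ?_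
    leibniz := fun l f e => ?_
    form := fun k => (D.form k).compLinearMap r
    form_one := by rw [D.form_one]; rfl
    nabla_mem := fun i l e he j hj => ?_
    form_mem := fun k i v e he => D.form_mem k i _ e he }, fun a e => ?_, fun k v => ?_⟩
  · funext i
    simp only [map_add, Connection.add_left, Pi.add_apply]; abel
  · funext i
    simp only [map_smul, Connection.smul_left, Pi.smul_apply, smul_add, smul_sub]
  · funext i
    simp only [Connection.add_right, Pi.add_apply]; abel
  · funext i
    simp only [Connection.leibniz, Pi.add_apply, Pi.smul_apply, smul_add, smul_sub, ι.anchor_map]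
    abel
  · simp only
    rw [he j hj, Connection.zero_right, Connection.zero_right, D.nabla_mem i _ e he j hj, sub_zero,
      add_zero]
  · funext i
    change (N i).nabla _ _ - (N i).nabla _ _ + D.nabla _ _ _ = D.nabla a e i
    rw [hr, sub_self, zero_add]
  · change D.form k (fun i => r (ι.toLinearMap (v i))) = D.form k v
    simp only [hr]

variable {D : gA.Superconnection (∀ i, X i) (homogeneous R X)}
  {DL : gL.Superconnection (∀ i, X i) (homogeneous R X)} {ι : Hom gA gL}

/-- In arity zero there are no arguments to restrict, so the form is the `∂` of `D`; in higher arity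
the degree drops. -/
theorem Extends.toCokernel_form (h : DL.Extends ι D) {n : ℕ} (hX : Bounded X n) (k : ℕ)
    (v : Fin k → L) (e : ∀ i, X i) : D.toCokernel (DL.form k v e) = 0 := by
  by_cases hk : k = 0
  · subst hk
    have := h.2 0 ![]
    rw [Subsingleton.elim (fun i : Fin 0 => _) v] at this
    rw [this]
    exact D.toCokernel_form hX _ _ _
  by_cases hk' : k = 1
  · subst hk'
    rw [DL.form_one]; simp
  refine hX.ext_homogeneous (R := R) (fun e => D.toCokernel (DL.form k v e)) (fun _ => 0) (by simp)
    (by simp) (fun i e he => ?_) e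
  by_cases hi : 0 < i
  · rw [eq_zero_of_mem_homogeneous (R := R) (hX i (Or.inr hi)) he, map_zero, map_zero]
  · exact D.toCokernel_of_ne (by omega) (DL.form_mem k i v e he)

theorem Extends.toCokernel_cup (h : DL.Extends ι D) {n : ℕ} (hX : Bounded X n)
    (w : Form R L (EndMod R (∀ i, X i))) (k : ℕ) (v : Fin k → L) (e : ∀ i, X i) :
    D.toCokernel (cup (compPairing R _) w DL.form k v e) = 0 := by
  have := cup_mem (compPairing R (∀ i, X i))
    (LinearMap.ker (D.toCokernel.compRight R (M := ∀ i, X i))).toAddSubgroup w DL.form k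
    (fun k q hkq x y => by
      change D.toCokernel ∘ₗ _ = 0
      ext1 e
      exact h.toCokernel_form hX _ _ _) v
  exact LinearMap.congr_fun (show D.toCokernel ∘ₗ _ = 0 from this) e

/-- The connection on `K` extends if the superconnection does. -/
theorem Contraction.exists_cokernelConnection_extends (C : D.Contraction) (hD : D.IsFlat) {n : ℕ}
    (hX : Bounded X n) (h : DL.Extends ι D) :
    ∃ DK : gL.Connection D.cokernel, DK.Extends ι (D.cokernelConnection hD) := by
  refine ⟨{
    nabla := fun l x => D.toCokernel (DL.nabla l (C.sec hD x))
    add_left := fun l l' e => ?_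
    smul_left := fun f l e => ?_
    add_right := fun l e e' => ?_
    leibniz := fun l f e => ?_ }, fun a x => ?_⟩
  · rw [DL.add_left, map_add]
  · rw [DL.smul_left, map_smul]
  · rw [map_add, DL.add_right, map_add]
  · rw [map_smul, DL.leibniz, map_add, map_smul, map_smul, C.toCokernel_sec hX]
  · change D.toCokernel (DL.nabla _ _) = _
    rw [h.1, D.toCokernel_nabla hX hD, C.toCokernel_sec hX]

/-- The defect of compatibility of two connections with the projection onto `K`. -/
theorem Extends.exists_defect (h : DL.Extends ι D) (hD : D.IsFlat) {n : ℕ} (hX : Bounded X n)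
    {DK : gL.Connection D.cokernel} (hK : DK.Extends ι (D.cokernelConnection hD)) :
    ∃ β : L →ₗ[R] (∀ i, X i) →ₗ[R] D.cokernel,
      (∀ l e, β l e = D.toCokernel (DL.nabla l e) - DK.nabla l (D.toCokernel e)) ∧
      ∀ a, β (ι.toLinearMap a) = 0 := by
  -- Both terms satisfy the Leibniz rule with the same anchor, so the derivative terms cancel and
  -- the difference is linear in the section.
  refine ⟨LinearMap.mk₂ R (fun l e => D.toCokernel (DL.nabla l e) - DK.nabla l (D.toCokernel e))
    (fun l l' e => ?_) (fun f l e => ?_) (fun l e e' => ?_) (fun f l e => ?_), fun l e => rfl,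
    fun a => LinearMap.ext fun e => ?_⟩
  · rw [DL.add_left, DK.add_left, map_add]; abel
  · rw [DL.smul_left, DK.smul_left, map_smul, smul_sub]
  · rw [DL.add_right, map_add, map_add, DK.add_right]; abel
  · rw [DL.leibniz, map_add, map_smul, map_smul, map_smul, DK.leibniz, smul_sub]; abel
  · change D.toCokernel (DL.nabla _ e) - DK.nabla _ _ = 0
    rw [h.1, hK, D.toCokernel_nabla hX hD, sub_self]

/-- The Atiyah form of `X` is cohomologous to a form that induces the Atiyah form of `K`. -/
theorem Contraction.exists_induces_isAtiyahForm (C : D.Contraction) (hD : D.IsFlat) {n : ℕ}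
    (hX : Bounded X n) (h : DL.Extends ι D) {DK : gL.Connection D.cokernel}
    (hK : DK.Extends ι (D.cokernelConnection hD)) {α : Form R A (ι.AnnEnd (∀ i, X i))}
    (hα : α ∈ D.annEndCocycles ι 1) (hαL : DL.IsAtiyahForm ι α) :
    ∃ z ∈ D.annEndCocycles ι 1, z ∈ valued A (D.annStab ι) ∧
      z - α ∈ coboundaries (totalDegree A (ι.annDegree X)) (D.onAnnEnd ι).op 1 ∧
      DK.IsAtiyahForm ι (map (C.red ι hD) z) := by
  obtain ⟨β, hβ, hβA⟩ := h.exists_defect hD hX hK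
  -- The defect, followed by the section, is a cochain of total degree zero; its coboundary is what
  -- separates `α` from a lift of `at_K`.
  obtain ⟨b, hb⟩ : ∃ b : ι.AnnEnd (∀ i, X i), ∀ l e, b.toHom l e = C.sec hD (β l e) :=
    ⟨.mk (LinearMap.llcomp R _ _ _ (C.sec hD) ∘ₗ β) fun a => by simp [hβA], fun l e => rfl⟩
  have hbK : ∀ l e, D.toCokernel (b.toHom l e) = β l e := fun l e => by
    rw [hb, C.toCokernel_sec hX]
  have hb0 : b ∈ ι.annDegree X 0 := by
    intro l i e he
    rw [hb]
    by_cases hi : i = 0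
    · subst hi; exact C.sec_mem hD _
    · rw [hβ, D.toCokernel_of_ne hi he, D.toCokernel_of_ne hi (DL.nabla_mem i l e he),
        Connection.zero_right, sub_zero, map_zero]
      exact zero_mem _
  have hc0 : constForm b ∈ totalDegree A (ι.annDegree X) 0 := by
    intro k v
    cases k with
    | zero => simpa [constForm] using hb0
    | succ k => exact zero_mem _
  have hop := (D.onAnnEnd ι).op_mem _ _ hc0
  rw [zero_add] at hop
  have hαv : ∀ k v l e, (α k v).toHom l e = DL.curvature (k + 1)
      (Fin.snoc (α := fun _ => L) (fun i => ι.toLinearMap (v i)) l) e := fun k v l e => by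
    rw [hαL, op_op_constForm]
  have hzdeg : α - (D.onAnnEnd ι).op (constForm b) ∈ totalDegree A (ι.annDegree X) 1 :=
    sub_mem hα.1 hop
  have hform : DL.form 0 ![] = D.form 0 ![] := by
    rw [← h.2 0 ![]]; congr 1; exact Subsingleton.elim _ _
  -- Modulo `ker π`, the component `α^(0)` is `[∇_l, ∂]`. Applied to `e` it gives `β(l, ∂e)`, and so
  -- does the component of `s b` in form degree zero.
  have hz0 : ∀ v l e, D.toCokernel (((α - (D.onAnnEnd ι).op (constForm b)) 0 v).toHom l e) = 0 := by
    intro v l e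
    rw [Pi.sub_apply, AlternatingMap.sub_apply, map_sub, LinearMap.sub_apply, LinearMap.sub_apply,
      D.onAnnEnd_op_lowest ι hX hc0 (by simp), hαv, Superconnection.curvature, Pi.add_apply,
      Pi.add_apply, Connection.curvForm_of_ne _ (by norm_num)]
    simp only [AlternatingMap.add_apply, LinearMap.add_apply, zero_add, map_sub, map_add, h.toCokernel_cup hX, map_zsmul,
      D.toCokernel_form hX, smul_zero, sub_zero, add_zero, Int.negOnePow_zero, Units.val_one, one_smul]
    have e1 : (DL.onEnd.extD DL.form 1) (Fin.snoc (α := fun _ => L)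
        (fun i => ι.toLinearMap (v i)) l) = DL.onEnd.nabla l (DL.form 0 ![]) := by
      have := congrArg (fun w => w 0 ![]) (DL.onEnd.contr_extD l DL.form)
      simp only [Pi.sub_apply, AlternatingMap.sub_apply, Connection.lie_zero_apply,
        Connection.extD_zero_apply, AlternatingMap.zero_apply, sub_zero] at this
      rw [← this, contr_apply]
      congr 1
      funext i
      fin_cases i
      rfl
    change _ - D.toCokernel (b.toHom l (D.form 0 ![] e)) = 0
    rw [e1, Connection.onEnd_apply, hform, hbK, hβ, map_sub, D.toCokernel_form hX,
      D.toCokernel_form hX, Connection.zero_right, sub_zero, sub_self]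
  -- Modulo `ker π`, `α^(1)` is the curvature of the connection of `D_L` at `(a, l)`. Moving `π`
  -- through it with `π∇_l = β(l, ·) + ∇^K_l π` yields the curvature on `K` plus terms in `β` that
  -- form exactly the covariant derivative of `b`.
  have hz1 : ∀ v l e, D.toCokernel (((α - (D.onAnnEnd ι).op (constForm b)) 1 v).toHom l e) =
      DK.curvature (ι.toLinearMap (v 0)) l (D.toCokernel e) := by
    intro v l e
    have e1 : (D.onAnnEnd ι).extD (constForm b) 1 v =
        (D.toConnection.onAnnEnd ι).nabla (v 0) b := by
      have := congrArg (fun w => w 0 ![])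
        ((D.toConnection.onAnnEnd ι).contr_extD (v 0) (constForm b))
      simp only [Pi.sub_apply, Connection.lie_zero_apply, Connection.extD_zero_apply, sub_zero] at this
      refine Eq.trans ?_ (this.trans ?_)
      · rw [contr_apply]
        change (D.toConnection.onAnnEnd ι).extD (constForm b) 1 v = _
        congr 1
        funext i
        fin_cases i
        rfl
      · rfl
    have hcontr : ∀ a : A, contr a (constForm b : Form R A (ι.AnnEnd (∀ i, X i))) = 0 := fun a => rfl
    have e2 : cup (ι.annPre _) (evenPart D.form) (constForm b) 1 v = 0 := by
      rw [cup_of_contr_eq_zero _ _ _ hcontr, map_apply]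
      have : evenPart D.form 1 = 0 := by simp [evenPart]
      rw [this, AlternatingMap.zero_apply, map_zero]
    have e3 : cup (ι.annPre _) (oddPart D.form) (constForm b) 1 v = 0 := by
      rw [cup_of_contr_eq_zero _ _ _ hcontr, map_apply]
      have : oddPart D.form 1 = 0 := by simp [oddPart, D.form_one]
      rw [this, AlternatingMap.zero_apply, map_zero]
    have e4 : D.toCokernel ((cup (ι.annPost _) (par (constForm b)) (par D.form) 1 v).toHom l e) = 0 :=
      cup_mem _ (D.annNull ι).toAddSubgroup _ _ 1 (fun k q _ x y l e => by
        change D.toCokernel (((-1 : ℤ) ^ q • D.form q y) _) = 0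
        rw [LinearMap.smul_apply, map_zsmul, D.toCokernel_form hX, smul_zero]) v l e
    have e5 : DL.onEnd.extD DL.form 2 = 0 := by
      change DL.onEnd.extDeriv (DL.form 1) = 0
      rw [DL.form_one, Connection.extDeriv_zero]
    have e6 : D.toCokernel ((α 1 v).toHom l e) =
        D.toCokernel (DL.toConnection.curvature (ι.toLinearMap (v 0)) l e) := by
      rw [hαv, Superconnection.curvature, Pi.add_apply, Pi.add_apply, e5]
      simp only [AlternatingMap.add_apply, LinearMap.add_apply, add_zero, map_add,
        h.toCokernel_cup hX]
      rfl
    have hπ : ∀ l e, D.toCokernel (DL.nabla l e) = β l e + DK.nabla l (D.toCokernel e) := by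
      intro l e; rw [hβ]; abel
    have hπA : ∀ a e, D.toCokernel (DL.nabla (ι.toLinearMap a) e) =
        DK.nabla (ι.toLinearMap a) (D.toCokernel e) := by
      intro a e; rw [hπ, hβA]; simp
    rw [Pi.sub_apply, AlternatingMap.sub_apply, map_sub, LinearMap.sub_apply, LinearMap.sub_apply,
      map_sub, e6, D.onAnnEnd_op_of_mem ι hX hc0]
    simp only [Pi.sub_apply, Pi.add_apply, Pi.smul_apply, AlternatingMap.sub_apply,
      AlternatingMap.add_apply, AlternatingMap.smul_apply, e2, e3, smul_zero, sub_zero, add_zero,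
      map_sub, LinearMap.sub_apply, e4]
    change _ - D.toCokernel (((D.onAnnEnd ι).extD (constForm b) 1 v).toHom l e) = _
    rw [e1, Connection.onAnnEnd_apply, LinearMap.sub_apply, Connection.onEnd_apply, map_sub, map_sub,
      hbK, hbK, D.toCokernel_nabla hX hD, hbK, ← hK]
    simp only [Connection.curvature, map_sub, hπA, hπ]
    rw [h.1, DK.add_right]
    abel
  have hzT : α - (D.onAnnEnd ι).op (constForm b) ∈ valued A (D.annStab ι) := by
    intro k v l e he
    by_cases hk : k = 0
    · subst hk; exact hz0 v l e
    by_cases hk' : k = 1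
    · subst hk'; rw [hz1, he]; simp [Connection.curvature, Connection.zero_right]
    · rw [toCokernel_apply, hX.apply_zero_of_mem_endDegree (by omega) (hzdeg k v l),
        Submodule.Quotient.mk_zero]
  refine ⟨α - (D.onAnnEnd ι).op (constForm b), ⟨hzdeg, ?_⟩, hzT, ⟨-constForm b, neg_mem ?_, ?_⟩, ?_, ?_⟩
  · change (D.onAnnEnd ι).op _ = 0
    rw [map_sub, hD.onAnnEnd D ι hX, show (D.onAnnEnd ι).op α = 0 from hα.2, sub_zero]
  · exact hc0
  · rw [map_neg]; abel
  · intro k hk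
    exact C.map_red_mem ι hD hzdeg k (by exact_mod_cast hk)
  · intro v l x
    rw [map_apply, C.red_apply, hz1, C.toCokernel_sec hX]

/-- Components of form degree above `p` have negative endomorphism degree. The one of form degree
`p` is the lowest possible, so closedness makes it commute with `∂` up to sign, and it therefore
preserves `ker π`. -/
theorem Contraction.mem_valued_annStab (C : D.Contraction) (hD : D.IsFlat) {n : ℕ} (hX : Bounded X n)
    {p : ℤ} {ϖ : Form R A (ι.AnnEnd (∀ i, X i))} (h : ϖ ∈ D.annEndCocycles ι p)
    (h0 : ∀ k : ℕ, (k : ℤ) < p → ϖ k = 0) : ϖ ∈ valued A (D.annStab ι) := by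
  intro k v
  rcases lt_trichotomy (k : ℤ) p with hk | hk | hk
  · rw [h0 k hk]; exact zero_mem _
  · intro l e he
    have h1 := C.sec_toCokernel hX hD e
    rw [he, map_zero, sub_sub] at h1
    have h2 := D.onAnnEnd_op_lowest ι hX h.1 (m := k) (fun j hj => h0 j (by omega)) v l (C.h e)
    rw [show (D.onAnnEnd ι).op ϖ = 0 from h.2] at h2
    have h3 := congrArg D.toCokernel h2
    simp only [Pi.zero_apply, AlternatingMap.zero_apply, map_zero, LinearMap.zero_apply, map_sub,
      map_zsmul, D.toCokernel_form hX, smul_zero, sub_zero] at h3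
    have h4 : D.toCokernel ((ϖ k v).toHom l (D.form 0 ![] (C.h e))) = 0 := by
      rcases Int.units_eq_one_or p.negOnePow with h | h <;> simpa [h] using h3.symm
    have h5 : D.toCokernel ((ϖ k v).toHom l (C.h (D.form 0 ![] e))) = 0 := by
      -- In form degree `p` the values have endomorphism degree zero, so composing with `h` gives
      -- degree `-1` and no part in `E_0`.
      have hdeg : (ϖ k v).toHom l ∘ₗ C.h ∈ endDegree R X (-1) := by
        intro i e he
        have := h.1 k v l _ _ (C.h_mem i e he)
        rwa [hk, sub_self, add_zero] at this
      rw [toCokernel_apply]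
      exact (Submodule.Quotient.mk_eq_zero _).2
        ((hX.apply_zero_of_mem_endDegree (by norm_num) hdeg (D.form 0 ![] e)) ▸ zero_mem _)
    rw [sub_eq_zero.1 h1.symm, map_add, map_add, h4, h5, add_zero]
  · intro l e he
    rw [toCokernel_apply, hX.apply_zero_of_mem_endDegree (by omega) (h.1 k v l),
      Submodule.Quotient.mk_zero]

/-- The comparison of the Atiyah classes, for a complex with a contraction in negative degrees. -/
theorem Contraction.main (C : D.Contraction) (hD : D.IsFlat) {n : ℕ} (hX : Bounded X n)
    (r : L →ₗ[R] A) (hr : ∀ a, r (ι.toLinearMap a) = a) (N : ∀ i, gL.Connection (X i)) :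
    (D.onAnnEnd ι).IsFlat ∧
    (∀ a b e, (D.cokernelConnection hD).curvature a b e = 0) ∧
    (∃ DL : gL.Superconnection (∀ i, X i) (homogeneous R X), DL.Extends ι D) ∧
    (∃ DK : gL.Connection D.cokernel, DK.Extends ι (D.cokernelConnection hD)) ∧
    (∀ p : ℤ, p < 0 → Subsingleton (D.AnnEndCohomology ι p)) ∧
    ∃ Φ : ∀ p : ℤ, D.AnnEndCohomology ι p ≃ₗ[ℝ]
        (D.cokernelConnection hD).AnnEndCohomology ι p,
      (∀ (p : ℤ) (ϖ : D.annEndCocycles ι p), (∀ k : ℕ, (k : ℤ) < p → ϖ.1 k = 0) →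
        ∃ κ : (D.cokernelConnection hD).annEndCocycles ι p,
          D.Induces ι ϖ.1 κ.1 ∧ Φ p (cohomologyClass ϖ) = cohomologyClass κ) ∧
      (∀ (DL : gL.Superconnection (∀ i, X i) (homogeneous R X)) (DK : gL.Connection D.cokernel),
        DL.Extends ι D → DK.Extends ι (D.cokernelConnection hD) →
        ∃ (α : D.annEndCocycles ι 1) (atK : (D.cokernelConnection hD).annEndCocycles ι 1),
          DL.IsAtiyahForm ι α.1 ∧ DK.IsAtiyahForm ι atK.1 ∧
            Φ 1 (cohomologyClass α) = cohomologyClass atK) := by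
  obtain ⟨DL, hDL⟩ := exists_extends D ι r hr N
  choose Φ hΦ using fun p => C.exists_cohomology_equiv ι hD hX p
  refine ⟨hD.onAnnEnd D ι hX, D.cokernelConnection_curvature hX hD, ⟨DL, hDL⟩,
    C.exists_cokernelConnection_extends hD hX hDL, fun p hp => ?_, Φ, fun p ϖ h0 => ?_,
    fun DL DK hDL hDK => ?_⟩
  -- There are no forms of negative form degree, so the target of `Φ^p` is zero.
  · have : Subsingleton ((D.cokernelConnection hD).annEndCocycles ι p) := by
      refine ⟨fun x y => Subtype.ext (funext fun k => ?_)⟩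
      rw [x.2.1 k (by omega), y.2.1 k (by omega)]
    have : Subsingleton ((D.cokernelConnection hD).AnnEndCohomology ι p) :=
      (Submodule.Quotient.mk_surjective _).subsingleton
    exact (Φ p).toEquiv.subsingleton
  · have hT := C.mem_valued_annStab hD hX ϖ.2 h0
    obtain ⟨κ, hκ, hκΦ⟩ := hΦ p ϖ hT
    refine ⟨κ, fun k v l e => ?_, hκΦ⟩
    rw [hκ, map_apply, ← D.toCokernel_single, C.red_toCokernel ι hD hX (hT k v)]
    rfl
  · obtain ⟨α, hα⟩ := hDL.exists_isAtiyahForm hD hX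
    obtain ⟨z, hz, hT, hzα, hat⟩ := C.exists_induces_isAtiyahForm hD hX hDL hDK α.2 hα
    obtain ⟨κ, hκ, hκΦ⟩ := hΦ 1 ⟨z, hz⟩ hT
    refine ⟨α, κ, hα, hκ ▸ hat, ?_⟩
    have hcl : cohomologyClass (⟨z, hz⟩ : D.annEndCocycles ι 1) = cohomologyClass α :=
      (Submodule.Quotient.eq _).2 hzα
    rw [← hκΦ, hcl]

end LieRinehart.Superconnection
end
end HomotopyModules

/-! ### Sections of vector bundles: frames, gluing, connections, left inverses. -/

namespace HomotopyModules
open Function Bundle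

section
variable {EM : Type*} [NormedAddCommGroup EM] [NormedSpace ℝ EM]
  {M : Type*} [TopologicalSpace M] [ChartedSpace EM M]
  {F : Type*} [NormedAddCommGroup F] [NormedSpace ℝ F]
  {V : M → Type*} [TopologicalSpace (TotalSpace F V)] [∀ x, TopologicalSpace (V x)]
  [∀ x, AddCommGroup (V x)] [∀ x, Module ℝ (V x)] [FiberBundle F V] [VectorBundle ℝ F V]

theorem section_sum_apply {J : Type*} (t : Finset J) (s : J → Cₛ^∞⟮𝓘(ℝ, EM); F, V⟯) (x : M) :
    (∑ j ∈ t, s j) x = ∑ j ∈ t, s j x :=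
  map_sum (AddMonoidHom.mk' (fun s : Cₛ^∞⟮𝓘(ℝ, EM); F, V⟯ => s x) fun _ _ => rfl) s t

theorem smoothFun_sum_apply {J : Type*} (t : Finset J) (s : J → SmoothFun EM M) (x : M) :
    (∑ j ∈ t, s j) x = ∑ j ∈ t, s j x :=
  map_sum (AddMonoidHom.mk' (fun s : SmoothFun EM M => s x) fun _ _ => rfl) s t

variable [FiniteDimensional ℝ EM] [IsManifold 𝓘(ℝ, EM) ∞ M] [T2Space M] [FiniteDimensional ℝ F]
  [ContMDiffVectorBundle ∞ F V 𝓘(ℝ, EM)]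

/-- Local frames, multiplied by a bump function to be defined globally. -/
theorem exists_local_frame (x₀ : M) :
    ∃ (e : Fin (Module.finrank ℝ F) → Cₛ^∞⟮𝓘(ℝ, EM); F, V⟯)
      (φ : Fin (Module.finrank ℝ F) → Cₛ^∞⟮𝓘(ℝ, EM); F, V⟯ →ₗ[SmoothFun EM M] SmoothFun EM M)
      (χ : SmoothFun EM M), χ x₀ ≠ 0 ∧ (∀ s, χ • s = ∑ j, φ j s • e j) ∧
      (∀ j k, φ j (e k) = if j = k then χ else 0) ∧ ∀ j s, s x₀ = 0 → φ j s x₀ = 0 := by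
  have : ContMDiffVectorBundle 1 F V 𝓘(ℝ, EM) := ContMDiffVectorBundle.of_le (n := ∞) (by simp)
  let T := trivializationAt F V x₀
  let b := Module.finBasis ℝ F
  have hx₀ : x₀ ∈ T.baseSet := FiberBundle.mem_baseSet_trivializationAt' x₀
  obtain ⟨ψ, -, hψ⟩ := (SmoothBumpFunction.nhds_basis_tsupport (I := 𝓘(ℝ, EM)) x₀).mem_iff.1
    (T.open_baseSet.mem_nhds hx₀)
  have hψ0 : ∀ x, x ∉ T.baseSet → ψ x = 0 := fun x hx =>
    image_eq_zero_of_notMem_tsupport fun h => hx (hψ h)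
  -- Both the frame and its coefficient functionals are cut off by the bump function `ψ`, so the
  -- expansion of a section holds after multiplication by `χ = ψ²`.
  let e : Fin (Module.finrank ℝ F) → Cₛ^∞⟮𝓘(ℝ, EM); F, V⟯ := fun j =>
    ⟨fun x => ψ x • T.localFrame b j x, ContMDiffOn.smul_section_of_tsupport
      ψ.contMDiff.contMDiffOn T.open_baseSet hψ (T.contMDiffOn_localFrame_baseSet ∞ b j)⟩
  let c := fun j => T.localFrameCoeff 𝓘(ℝ, EM) b j
  let φ : Fin (Module.finrank ℝ F) → Cₛ^∞⟮𝓘(ℝ, EM); F, V⟯ →ₗ[SmoothFun EM M] SmoothFun EM M :=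
    fun j =>
    { toFun := fun s => ⟨fun x => ψ x • c j x (s x), contMDiff_of_tsupport fun x hx =>
        ψ.contMDiffAt.smul (contMDiffAt_localFrameCoeff b
          (hψ (tsupport_smul_subset_left _ _ hx)) s.contMDiff.contMDiffAt j)⟩
      map_add' := fun s s' => by
        ext x
        change ψ x • c j x (s x + s' x) = ψ x • c j x (s x) + ψ x • c j x (s' x)
        rw [map_add, smul_add]
      map_smul' := fun r s => by
        ext x
        change ψ x • c j x (r x • s x) = r x • ψ x • c j x (s x)
        rw [map_smul, smul_comm] }
  let χ : SmoothFun EM M := ⟨fun x => ψ x * ψ x, ψ.contMDiff.mul ψ.contMDiff⟩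
  refine ⟨e, φ, χ, ?_, fun s => ?_, fun j k => ?_, fun j s hs => ?_⟩
  · change ψ x₀ * ψ x₀ ≠ 0
    rw [ψ.eq_one]; norm_num
  · ext x
    rw [section_sum_apply]
    change (ψ x * ψ x) • s x = ∑ j, (ψ x • c j x (s x)) • ψ x • T.localFrame b j x
    by_cases hx : x ∈ T.baseSet
    · have h := T.eq_sum_localFrameCoeff_smul (I := 𝓘(ℝ, EM)) (b := b) (s := s) hx
      conv_lhs => rw [h, Finset.smul_sum]
      refine Finset.sum_congr rfl fun j _ => ?_
      rw [smul_smul, smul_smul, smul_eq_mul]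
      congr 1
      ring
    · simp [hψ0 x hx]
  · ext x
    change ψ x • c j x (ψ x • T.localFrame b k x) = _
    rw [map_smul, smul_smul]
    by_cases hx : x ∈ T.baseSet
    · have h := T.localFrameCoeff_apply_of_mem_baseSet (I := 𝓘(ℝ, EM)) b hx (T.localFrame b k) j
      rw [show c j x (T.localFrame b k x) = _ from h, T.localFrame_apply_of_mem_baseSet b hx,
        Module.Basis.repr_self, Finsupp.single_apply]
      by_cases hjk : j = k
      · rw [if_pos hjk, if_pos hjk.symm, smul_eq_mul, mul_one]; rfl
      · rw [if_neg hjk, if_neg (Ne.symm hjk), smul_zero]; rfl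
    · rw [hψ0 x hx, mul_zero, zero_smul]
      split_ifs
      · change 0 = ψ x * ψ x
        rw [hψ0 x hx, mul_zero]
      · rfl
  · change ψ x₀ • c j x₀ (s x₀) = 0
    rw [hs, map_zero, smul_zero]

/-- Functionals separate the values of the sections. -/
theorem section_eq_zero_of_forall (s : Cₛ^∞⟮𝓘(ℝ, EM); F, V⟯) (x : M)
    (h : ∀ ψ : Cₛ^∞⟮𝓘(ℝ, EM); F, V⟯ →ₗ[SmoothFun EM M] SmoothFun EM M, ψ s x = 0) : s x = 0 := by
  obtain ⟨e, φ, χ, hχ, hs, -, -⟩ := exists_local_frame (EM := EM) (F := F) (V := V) x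
  have h1 := congrArg (fun s => s x) (hs s)
  simp only [section_sum_apply, section_smul_apply, h, zero_smul, Finset.sum_const_zero] at h1
  exact (smul_eq_zero.1 h1).resolve_left hχ

/-- The value at a point of the image of a section depends only on the value of the section. -/
theorem linearMap_section_eq_zero {F' : Type*} [NormedAddCommGroup F'] [NormedSpace ℝ F']
    {W : M → Type*} [TopologicalSpace (TotalSpace F' W)] [∀ x, TopologicalSpace (W x)]
    [∀ x, AddCommGroup (W x)] [∀ x, Module ℝ (W x)] [FiberBundle F' W] [VectorBundle ℝ F' W]
    (T : Cₛ^∞⟮𝓘(ℝ, EM); F, V⟯ →ₗ[SmoothFun EM M] Cₛ^∞⟮𝓘(ℝ, EM); F', W⟯)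
    {s : Cₛ^∞⟮𝓘(ℝ, EM); F, V⟯} {x : M} (h : s x = 0) : T s x = 0 := by
  obtain ⟨e, φ, χ, hχ, hs, -, h0⟩ := exists_local_frame (EM := EM) (F := F) (V := V) x
  have h1 := congrArg (fun s => T s x) (hs s)
  simp only [map_smul, map_sum, section_sum_apply, section_smul_apply, h0 _ _ h, zero_smul,
    Finset.sum_const_zero] at h1
  exact (smul_eq_zero.1 h1).resolve_left hχ

variable [SecondCountableTopology M]

omit [FiniteDimensional ℝ F] [ContMDiffVectorBundle ∞ F V 𝓘(ℝ, EM)] in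
/-- Gluing of sections. -/
theorem exists_glue (d : M → SmoothFun EM M) (hd : ∀ x, d x x ≠ 0) :
    ∃ G : (M → Cₛ^∞⟮𝓘(ℝ, EM); F, V⟯) →ₗ[SmoothFun EM M] Cₛ^∞⟮𝓘(ℝ, EM); F, V⟯,
      ∀ s, G (fun i => d i • s) = s := by
  have : LocallyCompactSpace M := ChartedSpace.locallyCompactSpace EM M
  -- The partition is subordinate to the sets where `d i` does not vanish, so the weights `g i / d
  -- i` are smooth. They undo the factors `d i` of solutions that are correct only up to a multiple.
  obtain ⟨g, hg⟩ := SmoothPartitionOfUnity.exists_isSubordinate 𝓘(ℝ, EM) isClosed_univ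
    (fun i => {x | d i x ≠ 0}) (fun i => isOpen_ne_fun (d i).contMDiff.continuous continuous_const)
    (fun x _ => Set.mem_iUnion.2 ⟨x, hd x⟩)
  have hw : ∀ i, ContMDiff 𝓘(ℝ, EM) 𝓘(ℝ, ℝ) ∞ fun x => g i x • (d i x)⁻¹ := fun i =>
    g.contMDiff_smul fun x hx => ((d i).contMDiff.contMDiffAt).inv₀ (hg i hx)
  have hlf : ∀ s : M → Cₛ^∞⟮𝓘(ℝ, EM); F, V⟯,
      LocallyFinite fun i => {x : M | (g i x • (d i x)⁻¹) • s i x ≠ 0} := fun s =>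
    g.locallyFinite.subset fun i x hx => by
      intro h
      exact hx (by rw [h, zero_smul, zero_smul])
  have hfin : ∀ (s : M → Cₛ^∞⟮𝓘(ℝ, EM); F, V⟯) x,
      (support fun i => (g i x • (d i x)⁻¹) • s i x).Finite := fun s x => (hlf s).point_finite x
  refine ⟨{
    toFun := fun s => ⟨fun x => ∑ᶠ i, (g i x • (d i x)⁻¹) • s i x,
      ContMDiff.finsum_section_of_locallyFinite (hlf s) fun i =>
        (hw i).smul_section (s i).contMDiff⟩
    map_add' := fun s s' => ?_
    map_smul' := fun f s => ?_ }, fun s => ?_⟩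
  · ext x
    change ∑ᶠ i, (g i x • (d i x)⁻¹) • (s i x + s' i x) = _ + _
    simp only [smul_add]
    exact finsum_add_distrib (hfin s x) (hfin s' x)
  · ext x
    change ∑ᶠ i, (g i x • (d i x)⁻¹) • (f x • s i x) = f x • _
    simp only [smul_comm _ (f x)]
    exact (smul_finsum' (f x) (hfin s x)).symm
  · ext x
    change ∑ᶠ i, (g i x • (d i x)⁻¹) • (d i x • s x) = s x
    have h : ∀ i, (g i x • (d i x)⁻¹) • (d i x • s x) = g i x • s x := by
      intro i
      by_cases hi : d i x = 0
      · have : g i x = 0 := image_eq_zero_of_notMem_tsupport fun h => hg i h hi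
        rw [this, zero_smul, zero_smul, zero_smul]
      · rw [smul_smul, smul_eq_mul, mul_assoc, inv_mul_cancel₀ hi, mul_one]
    simp only [h]
    rw [← finsum_smul' (g.locallyFinite.point_finite x), g.sum_eq_one (Set.mem_univ x), one_smul]

/-- Connections exist. -/
theorem exists_connection {L : Type*} [AddCommGroup L] [Module (SmoothFun EM M) L]
    (gL : LieRinehart (SmoothFun EM M) L) : Nonempty (gL.Connection Cₛ^∞⟮𝓘(ℝ, EM); F, V⟯) := by
  choose e φ χ hχ hs _ _ using exists_local_frame (EM := EM) (F := F) (V := V)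
  obtain ⟨G, hG⟩ := exists_glue (F := F) (V := V) χ hχ
  refine ⟨{
    -- The local connections differentiate the coefficients in a frame.
    nabla := fun l s => G fun i => ∑ j, gL.anchor l (φ i j s) • e i j
    add_left := fun l l' s => ?_
    smul_left := fun f l s => ?_
    add_right := fun l s s' => ?_
    leibniz := fun l f s => ?_ }⟩
  · rw [← map_add]
    congr 1
    funext i
    simp only [map_add, Derivation.add_apply, add_smul, Finset.sum_add_distrib, Pi.add_apply]
  · rw [← map_smul]
    congr 1
    funext i
    simp only [map_smul, Derivation.smul_apply, Pi.smul_apply, Finset.smul_sum, smul_assoc]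
  · rw [← map_add]
    congr 1
    funext i
    simp only [map_add, add_smul, Finset.sum_add_distrib, Pi.add_apply]
  -- Locally the Leibniz term comes out as `ρ(l)(f) χ s`, since the frame only reproduces `χ s`; the
  -- gluing map removes `χ`.
  · have h1 : gL.anchor l f • s = G (gL.anchor l f • fun i => χ i • s) := by rw [map_smul, hG]
    rw [h1, ← map_smul, ← map_add]
    congr 1
    funext i
    simp only [map_smul, smul_eq_mul, Derivation.leibniz, Pi.smul_apply, Pi.add_apply,
      Finset.smul_sum, add_smul, Finset.sum_add_distrib, hs, smul_smul]
    congr 1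
    refine Finset.sum_congr rfl fun j _ => ?_
    rw [mul_comm]

/-- A linear map on sections that is injective on the fibres has a left inverse. -/
theorem exists_leftInverse {N : Type*} [AddCommGroup N] [Module (SmoothFun EM M) N]
    (T : Cₛ^∞⟮𝓘(ℝ, EM); F, V⟯ →ₗ[SmoothFun EM M] N)
    (hT : ∀ x s, (∀ ψ : N →ₗ[SmoothFun EM M] SmoothFun EM M, ψ (T s) x = 0) → s x = 0) :
    ∃ S : N →ₗ[SmoothFun EM M] Cₛ^∞⟮𝓘(ℝ, EM); F, V⟯, ∀ s, S (T s) = s := by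
  suffices key : ∀ x₀ : M, ∃ (S : N →ₗ[SmoothFun EM M] Cₛ^∞⟮𝓘(ℝ, EM); F, V⟯)
      (d : SmoothFun EM M), d x₀ ≠ 0 ∧ ∀ s, S (T s) = d • s by
    choose S d hd hS using key
    obtain ⟨G, hG⟩ := exists_glue (F := F) (V := V) d hd
    refine ⟨G ∘ₗ LinearMap.pi S, fun s => ?_⟩
    rw [LinearMap.comp_apply]
    convert hG s using 2
    funext i
    exact hS i s
  intro x₀
  obtain ⟨e, φ, χ, hχ, hs, hφe, h0⟩ := exists_local_frame (EM := EM) (F := F) (V := V) x₀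
  -- The values at `x₀` that linear functionals on `N` can take on the images of the frame.
  let U : Submodule ℝ (Fin (Module.finrank ℝ F) → ℝ) :=
    { carrier := {c | ∃ ψ : N →ₗ[SmoothFun EM M] SmoothFun EM M, ∀ j, ψ (T (e j)) x₀ = c j}
      add_mem' := by
        rintro _ _ ⟨ψ, h⟩ ⟨ψ', h'⟩
        exact ⟨ψ + ψ', fun j => congrArg₂ (· + ·) (h j) (h' j)⟩
      zero_mem' := ⟨0, fun j => rfl⟩
      smul_mem' := by
        rintro a _ ⟨ψ, h⟩
        refine ⟨algebraMap ℝ (SmoothFun EM M) a • ψ, fun j => ?_⟩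
        change a * ψ (T (e j)) x₀ = a * _
        rw [h] }
  have hU : U = ⊤ := by
    by_contra hne
    obtain ⟨f, hf, hUf⟩ := Submodule.exists_le_ker_of_lt_top U (lt_top_iff_ne_top.2 hne)
    apply hf
    -- A relation satisfied by all of `U` gives a constant combination of the frame whose image is
    -- killed by all functionals at `x₀`. By hypothesis it vanishes at `x₀`, so all its coefficients
    -- are zero.
    let c : Fin (Module.finrank ℝ F) → ℝ := fun j => f (Pi.single j 1)
    have hfc : ∀ v, f v = ∑ j, v j * c j := fun v => by
      conv_lhs => rw [pi_eq_sum_univ' v, map_sum]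
      refine Finset.sum_congr rfl fun j _ => ?_
      rw [map_smul, smul_eq_mul]
    let s : Cₛ^∞⟮𝓘(ℝ, EM); F, V⟯ := ∑ j, algebraMap ℝ (SmoothFun EM M) (c j) • e j
    have hs0 : s x₀ = 0 := hT x₀ s fun ψ => by
      have := hUf (show (fun j => ψ (T (e j)) x₀) ∈ U from ⟨ψ, fun j => rfl⟩)
      rw [LinearMap.mem_ker, hfc] at this
      simp only [s, map_sum, map_smul, smoothFun_sum_apply]
      rw [← this]
      refine Finset.sum_congr rfl fun j _ => ?_
      exact mul_comm (c j) _
    have hc : c = 0 := by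
      funext k
      have := h0 k s hs0
      simp only [s, map_sum, map_smul, hφe, smoothFun_sum_apply] at this
      rw [Finset.sum_eq_single k (fun j _ hj => by rw [if_neg hj.symm, smul_zero]; rfl)
        (fun h => absurd (Finset.mem_univ k) h), if_pos rfl] at this
      exact (mul_eq_zero.1 (show c k * χ x₀ = 0 from this)).resolve_right hχ
    refine LinearMap.ext fun v => ?_
    rw [hfc, hc]; simp
  have hψ : ∀ i, ∃ ψ : N →ₗ[SmoothFun EM M] SmoothFun EM M, ∀ j, ψ (T (e j)) x₀ =
      (Pi.single i 1 : Fin (Module.finrank ℝ F) → ℝ) j := fun i =>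
    show (Pi.single i 1 : Fin (Module.finrank ℝ F) → ℝ) ∈ U by rw [hU]; trivial
  choose ψ hψ using hψ
  -- Functionals dual to the images of the frame at `x₀` give a matrix of functions that is the
  -- identity there.
  let m : Matrix (Fin (Module.finrank ℝ F)) (Fin (Module.finrank ℝ F)) (SmoothFun EM M) :=
    Matrix.of fun i j => ψ i (T (e j))
  have hdet : m.det x₀ = 1 := by
    let ev : SmoothFun EM M →+* ℝ :=
      { toFun := fun f => f x₀
        map_one' := rfl
        map_mul' := fun _ _ => rfl
        map_zero' := rfl
        map_add' := fun _ _ => rfl }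
    change ev m.det = 1
    have h1 : ev.mapMatrix m = 1 := by
      ext i j
      change ψ i (T (e j)) x₀ = _
      rw [hψ, Matrix.one_apply, Pi.single_apply]
      simp only [eq_comm]
    rw [RingHom.map_det, h1, Matrix.det_one]
  -- The adjugate inverts the matrix up to its determinant without division. The result is a left
  -- inverse up to `det · χ`, which is nonzero at `x₀`, as the gluing requires.
  refine ⟨χ • ∑ i, ∑ j, (m.adjugate i j • ψ j).smulRight (e i), m.det * χ, ?_, fun s => ?_⟩
  · change m.det x₀ * χ x₀ ≠ 0
    rw [hdet, one_mul]; exact hχ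
  · rw [LinearMap.smul_apply, ← map_smul, ← map_smul, hs, mul_smul, hs, map_sum, map_sum,
      Finset.smul_sum]
    refine Finset.sum_congr rfl fun k _ => ?_
    rw [map_smul, map_smul, smul_comm]
    congr 1
    simp only [LinearMap.sum_apply, LinearMap.smulRight_apply, LinearMap.smul_apply, smul_eq_mul]
    have hadj : ∀ i, ∑ j, m.adjugate i j * ψ j (T (e k)) = m.det * (if i = k then 1 else 0) := by
      intro i
      have := congrFun (congrFun m.adjugate_mul i) k
      rw [Matrix.mul_apply, Matrix.smul_apply, Matrix.one_apply, smul_eq_mul] at this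
      exact this
    simp only [← Finset.sum_smul, hadj]
    rw [Finset.sum_eq_single k (fun i _ hi => by rw [if_neg hi, mul_zero, zero_smul])
      (fun h => absurd (Finset.mem_univ k) h), if_pos rfl, mul_one]

end
end HomotopyModules

/-! ### Existence of the retraction and of the contraction. -/

namespace HomotopyModules
open Function Bundle

section
variable {R A : Type*} [CommRing R] [Algebra ℝ R] [AddCommGroup A] [Module R A]
  {gA : LieRinehart R A} {X : ℤ → Type*} [∀ i, AddCommGroup (X i)] [∀ i, Module R (X i)]
  [∀ i, Module ℝ (X i)] [∀ i, IsScalarTower ℝ R (X i)]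
  {D : gA.Superconnection (∀ i, X i) (homogeneous R X)}

/-- A contraction is built degree by degree, from the lowest one up. -/
theorem nonempty_contraction (hD : D.IsFlat) {n : ℕ} (hX : Bounded X n)
    (hstep : ∀ m : ℤ, m < 0 → ∀ P : X m →ₗ[R] X m,
      (∀ f, P (D.diff (m - 1) m f) = D.diff (m - 1) m f) →
      ∃ (a : X (m + 1) →ₗ[R] X m) (b : X m →ₗ[R] X m),
        ∀ e, a (D.diff m (m + 1) e) + b (P e) = e) : Nonempty D.Contraction := by
  -- The contraction identity is extended by one degree at a time. It holds below `-n` because the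
  -- modules are zero there.
  have key : ∀ k : ℕ, ∃ h ∈ endDegree R X (-1), ∀ i < 0, i < -(n : ℤ) + k →
      ∀ e ∈ homogeneous R X i, D.form 0 ![] (h e) + h (D.form 0 ![] e) = e := by
    intro k
    induction k with
    | zero =>
      refine ⟨0, zero_mem _, fun i _ hi e he => ?_⟩
      rw [eq_zero_of_mem_homogeneous (R := R) (hX i (Or.inl (by simpa using hi))) he]
      simp only [map_zero, add_zero]
    | succ k ih =>
      obtain ⟨h, hmem, hdiff⟩ := ih
      obtain ⟨m, hm⟩ : ∃ m, m = -(n : ℤ) + k := ⟨_, rfl⟩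
      rw [← hm] at hdiff
      by_cases hm0 : m < 0
      swap
      · exact ⟨h, hmem, fun i hi _ => hdiff i hi (by omega)⟩
      have hsingle : ∀ i j : ℤ, j = i - 1 → ∀ x : X i,
          h (Pi.single i x) = Pi.single j (h (Pi.single i x) j) := fun i j hj x => by
        subst hj
        exact eq_single_of_mem_homogeneous (R := R) (hmem i _ (single_mem_homogeneous i x))
      -- This is `∂h` on `X m`, already determined by the components constructed so far. The
      -- identity one degree lower, composed with `∂`, says that it fixes coboundaries.
      let P : X m →ₗ[R] X m := LinearMap.proj m ∘ₗ D.form 0 ![] ∘ₗ h ∘ₗ LinearMap.single R X m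
      have hP : ∀ x : X m, P x = D.diff (m - 1) m (h (Pi.single m x) (m - 1)) := fun x => by
        change D.form 0 ![] (h (Pi.single m x)) m = _
        rw [hsingle m (m - 1) rfl x, D.diff_single (m - 1) m (by ring), Pi.single_eq_same,
          Pi.single_eq_same]
      have hPd : ∀ f, P (D.diff (m - 1) m f) = D.diff (m - 1) m f := fun f => by
        have h1 := congrArg (D.form 0 ![]) (hdiff (m - 1) (by omega) (by omega) _
          (single_mem_homogeneous (m - 1) f))
        rw [map_add, hD.form_zero_form_zero, zero_add, D.diff_single (m - 1) m (by ring)] at h1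
        have h2 := congrFun h1 m
        rwa [Pi.single_eq_same] at h2
      obtain ⟨a, b, hab⟩ := hstep m hm0 P hPd
      -- As `∂∂ = 0` and `P` fixes coboundaries, `b` fixes them too. Hence `bP = ∂h`, and `a∂ + bP =
      -- 1` becomes the contraction identity with `a` as the next component of `h`.
      have hbd : ∀ f, b (D.diff (m - 1) m f) = D.diff (m - 1) m f := fun f => by
        have h1 := hab (D.diff (m - 1) m f)
        have h2 := hD.form_zero_form_zero (Pi.single (m - 1) f)
        rw [D.diff_single (m - 1) m (by ring), D.diff_single m (m + 1) rfl,
          Pi.single_eq_zero_iff] at h2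
        rwa [h2, map_zero, zero_add, hPd] at h1
      -- Adding `g` replaces the component of `h` on `X (m + 1)` by `a`. The identities in degrees
      -- below `m` do not involve this component.
      let g : X (m + 1) →ₗ[R] X m := a - LinearMap.proj m ∘ₗ h ∘ₗ LinearMap.single R X (m + 1)
      let h' : EndMod R (∀ i, X i) := h + LinearMap.single R X m ∘ₗ g ∘ₗ LinearMap.proj (m + 1)
      have hh' : ∀ e, h' e = h e + Pi.single m (g (e (m + 1))) := fun e => rfl
      have hlow : ∀ i, i ≠ m + 1 → ∀ e ∈ homogeneous R X i, h' e = h e := fun i hi e he => by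
        rw [hh', he (m + 1) hi.symm, map_zero, Pi.single_zero, add_zero]
      refine ⟨h', ?_, fun i hi hik e he => ?_⟩
      · intro i e he
        by_cases hi : i = m + 1
        · subst hi
          rw [hh']
          refine add_mem (hmem _ e he) ?_
          have := single_mem_homogeneous (R := R) (X := X) m (g (e (m + 1)))
          rwa [show m + 1 + -1 = m by ring]
        · rw [hlow i hi e he]
          exact hmem i e he
      · rw [hlow i (by omega) e he]
        by_cases him : i = m
        · subst him
          rw [eq_single_of_mem_homogeneous (R := R) he, D.diff_single i (i + 1) rfl, hh',
            Pi.single_eq_same, hsingle (i + 1) i (by ring), ← Pi.single_add,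
            hsingle i (i - 1) rfl, D.diff_single (i - 1) i (by ring), ← Pi.single_add]
          congr 1
          change _ + (_ + (a _ - h (Pi.single _ _) i)) = _
          rw [add_sub_cancel]
          have h1 := hab (e i)
          rw [hP, hbd] at h1
          rw [add_comm]
          simpa only [Pi.single_eq_same] using h1
        · have h1 : D.form 0 ![] e ∈ homogeneous R X (i + 1) := by
            rw [eq_single_of_mem_homogeneous (R := R) he, D.diff_single i (i + 1) rfl]
            exact single_mem_homogeneous _ _
          rw [hlow (i + 1) (by omega) _ h1]
          exact hdiff i hi (by omega) e he
  obtain ⟨h, hmem, hdiff⟩ := key n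
  exact ⟨⟨h, hmem, fun i hi => hdiff i hi (by omega)⟩⟩

end

section
variable {EM : Type*} [NormedAddCommGroup EM] [NormedSpace ℝ EM] [FiniteDimensional ℝ EM]
  {M : Type*} [TopologicalSpace M] [ChartedSpace EM M] [IsManifold 𝓘(ℝ, EM) ∞ M]
  [T2Space M] [SecondCountableTopology M]

/-- An injective morphism of vector bundles has a left inverse. -/
theorem LiePair.exists_retraction
    {FA : Type*} [NormedAddCommGroup FA] [NormedSpace ℝ FA] [FiniteDimensional ℝ FA]
    {VA : M → Type*} [TopologicalSpace (TotalSpace FA VA)] [∀ x, TopologicalSpace (VA x)]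
    [∀ x, AddCommGroup (VA x)] [∀ x, Module ℝ (VA x)] [FiberBundle FA VA] [VectorBundle ℝ FA VA]
    [ContMDiffVectorBundle ∞ FA VA 𝓘(ℝ, EM)]
    {FL : Type*} [NormedAddCommGroup FL] [NormedSpace ℝ FL] [FiniteDimensional ℝ FL]
    {VL : M → Type*} [TopologicalSpace (TotalSpace FL VL)] [∀ x, TopologicalSpace (VL x)]
    [∀ x, AddCommGroup (VL x)] [∀ x, Module ℝ (VL x)] [FiberBundle FL VL] [VectorBundle ℝ FL VL]
    [ContMDiffVectorBundle ∞ FL VL 𝓘(ℝ, EM)]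
    {𝒜 : LieAlgebroid EM FA VA} {ℒ : LieAlgebroid EM FL VL} (ι : LiePair 𝒜 ℒ) :
    ∃ r : Cₛ^∞⟮𝓘(ℝ, EM); FL, VL⟯ →ₗ[SmoothFun EM M] Cₛ^∞⟮𝓘(ℝ, EM); FA, VA⟯,
      ∀ a, r (ι.toHom.toLinearMap a) = a := by
  refine exists_leftInverse ι.toHom.toLinearMap fun x s hs => ?_
  have h : ι.incl x (s x) = 0 := section_eq_zero_of_forall (ι.toHom.toLinearMap s) x hs
  exact ι.incl_injective x (h.trans (map_zero _).symm)

variable {F₀ : Type*} [NormedAddCommGroup F₀] [NormedSpace ℝ F₀]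
  {V₀ : M → Type*} [TopologicalSpace (TotalSpace F₀ V₀)] [∀ x, TopologicalSpace (V₀ x)]
  [∀ x, AddCommGroup (V₀ x)] [∀ x, Module ℝ (V₀ x)] [FiberBundle F₀ V₀] [VectorBundle ℝ F₀ V₀]
  {F₁ : Type*} [NormedAddCommGroup F₁] [NormedSpace ℝ F₁] [FiniteDimensional ℝ F₁]
  {V₁ : M → Type*} [TopologicalSpace (TotalSpace F₁ V₁)] [∀ x, TopologicalSpace (V₁ x)]
  [∀ x, AddCommGroup (V₁ x)] [∀ x, Module ℝ (V₁ x)] [FiberBundle F₁ V₁] [VectorBundle ℝ F₁ V₁]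
  [ContMDiffVectorBundle ∞ F₁ V₁ 𝓘(ℝ, EM)]
  {F₂ : Type*} [NormedAddCommGroup F₂] [NormedSpace ℝ F₂] [FiniteDimensional ℝ F₂]
  {V₂ : M → Type*} [TopologicalSpace (TotalSpace F₂ V₂)] [∀ x, TopologicalSpace (V₂ x)]
  [∀ x, AddCommGroup (V₂ x)] [∀ x, Module ℝ (V₂ x)] [FiberBundle F₂ V₂] [VectorBundle ℝ F₂ V₂]
  [ContMDiffVectorBundle ∞ F₂ V₂ 𝓘(ℝ, EM)]

/-- In a complex that is exact on the fibres, an endomorphism that is the identity on the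
coboundaries determines, together with the differential, every section. -/
theorem exists_contraction_step
    (S : Cₛ^∞⟮𝓘(ℝ, EM); F₀, V₀⟯ →ₗ[SmoothFun EM M] Cₛ^∞⟮𝓘(ℝ, EM); F₁, V₁⟯)
    (T : Cₛ^∞⟮𝓘(ℝ, EM); F₁, V₁⟯ →ₗ[SmoothFun EM M] Cₛ^∞⟮𝓘(ℝ, EM); F₂, V₂⟯)
    (hST : ∀ x, fiberKernel T x = fiberImage S x)
    (P : Cₛ^∞⟮𝓘(ℝ, EM); F₁, V₁⟯ →ₗ[SmoothFun EM M] Cₛ^∞⟮𝓘(ℝ, EM); F₁, V₁⟯)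
    (hP : ∀ f, P (S f) = S f) :
    ∃ (a : Cₛ^∞⟮𝓘(ℝ, EM); F₂, V₂⟯ →ₗ[SmoothFun EM M] Cₛ^∞⟮𝓘(ℝ, EM); F₁, V₁⟯)
      (b : Cₛ^∞⟮𝓘(ℝ, EM); F₁, V₁⟯ →ₗ[SmoothFun EM M] Cₛ^∞⟮𝓘(ℝ, EM); F₁, V₁⟯),
      ∀ e, a (T e) + b (P e) = e := by
  -- The pair `(T, P)` is injective on fibres: a vector in the fibre kernel of `T` is the value of
  -- some `S f`, which `P` fixes, so it vanishes if `P` kills it. The two components of a left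
  -- inverse are `a` and `b`.
  obtain ⟨c, hc⟩ := exists_leftInverse (T.prod P) fun x s hs => by
    have h1 : T s x = 0 := section_eq_zero_of_forall _ x fun ψ => hs (ψ ∘ₗ LinearMap.fst _ _ _)
    have h2 : P s x = 0 := section_eq_zero_of_forall _ x fun ψ => hs (ψ ∘ₗ LinearMap.snd _ _ _)
    have h3 : s x ∈ fiberKernel T x := ⟨s, rfl, h1⟩
    rw [hST] at h3
    obtain ⟨f, hf⟩ := h3
    have h4 := linearMap_section_eq_zero P (s := S f - s) (x := x) (sub_eq_zero.2 hf)
    rw [map_sub, hP] at h4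
    rw [← hf, sub_eq_zero.1 (show S f x - P s x = 0 from h4), h2]
  refine ⟨c ∘ₗ LinearMap.inl _ _ _, c ∘ₗ LinearMap.inr _ _ _, fun e => ?_⟩
  conv_rhs => rw [← hc e]
  rw [LinearMap.comp_apply, LinearMap.comp_apply, ← map_add]
  congr 1
  simp

end
end HomotopyModules

/-! ### The theorem for vector bundles. -/

set_option maxHeartbeats 1000000 in
theorem mainTheorem2
    {EM : Type*} [NormedAddCommGroup EM] [NormedSpace ℝ EM] [FiniteDimensional ℝ EM]
    {M : Type*} [TopologicalSpace M] [ChartedSpace EM M] [IsManifold 𝓘(ℝ, EM) ∞ M]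
    [T2Space M] [SecondCountableTopology M]
    {FA : Type*} [NormedAddCommGroup FA] [NormedSpace ℝ FA] [FiniteDimensional ℝ FA]
    {VA : M → Type*} [TopologicalSpace (Bundle.TotalSpace FA VA)] [∀ x, TopologicalSpace (VA x)]
    [∀ x, AddCommGroup (VA x)] [∀ x, Module ℝ (VA x)] [FiberBundle FA VA] [VectorBundle ℝ FA VA]
    [ContMDiffVectorBundle ∞ FA VA 𝓘(ℝ, EM)]
    {FL : Type*} [NormedAddCommGroup FL] [NormedSpace ℝ FL] [FiniteDimensional ℝ FL]
    {VL : M → Type*} [TopologicalSpace (Bundle.TotalSpace FL VL)] [∀ x, TopologicalSpace (VL x)]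
    [∀ x, AddCommGroup (VL x)] [∀ x, Module ℝ (VL x)] [FiberBundle FL VL] [VectorBundle ℝ FL VL]
    [ContMDiffVectorBundle ∞ FL VL 𝓘(ℝ, EM)]
    (𝒜 : LieAlgebroid EM FA VA) (ℒ : LieAlgebroid EM FL VL) (ι : LiePair 𝒜 ℒ)
    {FE : ℤ → Type*} [∀ i, NormedAddCommGroup (FE i)] [∀ i, NormedSpace ℝ (FE i)]
    [∀ i, FiniteDimensional ℝ (FE i)]
    {E : ℤ → M → Type*} [∀ i, TopologicalSpace (Bundle.TotalSpace (FE i) (E i))]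
    [∀ i x, TopologicalSpace (E i x)] [∀ i x, AddCommGroup (E i x)] [∀ i x, Module ℝ (E i x)]
    [∀ i, FiberBundle (FE i) (E i)] [∀ i, VectorBundle ℝ (FE i) (E i)]
    [∀ i, ContMDiffVectorBundle ∞ (FE i) (E i) 𝓘(ℝ, EM)]
    (n : ℕ) (hE : ∀ i : ℤ, i < -(n : ℤ) ∨ 0 < i → ∀ x, Subsingleton (E i x))
    (D : 𝒜.toLieRinehart.Superconnection (∀ i, Cₛ^∞⟮𝓘(ℝ, EM); FE i, E i⟯)
      (homogeneous (SmoothFun EM M) fun i => Cₛ^∞⟮𝓘(ℝ, EM); FE i, E i⟯))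
    (hD : D.IsFlat)
    (hreg : ∀ (i : ℤ) (x y : M), Module.finrank ℝ (fiberImage (D.diff i (i + 1)) x) =
      Module.finrank ℝ (fiberImage (D.diff i (i + 1)) y))
    (hexact : ∀ i : ℤ, i < 0 → ∀ x : M,
      fiberKernel (D.diff i (i + 1)) x = fiberImage (D.diff (i - 1) i) x) :
    (D.onAnnEnd ι.toHom).IsFlat ∧
    (∀ a b e, (D.cokernelConnection hD).curvature a b e = 0) ∧
    (∃ DL : ℒ.toLieRinehart.Superconnection (∀ i, Cₛ^∞⟮𝓘(ℝ, EM); FE i, E i⟯)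
        (homogeneous (SmoothFun EM M) fun i => Cₛ^∞⟮𝓘(ℝ, EM); FE i, E i⟯),
      DL.Extends ι.toHom D) ∧
    (∃ DK : ℒ.toLieRinehart.Connection D.cokernel,
      DK.Extends ι.toHom (D.cokernelConnection hD)) ∧
    (∀ p : ℤ, p < 0 → Subsingleton (D.AnnEndCohomology ι.toHom p)) ∧
    ∃ Φ : ∀ p : ℤ, D.AnnEndCohomology ι.toHom p ≃ₗ[ℝ]
        (D.cokernelConnection hD).AnnEndCohomology ι.toHom p,
      (∀ (p : ℤ) (ϖ : D.annEndCocycles ι.toHom p), (∀ k : ℕ, (k : ℤ) < p → ϖ.1 k = 0) →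
        ∃ κ : (D.cokernelConnection hD).annEndCocycles ι.toHom p,
          D.Induces ι.toHom ϖ.1 κ.1 ∧ Φ p (cohomologyClass ϖ) = cohomologyClass κ) ∧
      (∀ (DL : ℒ.toLieRinehart.Superconnection (∀ i, Cₛ^∞⟮𝓘(ℝ, EM); FE i, E i⟯)
            (homogeneous (SmoothFun EM M) fun i => Cₛ^∞⟮𝓘(ℝ, EM); FE i, E i⟯))
          (DK : ℒ.toLieRinehart.Connection D.cokernel),
        DL.Extends ι.toHom D → DK.Extends ι.toHom (D.cokernelConnection hD) →
        ∃ (α : D.annEndCocycles ι.toHom 1)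
          (atK : (D.cokernelConnection hD).annEndCocycles ι.toHom 1),
          DL.IsAtiyahForm ι.toHom α.1 ∧ DK.IsAtiyahForm ι.toHom atK.1 ∧
            Φ 1 (cohomologyClass α) = cohomologyClass atK) := by
  have hX : Bounded (fun i => Cₛ^∞⟮𝓘(ℝ, EM); FE i, E i⟯) n := fun i hi =>
    ⟨fun s s' => ContMDiffSection.ext fun x => (hE i hi x).elim _ _⟩
  obtain ⟨r, hr⟩ := ι.exists_retraction
  -- Fibrewise exactness is used only here; after this the retraction, the contraction and arbitrary
  -- `L`-connections on the `E_i` suffice.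
  obtain ⟨C⟩ := nonempty_contraction hD hX fun m hm P hP =>
    exists_contraction_step (D.diff (m - 1) m) (D.diff m (m + 1)) (hexact m hm) P hP
  exact C.main (ι := ι.toHom) hD hX r hr fun i => (exists_connection ℒ.toLieRinehart).some
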